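/- Let $g>1$ be real and $n\ge 1$. For real $\lambda$ put $$\hat K(\lambda)=\Gamma\bigl(i\lambda+\tfrac g2\bigr)\Gamma\bigl(-i\lambda+\tfrac g2\bigr),\qquad \hat w(\lambda)=\frac{1}{\Gamma(i\lambda)\,\Gamma(-i\lambda+g)},\qquad \hat\mu(\lambda)=\hat w(\lambda)\hat w(-\lambda),$$ where $1/\Gamma$ is the entire reciprocal Gamma function, and for $\gamma\in\mathbb R^m$, $\lambda\in\mathbb R^k$ put $\hat\mu(\gamma)=\prod_{1\le i<j\le m}\hat\mu(\gamma_i-\gamma_j)$, $\hat K(\lambda,\gamma)=\prod_{i=1}^k\prod_{a=1}^m\hat K(\lambda_i-\gamma_a)$, $\hat d_m=\frac{1}{m!}(2\pi\Gamma(g))^{-m}$ and, for $x\in\mathbb C$, $$\hat{\mathcal K}_x(\lambda,\gamma)=e^{2\pi i x(\sum_i\lambda_i-\sum_a\gamma_a)}\,\hat K(\lambda,\gamma)\,\hat\mu(\gamma).$$ The Baxter operator and the raising operator are $$(\hat Q_m(x)f)(\lambda)=\hat d_m\int_{\mathbb R^m}\hat{\mathcal K}_x(\lambda,\gamma)f(\gamma)\,d\gamma\quad(\lambda\in\mathbb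 R^m),\qquad (\hat\Lambda_m(x)f)(\lambda)=\hat d_{m-1}\int_{\mathbb R^{m-1}}\hat{\mathcal K}_x(\lambda,\gamma)f(\gamma)\,d\gamma\quad(\lambda\in\mathbb R^m).$$ For $\boldsymbol x=(x_1,\dots,x_n)\in\mathbb R^n$ and $\lambda\in\mathbb R^n$ the Mellin--Barnes wave function is $$\hat\Psi_\lambda(\boldsymbol x)=\hat\Lambda_n(x_n)\cdots\hat\Lambda_2(x_2)\,e^{2\pi i\lambda_1x_1}.$$ For $1\le r\le n$ the rational Ruijsenaars--Macdonald operator is $$(\hat M_rF)(\lambda)=(-1)^{r(n-1)}\sum_{\substack{I\subset\{1,\dots,n\}\\|I|=r}}\ \prod_{i\in I,\,j\notin I}\frac{\lambda_i-\lambda_j-i(1-g)}{\lambda_i-\lambda_j}\;F(\lambda-i\,\mathbf 1_I),$$ where the $i$ that is not an index is the imaginary unit and $\mathbf 1_I$ is the indicator vector of $I$. Then, for every $\boldsymbol x\in\mathbb R^n$, all the integrals defining $\hat\Psi_\lambda(\boldsymbol x)$, $\lambda\in\mathbb R^n$, converge absolutely, and: 1. The function $\lambda\mapsto\hat\Psi_\lambda(\boldsymbol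 x)$ extends (uniquely) to a holomorphic function on $\{\lambda\in\mathbb C^n:\ |\operatorname{Im}(\lambda_i-\lambda_j)|<g\ \text{for all } i,j\}$, and the extension, still denoted $\hat\Psi_\lambda(\boldsymbol x)$, satisfies, for $r=1,\dots,n$, $$\hat M_r\,\hat\Psi_\lambda(\boldsymbol x)=e_r\bigl(e^{2\pi x_1},\dots,e^{2\pi x_n}\bigr)\,\hat\Psi_\lambda(\boldsymbol x)$$ at every $\lambda\in\mathbb C^n$ with pairwise distinct coordinates and $|\operatorname{Im}(\lambda_i-\lambda_j)|<g-1$ for all $i,j$ (in particular at every $\lambda\in\mathbb R^n$ with pairwise distinct coordinates), where $e_r$ is the $r$-th elementary symmetric function. 2. For every $x\in\mathbb C$ with $|\operatorname{Im}x|<\tfrac12$ and every $\lambda\in\mathbb R^n$, the integral $\hat Q_n(x)\hat\Psi_\lambda(\boldsymbol x)$ converges absolutely and $$\hat Q_n(x)\,\hat\Psi_\lambda(\boldsymbol x)=\prod_{j=1}^n\bigl(2\cosh\pi(x-x_j)\bigr)^{-g}\;\hat\Psi_\lambda(\boldsymbol x),$$ with the principal branch of the power. -/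

import Mathlib

noncomputable section

namespace RationalRuijsenaars

/-- The rational kernel function `Γ(iλ + g/2) Γ(-iλ + g/2)`. -/
def hatK (g l : ℝ) : ℂ :=
  Complex.Gamma (Complex.I * l + g / 2) * Complex.Gamma (-(Complex.I * l) + g / 2)

/-- The rational weight function `1 / (Γ(iλ) Γ(-iλ + g))`. Mathlib's `Gamma` takes the value `0`
at its poles, so `(Gamma z)⁻¹` is the entire function `1/Γ`; in particular `hatW g 0 = 0`. -/
def hatW (g l : ℝ) : ℂ :=
  (Complex.Gamma (Complex.I * l))⁻¹ * (Complex.Gamma (-(Complex.I * l) + g))⁻¹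

/-- The rational measure function of one variable. -/
def hatMu (g l : ℝ) : ℂ := hatW g l * hatW g (-l)

/-- The measure function of `n` variables, a product over pairs `i < j`. -/
def hatMuProd (g : ℝ) {n : ℕ} (l : Fin n → ℝ) : ℂ :=
  ∏ i, ∏ j ∈ Finset.Ioi i, hatMu g (l i - l j)

/-- The kernel function of `n + m` variables. -/
def hatKProd (g : ℝ) {n m : ℕ} (l : Fin n → ℝ) (c : Fin m → ℝ) : ℂ :=
  ∏ i, ∏ a, hatK g (l i - c a)

/-- The normalizing constant `(2π Γ(g))⁻ⁿ / n!`. -/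
def hatD (n : ℕ) (g : ℝ) : ℂ :=
  1 / (n.factorial : ℂ) * ((2 * Real.pi * Complex.Gamma g) ^ n)⁻¹

/-- The common form of the kernels of the Baxter operators (`m = n`) and of the raising operators
(`n = m + 1`). -/
def hatKernel (g : ℝ) {n m : ℕ} (l : Fin n → ℝ) (c : Fin m → ℝ) (z : ℂ) : ℂ :=
  Complex.exp (2 * Real.pi * Complex.I * z * ((∑ i, (l i : ℂ)) - ∑ a, (c a : ℂ)))
    * hatKProd g l c * hatMuProd g c

/-- The rational Baxter operator. -/
def baxter (g : ℝ) (n : ℕ) (z : ℂ) (f : (Fin n → ℝ) → ℂ) (l : Fin n → ℝ) : ℂ :=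
  hatD n g * ∫ c : Fin n → ℝ, hatKernel g l c z * f c

/-- The raising operator, from functions of `m` variables to functions of `m + 1` variables. -/
def raising (g : ℝ) (m : ℕ) (z : ℂ) (f : (Fin m → ℝ) → ℂ) (l : Fin (m + 1) → ℝ) : ℂ :=
  hatD m g * ∫ c : Fin m → ℝ, hatKernel g l c z * f c

/-- The Mellin–Barnes wave function, `wave g n x l` with spatial variables `x` and spectral
variables `l`. -/
def wave (g : ℝ) : (n : ℕ) → (Fin n → ℝ) → (Fin n → ℝ) → ℂ
  | 0, _, _ => 1
  | 1, x, l => Complex.exp (2 * Real.pi * Complex.I * l 0 * x 0)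
  | m + 2, x, l =>
      raising g (m + 1) (x (Fin.last (m + 1)) : ℂ) (wave g (m + 1) (Fin.init x)) l

/-- All the integrals in the iterative definition of the wave function converge absolutely. -/
def WaveConverges (g : ℝ) : (n : ℕ) → (Fin n → ℝ) → Prop
  | 0, _ => True
  | 1, _ => True
  | m + 2, x => WaveConverges g (m + 1) (Fin.init x) ∧
      ∀ l : Fin (m + 2) → ℝ, MeasureTheory.Integrable (fun c : Fin (m + 1) → ℝ =>
        hatKernel g l c (x (Fin.last (m + 1)) : ℂ) * wave g (m + 1) (Fin.init x) c)

/-- The open convex set of all `λ ∈ ℂⁿ` with `|Im (λᵢ - λⱼ)| < a` for all `i, j`. -/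
def tube (n : ℕ) (a : ℝ) : Set (Fin n → ℂ) :=
  {l | ∀ i j, |(l i - l j).im| < a}

/-- `F` is holomorphic on `tube n g` and restricts to the wave function on `ℝⁿ`. -/
def IsWaveContinuation (g : ℝ) (n : ℕ) (x : Fin n → ℝ) (F : (Fin n → ℂ) → ℂ) : Prop :=
  DifferentiableOn ℂ F (tube n g) ∧ ∀ l : Fin n → ℝ, F (fun i => (l i : ℂ)) = wave g n x l

/-- The rational Ruijsenaars–Macdonald operator of order `r`. -/
def macdonald (g : ℝ) (n r : ℕ) (F : (Fin n → ℂ) → ℂ) (l : Fin n → ℂ) : ℂ :=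
  (-1) ^ (r * (n - 1)) * ∑ I ∈ Finset.powersetCard r (Finset.univ : Finset (Fin n)),
    (∏ i ∈ I, ∏ j ∈ Iᶜ, (l i - l j - Complex.I * (1 - g)) / (l i - l j))
      * F (fun k => if k ∈ I then l k - Complex.I else l k)

/-- The Calogero–Sutherland kernel function `(2 cosh πz)^(-g)`, principal branch. -/
def kernelK (g : ℝ) (z : ℂ) : ℂ := (2 * Complex.cosh (Real.pi * z)) ^ (-(g : ℂ))

end RationalRuijsenaars

end

open RationalRuijsenaars

/-! ### Growth of the Gamma function on vertical strips. -/

noncomputable section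

namespace RationalRuijsenaars

/-! The proof rests on an energy inequality, two finite determinant identities and contour shifts.

Growth. On vertical strips the Gamma function behaves like `exp(-π|Im s|/2)` up to powers. Hence the
product of the `K̂` is of size `exp(-π crossEnergy)` and the measure of size `exp(2π pairEnergy)`.
The wave functions satisfy the bound `exp(-π pairEnergy)`, again up to powers (`HasWaveBound`): by
`energy_le_crossEnergy_succ` the raising operator reproduces this bound, so induction on the number
of variables (`waveC_properties`) gives convergence and holomorphy for `|Im λ_k| < g/2`. A common
translation of all `λ_k` only multiplies the wave function by an exponential (`waveC_add`), which
enlarges this strip to the tube.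

Difference equations. All orders `r` are treated at once through a generating function in `v`, with
shifts by `±i/2`. A half-shifted `K̂` is a common factor times an entry of a Cauchy matrix, and the
Macdonald coefficients are ratios of Vandermonde products. The action in `λ` on the raising kernel
is therefore one bordered Cauchy determinant expanded by rows; its expansion by columns is the
corresponding action in `γ`, times `1 + v exp(2πx_n)` up to normalization (`sum_subsets_duality`,
`sum_macCoeff_kernelC`). A contour shift, possible because `g > 1`, moves the shifts from the kernel
to the wave function of one variable fewer, where induction applies (`sum_macCoeff_waveC`).

Baxter operator. As a function of `z`, the integral of the Baxter kernel against the wave function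
satisfies a first-order linear differential equation (`baxter_ode`): a second determinant identity,
`sum_subsets_eq_zero`, is combined with the difference equations. The product of the `(2 cosh π(z -
x_j))^(-g)` satisfies the same equation, so the two differ by a factor independent of `z`
(`exists_baxter_eq_mul`). This factor is read off as `z → +∞`. The contour is moved close to the
poles, a Cauchy determinant splits the integrand into simple fractions, antisymmetry makes the `n!`
terms equal, and an Abelian theorem proved by Fourier inversion evaluates the limit as a residue
(`tendsto_exp_mul_baxter`). This works for distinct `λ_k`; continuity gives the rest. -/

open Complex in
/-- The quotient `|Γ(s)| / Γ(Re s)` does not decrease when `s` moves to the right. -/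
theorem norm_Gamma_mul_le {s : ℂ} (hs : 0 < s.re) {c : ℝ} (hc : 0 ≤ c) :
    ‖Complex.Gamma s‖ * Real.Gamma (s.re + c) ≤ ‖Complex.Gamma (s + c)‖ * Real.Gamma s.re := by
  rcases hc.eq_or_lt with rfl | hc
  · simp
  have h1 := Complex.Gamma_mul_Gamma_eq_betaIntegral hs (t := (c : ℂ)) (by simpa using hc)
  have h2 := Complex.Gamma_mul_Gamma_eq_betaIntegral (s := (s.re : ℂ)) (t := (c : ℂ))
    (by simpa using hs) (by simpa using hc)
  -- For real `c` the modulus of the beta integrand depends only on `s.re`. The claim is then the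
  -- quotient of the two identities `Γ(s)Γ(c) = Γ(s+c)B(s,c)`, at `s` and at `s.re`.
  have hbeta : ‖betaIntegral s c‖ ≤ ‖betaIntegral (s.re : ℂ) c‖ := by
    have hreal : betaIntegral (s.re : ℂ) c =
        ((∫ x : ℝ in (0 : ℝ)..1, x ^ (s.re - 1) * (1 - x) ^ (c - 1) : ℝ) : ℂ) := by
      rw [betaIntegral, ← intervalIntegral.integral_ofReal]
      refine intervalIntegral.integral_congr_ae (Filter.Eventually.of_forall fun x hx => ?_)
      rw [Set.uIoc_of_le zero_le_one] at hx
      push_cast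
      rw [ofReal_cpow hx.1.le, ofReal_cpow (by linarith [hx.2])]
      push_cast; rfl
    have hle : ‖betaIntegral s c‖ ≤ ∫ x : ℝ in (0 : ℝ)..1, x ^ (s.re - 1) * (1 - x) ^ (c - 1) := by
      rw [betaIntegral]
      refine (intervalIntegral.norm_integral_le_integral_norm zero_le_one).trans (le_of_eq ?_)
      refine intervalIntegral.integral_congr_ae ?_
      have : ∀ᵐ x : ℝ, x ≠ 1 := by simp [MeasureTheory.ae_iff]
      filter_upwards [this] with x hx1 hx
      rw [Set.uIoc_of_le zero_le_one] at hx
      have h1x : 0 < 1 - x := by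
        have := lt_of_le_of_ne hx.2 hx1
        linarith
      rw [norm_mul, norm_cpow_eq_rpow_re_of_pos hx.1]
      have : (1 - (x : ℂ)) = ((1 - x : ℝ) : ℂ) := by push_cast; rfl
      rw [this, norm_cpow_eq_rpow_re_of_pos h1x]
      simp
    refine hle.trans ?_
    rw [hreal, norm_real]
    exact le_abs_self _
  have e1 : ‖Complex.Gamma s‖ * Real.Gamma c = ‖Complex.Gamma (s + c)‖ * ‖betaIntegral s c‖ := by
    rw [← norm_mul, ← h1, norm_mul, Complex.Gamma_ofReal, norm_real,
      Real.norm_of_nonneg (Real.Gamma_pos_of_pos hc).le]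
  have e2 : Real.Gamma s.re * Real.Gamma c =
      Real.Gamma (s.re + c) * ‖betaIntegral (s.re : ℂ) c‖ := by
    have := congrArg norm h2
    rw [norm_mul, norm_mul, Complex.Gamma_ofReal, Complex.Gamma_ofReal, ← ofReal_add,
      Complex.Gamma_ofReal, norm_real, norm_real, norm_real,
      Real.norm_of_nonneg (Real.Gamma_pos_of_pos hc).le,
      Real.norm_of_nonneg (Real.Gamma_pos_of_pos hs).le,
      Real.norm_of_nonneg (Real.Gamma_pos_of_pos (by positivity)).le] at this
    exact this
  have hcpos := Real.Gamma_pos_of_pos hc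
  have hspos := Real.Gamma_pos_of_pos (show 0 < s.re + c by positivity)
  refine le_of_mul_le_mul_right ?_ hcpos
  calc ‖Complex.Gamma s‖ * Real.Gamma (s.re + c) * Real.Gamma c
      = (‖Complex.Gamma (s + c)‖ * Real.Gamma (s.re + c)) * ‖betaIntegral s c‖ := by
        rw [mul_right_comm, e1]; ring
    _ ≤ (‖Complex.Gamma (s + c)‖ * Real.Gamma (s.re + c)) * ‖betaIntegral (s.re : ℂ) c‖ := by
        gcongr
    _ = ‖Complex.Gamma (s + c)‖ * Real.Gamma s.re * Real.Gamma c := by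
        rw [mul_assoc ‖_‖ (Real.Gamma s.re), e2]; ring

/-- On the line `Re s = 1/2` the reflection `s ↦ 1 - s` is complex conjugation, so the reflection
formula computes the squared modulus exactly. -/
theorem norm_sq_Gamma_half_add (y : ℝ) :
    ‖Complex.Gamma (1 / 2 + y * Complex.I)‖ ^ 2 = Real.pi / Real.cosh (Real.pi * y) := by
  have h := Complex.Gamma_mul_Gamma_one_sub (1 / 2 + y * Complex.I)
  have hc : (1 : ℂ) - (1 / 2 + y * Complex.I) = (starRingEnd ℂ) (1 / 2 + y * Complex.I) := by
    apply Complex.ext <;> simp; norm_num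
  rw [hc, Complex.Gamma_conj, Complex.mul_conj] at h
  have hs : Complex.sin (Real.pi * (1 / 2 + y * Complex.I)) = (Real.cosh (Real.pi * y) : ℂ) := by
    rw [show (Real.pi : ℂ) * (1 / 2 + y * Complex.I)
      = (Real.pi * y : ℂ) * Complex.I + Real.pi / 2 by ring, Complex.sin_add_pi_div_two,
      Complex.cos_mul_I]
    push_cast; rfl
  rw [hs, Complex.normSq_eq_norm_sq] at h
  exact_mod_cast h

/-- The constant 3 is convenient: `3²/2` exceeds `π`. -/
theorem norm_Gamma_half_add_le (y : ℝ) :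
    ‖Complex.Gamma (1 / 2 + y * Complex.I)‖ ≤ 3 * Real.exp (-(Real.pi / 2 * |y|)) := by
  refine (pow_le_pow_iff_left₀ (by positivity) (by positivity) two_ne_zero).1 ?_
  rw [norm_sq_Gamma_half_add, mul_pow, ← Real.exp_nat_mul, ← Real.cosh_abs, abs_mul,
    abs_of_pos Real.pi_pos, div_le_iff₀ (Real.cosh_pos _), Real.cosh_eq]
  have h1 : Real.exp (((2 : ℕ) : ℝ) * -(Real.pi / 2 * |y|)) * Real.exp (Real.pi * |y|) = 1 := by
    rw [← Real.exp_add, ← Real.exp_zero]; congr 1; push_cast; ring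
  have h2 := Real.exp_pos (((2 : ℕ) : ℝ) * -(Real.pi / 2 * |y|))
  have h3 := Real.exp_pos (-(Real.pi * |y|))
  have := Real.pi_lt_four
  nlinarith [mul_pos h2 h3]

theorem le_norm_Gamma_half_add (y : ℝ) :
    Real.exp (-(Real.pi / 2 * |y|)) ≤ ‖Complex.Gamma (1 / 2 + y * Complex.I)‖ := by
  refine (pow_le_pow_iff_left₀ (by positivity) (by positivity) two_ne_zero).1 ?_
  rw [norm_sq_Gamma_half_add, ← Real.exp_nat_mul, ← Real.cosh_abs, abs_mul,
    abs_of_pos Real.pi_pos, le_div_iff₀ (Real.cosh_pos _), Real.cosh_eq]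
  have h1 : Real.exp (((2 : ℕ) : ℝ) * -(Real.pi / 2 * |y|)) * Real.exp (Real.pi * |y|) = 1 := by
    rw [← Real.exp_add, ← Real.exp_zero]; congr 1; push_cast; ring
  have h2 : Real.exp (((2 : ℕ) : ℝ) * -(Real.pi / 2 * |y|)) ≤ 1 := by
    rw [Real.exp_le_one_iff]; push_cast; nlinarith [Real.pi_pos, abs_nonneg y]
  have h3 : Real.exp (-(Real.pi * |y|)) ≤ 1 := by
    rw [Real.exp_le_one_iff]; nlinarith [Real.pi_pos, abs_nonneg y]
  have h4 := Real.exp_pos (((2 : ℕ) : ℝ) * -(Real.pi / 2 * |y|))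
  have h5 := Real.exp_pos (-(Real.pi * |y|))
  have := Real.pi_gt_three
  nlinarith

theorem Gamma_add_nat (s : ℂ) (hs : ∀ k : ℕ, s ≠ -k) (N : ℕ) :
    Complex.Gamma (s + N) = (∏ k ∈ Finset.range N, (s + k)) * Complex.Gamma s := by
  induction N with
  | zero => simp
  | succ N ih =>
    rw [Finset.prod_range_succ, Nat.cast_succ, ← add_assoc, Complex.Gamma_add_one, ih]
    · ring
    · intro h
      exact hs N (eq_neg_of_add_eq_zero_left h)

theorem norm_prod_add_nat_le (s : ℂ) {A : ℝ} (hA : |s.re| ≤ A) (N : ℕ) :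
    ‖∏ k ∈ Finset.range N, (s + k)‖ ≤ ((A + N + 1) * (1 + |s.im|)) ^ N := by
  rw [norm_prod]
  refine (Finset.prod_le_prod (g := fun _ => (A + N + 1) * (1 + |s.im|)) (fun _ _ => norm_nonneg _)
    fun k hk => ?_).trans (by simp)
  have hk' : (k : ℝ) ≤ N := by exact_mod_cast (Finset.mem_range.1 hk).le
  have hk0 : (0 : ℝ) ≤ k := k.cast_nonneg
  have hA0 := (abs_nonneg _).trans hA
  calc ‖s + k‖ ≤ ‖s‖ + ‖(k : ℂ)‖ := norm_add_le _ _
    _ ≤ (|s.re| + |s.im|) + k := by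
      gcongr
      · exact Complex.norm_le_abs_re_add_abs_im s
      · simp
    _ ≤ (A + N + 1) * (1 + |s.im|) := by nlinarith [abs_nonneg s.im]

/-- By `norm_Gamma_mul_le`, `|Γ(s)|` is controlled by its value further right, on the line `Re = 1/2
+ N`. From there the functional equation leads back to the line `1/2`, at the price of a polynomial
of degree `N`. -/
theorem exists_norm_Gamma_le {a b : ℝ} (ha : 0 < a) :
    ∃ C : ℝ, ∃ N : ℕ, 0 ≤ C ∧ ∀ s : ℂ, a ≤ s.re → s.re ≤ b →
      ‖Complex.Gamma s‖ ≤ C * (1 + |s.im|) ^ N * Real.exp (-(Real.pi / 2 * |s.im|)) := by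
  obtain ⟨N, hN⟩ := exists_nat_ge b
  obtain ⟨B, hB⟩ := (isCompact_Icc (a := a) (b := b)).exists_bound_of_continuousOn
    (f := Real.Gamma) (fun x hx => (Real.differentiableAt_Gamma (fun m => by
      have : (0 : ℝ) ≤ m := m.cast_nonneg
      have := hx.1
      intro h; linarith)).continuousAt.continuousWithinAt)
  set G := Real.Gamma (1 / 2 + N) with hG
  have hG0 : 0 < G := Real.Gamma_pos_of_pos (by positivity)
  refine ⟨|B| * (1 / 2 + N + 1) ^ N * 3 / G, N, by positivity, fun s h1 h2 => ?_⟩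
  have hs : 0 < s.re := ha.trans_le h1
  have key := norm_Gamma_mul_le hs (c := 1 / 2 + N - s.re) (by linarith)
  have e1 : s.re + (1 / 2 + N - s.re) = 1 / 2 + N := by ring
  have e2 : s + ((1 / 2 + N - s.re : ℝ) : ℂ) = (1 / 2 + s.im * Complex.I) + (N : ℕ) := by
    apply Complex.ext <;> simp
  rw [e1, e2, Gamma_add_nat, norm_mul] at key
  · have hp := norm_prod_add_nat_le (1 / 2 + s.im * Complex.I) (A := 1 / 2) (by simp) N
    have hb : Real.Gamma s.re ≤ |B| :=
      (le_abs_self _).trans ((hB s.re ⟨h1, h2⟩).trans (le_abs_self _))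
    have hg0 := Real.Gamma_pos_of_pos hs
    have hh := norm_Gamma_half_add_le s.im
    simp only [one_div, Complex.add_im, Complex.mul_im, Complex.ofReal_re, Complex.I_im, mul_one,
      Complex.ofReal_im, Complex.I_re, mul_zero, add_zero] at hp
    have him : ((2 : ℂ)⁻¹).im = 0 := by simp
    rw [him, zero_add] at hp
    rw [div_mul_eq_mul_div, div_mul_eq_mul_div, le_div_iff₀ hG0]
    refine key.trans ?_
    rw [one_div] at *
    calc _ ≤ (((2 : ℝ)⁻¹ + N + 1) * (1 + |s.im|)) ^ N * (3 * Real.exp (-(Real.pi / 2 * |s.im|)))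
          * |B| := by gcongr
      _ = _ := by rw [mul_pow]; ring
  · intro k h
    have := congrArg Complex.re h
    simp at this
    have hk : (0 : ℝ) ≤ k := k.cast_nonneg
    linarith

/-- The comparison now runs from `Re = 1/2` to `Re s + N ≥ 1/2`, bounding `|Γ(s + N)|` from below.
No positivity of `a` is needed because `1/Γ` is entire. -/
theorem exists_norm_Gamma_inv_le (a b : ℝ) :
    ∃ C : ℝ, ∃ N : ℕ, 0 ≤ C ∧ ∀ s : ℂ, a ≤ s.re → s.re ≤ b →
      ‖(Complex.Gamma s)⁻¹‖ ≤ C * (1 + |s.im|) ^ N * Real.exp (Real.pi / 2 * |s.im|) := by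
  obtain ⟨N, hN⟩ := exists_nat_ge (1 / 2 - a)
  obtain ⟨B, hB⟩ := (isCompact_Icc (a := a) (b := b)).exists_bound_of_continuousOn
    (f := fun x => (Real.Gamma (x + N))⁻¹) (fun x hx => by
      have hx0 : 0 < x + N := by linarith [hx.1]
      refine ContinuousAt.continuousWithinAt (ContinuousAt.inv₀ ?_
        (Real.Gamma_pos_of_pos hx0).ne')
      refine ContinuousAt.comp' (f := fun x : ℝ => x + N)
        (Real.differentiableAt_Gamma (fun m => ?_)).continuousAt (by fun_prop)
      have : (0 : ℝ) ≤ m := m.cast_nonneg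
      intro h; linarith)
  set G := Real.Gamma (1 / 2) with hG
  have hG0 : 0 < G := Real.Gamma_pos_of_pos (by positivity)
  set A := max |a| |b|
  refine ⟨|B| * (A + N + 1) ^ N * G, N, by positivity, fun s h1 h2 => ?_⟩
  by_cases hpole : ∀ k : ℕ, s ≠ -k
  · have hA : |s.re| ≤ A := abs_le_max_abs_abs h1 h2
    have hx0 : 0 < s.re + N := by linarith
    have key := norm_Gamma_mul_le (s := 1 / 2 + s.im * Complex.I) (by simp)
      (c := s.re + N - 1 / 2) (by linarith)
    have e1 : (1 / 2 + s.im * Complex.I).re = 1 / 2 := by simp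
    have e3 : (1 / 2 + s.im * Complex.I) + ((s.re + N - 1 / 2 : ℝ) : ℂ) = s + (N : ℕ) := by
      conv_rhs => rw [← Complex.re_add_im s]
      push_cast; ring
    rw [e1, e3, add_sub_cancel, Gamma_add_nat s hpole, norm_mul] at key
    have hp := norm_prod_add_nat_le s hA N
    have hb : (Real.Gamma (s.re + N))⁻¹ ≤ |B| :=
      (le_abs_self _).trans ((hB s.re ⟨h1, h2⟩).trans (le_abs_self _))
    have hh := le_norm_Gamma_half_add s.im
    have hgs : 0 < ‖Complex.Gamma s‖ := norm_pos_iff.2 (Complex.Gamma_ne_zero hpole)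
    have hgN := Real.Gamma_pos_of_pos hx0
    rw [norm_inv, inv_le_iff_one_le_mul₀ hgs]
    have hexp : Real.exp (Real.pi / 2 * |s.im|) * Real.exp (-(Real.pi / 2 * |s.im|)) = 1 := by
      rw [← Real.exp_add]; simp
    calc (1 : ℝ) = Real.exp (Real.pi / 2 * |s.im|) * (Real.Gamma (s.re + N))⁻¹ *
          (Real.exp (-(Real.pi / 2 * |s.im|)) * Real.Gamma (s.re + N)) := by
          rw [mul_mul_mul_comm, hexp, inv_mul_cancel₀ hgN.ne', one_mul]
      _ ≤ Real.exp (Real.pi / 2 * |s.im|) * (Real.Gamma (s.re + N))⁻¹ *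
          (‖Complex.Gamma (1 / 2 + s.im * Complex.I)‖ * Real.Gamma (s.re + N)) := by gcongr
      _ ≤ Real.exp (Real.pi / 2 * |s.im|) * (Real.Gamma (s.re + N))⁻¹ *
          (‖∏ k ∈ Finset.range N, (s + k)‖ * ‖Complex.Gamma s‖ * G) := by gcongr
      _ ≤ Real.exp (Real.pi / 2 * |s.im|) * |B| *
          (((A + N + 1) * (1 + |s.im|)) ^ N * ‖Complex.Gamma s‖ * G) := by gcongr
      _ = _ := by rw [mul_pow]; ring
  -- At a pole `Gamma` has the default value `0`, so the inverse is `0`, the true value of `1/Γ`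
  -- there.
  · push Not at hpole
    obtain ⟨k, rfl⟩ := hpole
    rw [Complex.Gamma_neg_nat_eq_zero, inv_zero, norm_zero]
    positivity

end RationalRuijsenaars

end

/-! ### Energy inequalities for configurations on the line. -/

noncomputable section

namespace RationalRuijsenaars

open MeasureTheory

/-- The sum of the distances between the points of a configuration on the line. -/
def pairEnergy {n : ℕ} (t : Fin n → ℝ) : ℝ := ∑ i, ∑ j ∈ Finset.Ioi i, |t i - t j|

/-- The sum of the distances between the points of two configurations on the line. -/
def crossEnergy {n m : ℕ} (l : Fin n → ℝ) (c : Fin m → ℝ) : ℝ := ∑ i, ∑ a, |l i - c a|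

theorem two_mul_pairEnergy {n : ℕ} (t : Fin n → ℝ) :
    2 * pairEnergy t = ∑ i, ∑ j, |t i - t j| := by
  have h := Finset.sum_sum_Ioi_add_eq_sum_sum_off_diag (fun i j => |t i - t j|)
  have h1 : ∀ i, ∑ j ∈ Finset.Ioi i, (|t j - t i| + |t i - t j|)
      = 2 * ∑ j ∈ Finset.Ioi i, |t i - t j| := fun i => by
    rw [Finset.mul_sum]
    refine Finset.sum_congr rfl fun j _ => ?_
    rw [abs_sub_comm (t j)]; ring
  rw [pairEnergy, Finset.mul_sum, ← Finset.sum_congr rfl fun i _ => h1 i, h]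
  refine Finset.sum_congr rfl fun i _ => ?_
  rw [← Finset.sum_add_sum_compl {i} (fun j => |t i - t j|)]
  simp [abs_sub_comm]

/-- The indicator function of `x ≤ t`. -/
def stepFn (x t : ℝ) : ℝ := if x ≤ t then 1 else 0

theorem stepFn_sub_eq (x y t : ℝ) : stepFn x t - stepFn y t
    = (Set.Ico x y).indicator 1 t - (Set.Ico y x).indicator 1 t := by
  simp only [stepFn, Set.indicator, Set.mem_Ico, Pi.one_apply]
  split_ifs <;> first | (exfalso; grind) | norm_num

theorem abs_stepFn_sub_eq (x y t : ℝ) : |stepFn x t - stepFn y t|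
    = (Set.Ico x y).indicator 1 t + (Set.Ico y x).indicator 1 t := by
  simp only [stepFn, Set.indicator, Set.mem_Ico, Pi.one_apply]
  split_ifs <;> first | (exfalso; grind) | norm_num

theorem integrable_indicator_Ico (x y : ℝ) :
    Integrable ((Set.Ico x y).indicator (1 : ℝ → ℝ)) := by
  rw [integrable_indicator_iff measurableSet_Ico]
  exact integrableOn_const (by simp)

theorem integral_indicator_Ico (x y : ℝ) :
    ∫ t, (Set.Ico x y).indicator (1 : ℝ → ℝ) t = max (y - x) 0 := by
  rw [integral_indicator_one measurableSet_Ico]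
  simp [Measure.real, ENNReal.toReal_ofReal']

theorem integrable_stepFn_sub (x y : ℝ) : Integrable fun t => stepFn x t - stepFn y t := by
  simp only [stepFn_sub_eq]
  exact (integrable_indicator_Ico _ _).sub (integrable_indicator_Ico _ _)

theorem integral_stepFn_sub (x y : ℝ) : ∫ t, (stepFn x t - stepFn y t) = y - x := by
  simp only [stepFn_sub_eq]
  rw [integral_sub (integrable_indicator_Ico _ _) (integrable_indicator_Ico _ _),
    integral_indicator_Ico, integral_indicator_Ico]
  rcases le_total x y with h | h
  · rw [max_eq_left (by linarith), max_eq_right (by linarith)]; ring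
  · rw [max_eq_right (by linarith), max_eq_left (by linarith)]; ring

theorem integral_abs_stepFn_sub (x y : ℝ) : ∫ t, |stepFn x t - stepFn y t| = |x - y| := by
  simp only [abs_stepFn_sub_eq]
  rw [integral_add (integrable_indicator_Ico _ _) (integrable_indicator_Ico _ _),
    integral_indicator_Ico, integral_indicator_Ico]
  rcases le_total x y with h | h
  · rw [max_eq_left (by linarith), max_eq_right (by linarith), abs_of_nonpos (by linarith)]; ring
  · rw [max_eq_right (by linarith), max_eq_left (by linarith), abs_of_nonneg (by linarith)]; ring

/-- The indicator function of the part between `x` and the interval `[-R, R]`. -/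
def tailFn (R x t : ℝ) : ℝ :=
  (Set.Ico R x).indicator 1 t + (Set.Ico x (-R)).indicator 1 t

theorem integrable_tailFn (R x : ℝ) : Integrable (tailFn R x) :=
  (integrable_indicator_Ico _ _).add (integrable_indicator_Ico _ _)

theorem integral_tailFn {R : ℝ} (hR : 0 ≤ R) (x : ℝ) :
    ∫ t, tailFn R x t = max (|x| - R) 0 := by
  simp only [tailFn]
  rw [integral_add (integrable_indicator_Ico _ _) (integrable_indicator_Ico _ _),
    integral_indicator_Ico, integral_indicator_Ico]
  rcases le_total 0 x with h | h
  · rw [abs_of_nonneg h, max_eq_right (a := -R - x) (by linarith)]; ring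
  · rw [abs_of_nonpos h, max_eq_right (a := x - R) (by linarith)]; ring_nf

theorem abs_stepFn_sub_eq_poly (x y t : ℝ) : |stepFn x t - stepFn y t|
    = stepFn x t + stepFn y t - 2 * (stepFn x t * stepFn y t) := by
  simp only [stepFn]
  split_ifs <;> norm_num

/-- For values 0 and 1, `|a - b| = a + b - 2ab`. At each level `t` the double sum thus depends only
on the two counts of points not exceeding `t`. -/
theorem sum_abs_stepFn_sub {n m : ℕ} (l : Fin n → ℝ) (c : Fin m → ℝ) (t : ℝ) :
    ∑ i, ∑ a, |stepFn (l i) t - stepFn (c a) t|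
      = m * (∑ i, stepFn (l i) t) + n * (∑ a, stepFn (c a) t)
        - 2 * ((∑ i, stepFn (l i) t) * ∑ a, stepFn (c a) t) := by
  simp only [abs_stepFn_sub_eq_poly, Finset.sum_sub_distrib, Finset.sum_add_distrib,
    Finset.sum_const, Finset.card_univ, Fintype.card_fin, nsmul_eq_mul, ← Finset.mul_sum]
  rw [Finset.sum_mul_sum]
  simp only [Finset.mul_sum]

theorem integral_sum_abs_stepFn_sub {n m : ℕ} (l : Fin n → ℝ) (c : Fin m → ℝ) :
    Integrable (fun t => ∑ i, ∑ a, |stepFn (l i) t - stepFn (c a) t|) ∧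
    ∫ t, ∑ i, ∑ a, |stepFn (l i) t - stepFn (c a) t| = crossEnergy l c := by
  have h : ∀ i a, Integrable fun t => |stepFn (l i) t - stepFn (c a) t| :=
    fun i a => (integrable_stepFn_sub _ _).abs
  have h' : ∀ i, Integrable fun t => ∑ a, |stepFn (l i) t - stepFn (c a) t| :=
    fun i => integrable_finsetSum _ fun a _ => h i a
  refine ⟨integrable_finsetSum _ fun i _ => h' i, ?_⟩
  rw [integral_finsetSum _ fun i _ => h' i, crossEnergy]
  refine Finset.sum_congr rfl fun i _ => ?_
  rw [integral_finsetSum _ fun a _ => h i a]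
  exact Finset.sum_congr rfl fun a _ => integral_abs_stepFn_sub _ _

theorem exists_int_sum_stepFn {n : ℕ} (l : Fin n → ℝ) (t : ℝ) :
    ∃ p : ℕ, p ≤ n ∧ ∑ i, stepFn (l i) t = p := by
  refine ⟨(Finset.univ.filter fun i => l i ≤ t).card, ?_, ?_⟩
  · simpa using Finset.card_le_univ (Finset.univ.filter fun i => l i ≤ t)
  · simp [stepFn]

/-- Beyond `[-R, R]` all points of `l` lie on one side of `t`, and the tails count the points of `c`
on the other side. Inside the interval the tails vanish. -/
theorem sum_tailFn_le {n m : ℕ} {l : Fin n → ℝ} (c : Fin m → ℝ) {R : ℝ} (hR : 0 ≤ R)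
    (hl : ∀ k, |l k| ≤ R) (t : ℝ) :
    (∑ i, stepFn (l i) t = n ∧
      ∑ a, tailFn R (c a) t ≤ m - ∑ a, stepFn (c a) t) ∨
    (∑ i, stepFn (l i) t = 0 ∧ ∑ a, tailFn R (c a) t ≤ ∑ a, stepFn (c a) t) ∨
      ∑ a, tailFn R (c a) t = 0 := by
  have htail : ∀ x, tailFn R x t = (if R ≤ t ∧ t < x then 1 else 0)
      + (if x ≤ t ∧ t < -R then 1 else 0) := fun x => by
    simp [tailFn, Set.indicator]
  rcases le_or_gt R t with h | h
  · left
    constructor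
    · rw [Finset.sum_congr rfl fun i _ =>
        show stepFn (l i) t = 1 from if_pos ((le_abs_self _).trans ((hl i).trans h))]
      simp
    · have : ∀ a, tailFn R (c a) t = 1 - stepFn (c a) t := fun a => by
        rw [htail, stepFn]
        split_ifs <;> first | (exfalso; grind) | norm_num
      simp [this]
  · rcases lt_or_ge t (-R) with h' | h'
    · right; left
      constructor
      · rw [Finset.sum_congr rfl fun i _ => show stepFn (l i) t = 0 from if_neg (by
          have := neg_abs_le (l i)
          have := hl i
          intro h0; linarith)]
        simp
      · refine Finset.sum_le_sum fun a _ => ?_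
        rw [htail, stepFn]
        split_ifs <;> first | (exfalso; grind) | norm_num
    · right; right
      refine Finset.sum_eq_zero fun a _ => ?_
      rw [htail]
      split_ifs <;> first | (exfalso; grind) | norm_num

/-- Distances are integrals over levels `t`. With `q` and `p` the counts of points of `l` and `c` up
to `t`, twice the cross term minus both full double sums has integrand `2(p - q)(p - q + 1)`, twice
a product of consecutive integers. It is nonnegative, and beyond `[-R, R]` it dominates the tails.
-/
theorem energy_le_crossEnergy_succ {m : ℕ} (l : Fin (m + 1) → ℝ) (c : Fin m → ℝ) {R : ℝ}
    (hR : 0 ≤ R) (hl : ∀ k, |l k| ≤ R) :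
    pairEnergy c + pairEnergy l + ∑ a, max (|c a| - R) 0 ≤ crossEnergy l c := by
  obtain ⟨i1, e1⟩ := integral_sum_abs_stepFn_sub l c
  obtain ⟨i2, e2⟩ := integral_sum_abs_stepFn_sub l l
  obtain ⟨i3, e3⟩ := integral_sum_abs_stepFn_sub c c
  have i4 : Integrable fun t => ∑ a, tailFn R (c a) t :=
    integrable_finsetSum _ fun a _ => integrable_tailFn _ _
  have e4 : ∫ t, ∑ a, tailFn R (c a) t = ∑ a, max (|c a| - R) 0 := by
    rw [integral_finsetSum _ fun a _ => integrable_tailFn _ _]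
    exact Finset.sum_congr rfl fun a _ => integral_tailFn hR _
  have key := integral_mono (((i2.add i3).add (i4.const_mul 2))) (i1.const_mul 2) fun t => by
    simp only [Pi.add_apply]
    rw [sum_abs_stepFn_sub, sum_abs_stepFn_sub, sum_abs_stepFn_sub]
    have htail := sum_tailFn_le c hR hl t
    obtain ⟨q, hq, hq'⟩ := exists_int_sum_stepFn l t
    obtain ⟨p, hp, hp'⟩ := exists_int_sum_stepFn c t
    rw [hq', hp'] at htail ⊢
    push_cast at htail ⊢
    have hpm : (p : ℝ) ≤ m := by exact_mod_cast hp
    have hp0 : (0 : ℝ) ≤ p := p.cast_nonneg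
    rcases htail with ⟨h1, h2⟩ | ⟨h1, h2⟩ | h2
    · rw [h1]; nlinarith
    · rw [h1]; nlinarith
    · rw [h2]
      have : (0 : ℝ) ≤ ((p : ℝ) - q) * (p - q + 1) := by
        rcases le_or_gt q p with h | h
        · have : (q : ℝ) ≤ p := by exact_mod_cast h
          exact mul_nonneg (by linarith) (by linarith)
        · have : (p : ℝ) + 1 ≤ q := by exact_mod_cast h
          exact mul_nonneg_of_nonpos_of_nonpos (by linarith) (by linarith)
      nlinarith
  rw [integral_add' (i2.add i3) (i4.const_mul 2), integral_add' i2 i3, integral_const_mul,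
    integral_const_mul, e1, e2, e3, e4] at key
  have t1 := two_mul_pairEnergy c
  have t2 := two_mul_pairEnergy l
  simp only [crossEnergy] at key ⊢
  linarith

/-- For equally many points the integrand becomes `2(p - q)²`, at least `2|p - q|` for integers. The
integral of `p - q` is the difference of the centres, which gives the second bound; it will pay for
the growth of the exponential at complex spectral parameter. -/
theorem energy_le_crossEnergy {n : ℕ} (l c : Fin n → ℝ) {R : ℝ}
    (hR : 0 ≤ R) (hl : ∀ k, |l k| ≤ R) :
    pairEnergy c + pairEnergy l + ∑ a, max (|c a| - R) 0 ≤ crossEnergy l c ∧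
    pairEnergy c + pairEnergy l + |(∑ i, l i) - ∑ a, c a| ≤ crossEnergy l c := by
  obtain ⟨i1, e1⟩ := integral_sum_abs_stepFn_sub l c
  obtain ⟨i2, e2⟩ := integral_sum_abs_stepFn_sub l l
  obtain ⟨i3, e3⟩ := integral_sum_abs_stepFn_sub c c
  have i4 : Integrable fun t => ∑ a, tailFn R (c a) t :=
    integrable_finsetSum _ fun a _ => integrable_tailFn _ _
  have e4 : ∫ t, ∑ a, tailFn R (c a) t = ∑ a, max (|c a| - R) 0 := by
    rw [integral_finsetSum _ fun a _ => integrable_tailFn _ _]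
    exact Finset.sum_congr rfl fun a _ => integral_tailFn hR _
  have i5 : Integrable fun t => ∑ a, (stepFn (c a) t - stepFn (l a) t) :=
    integrable_finsetSum _ fun a _ => integrable_stepFn_sub _ _
  have e5 : ∫ t, ∑ a, (stepFn (c a) t - stepFn (l a) t) = (∑ i, l i) - ∑ a, c a := by
    rw [integral_finsetSum _ fun a _ => integrable_stepFn_sub _ _, ← Finset.sum_sub_distrib]
    exact Finset.sum_congr rfl fun a _ => integral_stepFn_sub _ _
  have hsq : ∀ p q : ℕ, |(p : ℝ) - q| ≤ (p - q) ^ 2 := fun p q => by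
    have : |(p : ℤ) - q| ≤ ((p : ℤ) - q) ^ 2 := by
      rw [← sq_abs]
      nlinarith [Int.le_self_sq |(p : ℤ) - q|]
    exact_mod_cast this
  have key1 := integral_mono (((i2.add i3).add (i4.const_mul 2))) (i1.const_mul 2) fun t => by
    simp only [Pi.add_apply]
    rw [sum_abs_stepFn_sub, sum_abs_stepFn_sub, sum_abs_stepFn_sub]
    have htail := sum_tailFn_le c hR hl t
    obtain ⟨q, hq, hq'⟩ := exists_int_sum_stepFn l t
    obtain ⟨p, hp, hp'⟩ := exists_int_sum_stepFn c t
    rw [hq', hp'] at htail ⊢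
    have hpq := hsq p q
    rcases htail with ⟨h1, h2⟩ | ⟨h1, h2⟩ | h2
    · rw [h1] at hpq ⊢; nlinarith [neg_abs_le ((p : ℝ) - n)]
    · rw [h1] at hpq ⊢; nlinarith [le_abs_self ((p : ℝ) - 0)]
    · rw [h2]; nlinarith
  have key2 := integral_mono (((i2.add i3).add (i5.abs.const_mul 2))) (i1.const_mul 2) fun t => by
    simp only [Pi.add_apply]
    rw [sum_abs_stepFn_sub, sum_abs_stepFn_sub, sum_abs_stepFn_sub, Finset.sum_sub_distrib]
    obtain ⟨q, hq, hq'⟩ := exists_int_sum_stepFn l t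
    obtain ⟨p, hp, hp'⟩ := exists_int_sum_stepFn c t
    rw [hq', hp']
    have hpq := hsq p q
    nlinarith
  have h5 := abs_integral_le_integral_abs
    (μ := volume) (f := fun t => ∑ a, (stepFn (c a) t - stepFn (l a) t))
  rw [e5] at h5
  rw [integral_add' (i2.add i3) (i4.const_mul 2), integral_add' i2 i3, integral_const_mul,
    integral_const_mul, e1, e2, e3, e4] at key1
  rw [integral_add' (i2.add i3) (i5.abs.const_mul 2), integral_add' i2 i3, integral_const_mul,
    integral_const_mul, e1, e2, e3] at key2
  have t1 := two_mul_pairEnergy c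
  have t2 := two_mul_pairEnergy l
  simp only [crossEnergy] at key1 key2 ⊢
  constructor <;> linarith

end RationalRuijsenaars

end

/-! ### Polynomial weights and holomorphic dependence of integrals. -/

noncomputable section

namespace RationalRuijsenaars

open MeasureTheory Filter Topology

/-- A polynomial weight on the real space of dimension `n`. -/
def weight {n : ℕ} (t : Fin n → ℝ) : ℝ := ∏ k, (1 + |t k|)

theorem one_le_weight {n : ℕ} (t : Fin n → ℝ) : 1 ≤ weight t :=
  Finset.one_le_prod (fun k _ => le_add_of_nonneg_right (abs_nonneg (t k)))

theorem weight_pos {n : ℕ} (t : Fin n → ℝ) : 0 < weight t := one_pos.trans_le (one_le_weight t)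

theorem one_add_abs_le_weight {n : ℕ} (t : Fin n → ℝ) (k : Fin n) : 1 + |t k| ≤ weight t := by
  rw [weight, ← Finset.mul_prod_erase _ _ (Finset.mem_univ k)]
  refine le_mul_of_one_le_right (by positivity) ?_
  exact Finset.one_le_prod (s := Finset.univ.erase k) (f := fun k => 1 + |t k|)
    (fun i _ => le_add_of_nonneg_right (abs_nonneg (t i)))

theorem one_add_abs_add_le (x y : ℝ) : 1 + |x + y| ≤ (1 + |x|) * (1 + |y|) := by
  nlinarith [abs_add_le x y, abs_nonneg x, abs_nonneg y, mul_nonneg (abs_nonneg x) (abs_nonneg y)]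

theorem one_add_abs_sub_le (x y : ℝ) : 1 + |x - y| ≤ (1 + |x|) * (1 + |y|) := by
  simpa [sub_eq_add_neg] using one_add_abs_add_le x (-y)

theorem weight_add_le {n : ℕ} (s t : Fin n → ℝ) : weight (s + t) ≤ weight s * weight t := by
  rw [weight, weight, weight, ← Finset.prod_mul_distrib]
  exact Finset.prod_le_prod (fun _ _ => by positivity) fun k _ => one_add_abs_add_le _ _

theorem continuous_weight {n : ℕ} : Continuous (weight (n := n)) := by
  unfold weight; fun_prop

theorem integrable_weight_inv_sq {n : ℕ} :
    Integrable fun t : Fin n → ℝ => ((weight t) ^ 2)⁻¹ := by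
  have h1 : Integrable fun x : ℝ => ((1 + |x|) ^ 2)⁻¹ := by
    have := integrable_one_add_norm (E := ℝ) (μ := volume) (r := 2) (by simp)
    refine this.congr (Eventually.of_forall fun x => ?_)
    simp only [Real.norm_eq_abs]
    rw [Real.rpow_neg (by positivity)]
    norm_cast
  have := Integrable.fintype_prod (ι := Fin n) (f := fun _ (x : ℝ) => ((1 + |x|) ^ 2)⁻¹)
    (μ := fun _ => volume) (fun _ => h1)
  refine this.congr (Eventually.of_forall fun t => ?_)
  simp [weight, Finset.prod_pow]

theorem exists_exp_neg_le {κ : ℝ} (hκ : 0 < κ) (M : ℕ) :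
    ∃ C : ℝ, 0 ≤ C ∧ ∀ R ≥ 0, ∀ x : ℝ,
      Real.exp (-(κ * max (|x| - R) 0)) * (1 + |x|) ^ M ≤ C * (1 + R) ^ M := by
  -- With `u` the excess of `|x|` over `R`, `1 + |x| ≤ (1 + R)(1 + u)`, and the constant comes from
  -- `(κ(1 + u))^M / M! ≤ exp(κ(1 + u))`.
  refine ⟨M.factorial / κ ^ M * Real.exp κ, by positivity, fun R hR x => ?_⟩
  set u := max (|x| - R) 0
  have hu0 : 0 ≤ u := le_max_right _ _
  have hu : 1 + |x| ≤ (1 + R) * (1 + u) := by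
    have : |x| - R ≤ u := le_max_left _ _
    nlinarith [mul_nonneg hR hu0]
  have h1 := Real.pow_div_factorial_le_exp (κ * (1 + u)) (by positivity) M
  have h2 : (1 + u) ^ M ≤ M.factorial / κ ^ M * Real.exp (κ * (1 + u)) := by
    rw [mul_pow] at h1
    rw [div_mul_eq_mul_div, le_div_iff₀ (by positivity)]
    rw [div_le_iff₀ (by positivity)] at h1
    linarith
  calc Real.exp (-(κ * u)) * (1 + |x|) ^ M
      ≤ Real.exp (-(κ * u)) * ((1 + R) * (1 + u)) ^ M := by gcongr
    _ = Real.exp (-(κ * u)) * (1 + R) ^ M * (1 + u) ^ M := by rw [mul_pow]; ring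
    _ ≤ Real.exp (-(κ * u)) * (1 + R) ^ M *
        (M.factorial / κ ^ M * Real.exp (κ * (1 + u))) := by gcongr
    _ = M.factorial / κ ^ M * (Real.exp (-(κ * u)) * Real.exp (κ * (1 + u))) * (1 + R) ^ M := by
        ring
    _ = _ := by rw [← Real.exp_add]; ring_nf

theorem exists_exp_neg_sum_le {κ : ℝ} (hκ : 0 < κ) (m M : ℕ) :
    ∃ C : ℝ, 0 ≤ C ∧ ∀ R ≥ 0, ∀ c : Fin m → ℝ,
      Real.exp (-(κ * ∑ a, max (|c a| - R) 0)) * weight c ^ M ≤ C * (1 + R) ^ (M * m) := by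
  obtain ⟨C, hC, h⟩ := exists_exp_neg_le hκ M
  refine ⟨C ^ m, by positivity, fun R hR c => ?_⟩
  rw [Finset.mul_sum, ← Finset.sum_neg_distrib, Real.exp_sum, weight, ← Finset.prod_pow,
    ← Finset.prod_mul_distrib]
  refine (Finset.prod_le_prod (fun _ _ => by positivity) fun a _ => h R hR (c a)).trans
    (le_of_eq ?_)
  simp [mul_pow, pow_mul]

/-- Cauchy's estimate on the complex line through `x` in each direction; the radius is halved so
that the closed disc stays inside the ball. -/
theorem norm_fderiv_le_of_norm_le {E : Type*} [NormedAddCommGroup E] [NormedSpace ℂ E]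
    {f : E → ℂ} {x : E} {r M : ℝ} (hr : 0 < r) (hM : 0 ≤ M)
    (hf : DifferentiableOn ℂ f (Metric.ball x r))
    (hb : ∀ y ∈ Metric.ball x r, ‖f y‖ ≤ M) : ‖fderiv ℂ f x‖ ≤ M / (r / 2) := by
  refine ContinuousLinearMap.opNorm_le_bound _ (by positivity) fun v => ?_
  rcases eq_or_ne v 0 with rfl | hv
  · simp
  have hv' : 0 < ‖v‖ := norm_pos_iff.2 hv
  set ρ := r / 2 / ‖v‖
  have hρ : 0 < ρ := by positivity
  have hmem : ∀ ζ ∈ Metric.closedBall (0 : ℂ) ρ, x + ζ • v ∈ Metric.ball x r := fun ζ hζ => by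
    rw [mem_closedBall_zero_iff] at hζ
    rw [mem_ball_iff_norm, add_sub_cancel_left, norm_smul]
    calc ‖ζ‖ * ‖v‖ ≤ ρ * ‖v‖ := by gcongr
      _ = r / 2 := by simp only [ρ]; field_simp
      _ < r := by linarith
  have hline : DifferentiableOn ℂ (fun ζ : ℂ => f (x + ζ • v)) (Metric.closedBall 0 ρ) :=
    hf.comp (by fun_prop) hmem
  have hdc : DiffContOnCl ℂ (fun ζ : ℂ => f (x + ζ • v)) (Metric.ball 0 ρ) := by
    refine ⟨hline.mono Metric.ball_subset_closedBall, ?_⟩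
    rw [closure_ball _ hρ.ne']
    exact hline.continuousOn
  have h := Complex.norm_deriv_le_of_forall_mem_sphere_norm_le hρ hdc
    fun ζ hζ => hb _ (hmem ζ (Metric.sphere_subset_closedBall hζ))
  have hd : deriv (fun ζ : ℂ => f (x + ζ • v)) 0 = fderiv ℂ f x v := by
    have h1 : HasFDerivAt f (fderiv ℂ f x) (x + (0 : ℂ) • v) := by
      rw [zero_smul, add_zero]
      exact (hf.differentiableAt (Metric.ball_mem_nhds x hr)).hasFDerivAt
    have h2 : HasDerivAt (fun ζ : ℂ => x + ζ • v) v 0 := by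
      simpa using ((hasDerivAt_id (0 : ℂ)).smul_const v).const_add x
    exact (h1.comp_hasDerivAt (0 : ℂ) h2).deriv
  rw [hd] at h
  refine h.trans (le_of_eq ?_)
  simp only [ρ]; field_simp

/-- Each directional derivative is a pointwise limit of measurable difference quotients, and in
finite dimension these determine the derivative. -/
theorem aestronglyMeasurable_fderiv {E : Type*} [NormedAddCommGroup E] [NormedSpace ℂ E]
    [FiniteDimensional ℂ E] {α : Type*} [MeasurableSpace α] {μ : Measure α} {U : Set E}
    (hU : IsOpen U) {f : E → α → ℂ} (hm : ∀ x ∈ U, AEStronglyMeasurable (f x) μ)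
    (hd : ∀ a, DifferentiableOn ℂ (fun x => f x a) U) {x : E} (hx : x ∈ U) :
    AEStronglyMeasurable (fun a => fderiv ℂ (fun y => f y a) x) μ := by
  have hdir : ∀ v : E, AEStronglyMeasurable (fun a => fderiv ℂ (fun y => f y a) x v) μ := by
    intro v
    obtain ⟨r, hr, hball⟩ := Metric.isOpen_iff.1 hU x hx
    have hε : ∀ᶠ k : ℕ in atTop, x + ((k + 1 : ℂ)⁻¹) • v ∈ U := by
      have : Tendsto (fun k : ℕ => x + ((k + 1 : ℂ)⁻¹) • v) atTop (𝓝 (x + (0 : ℂ) • v)) := by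
        refine tendsto_const_nhds.add (Tendsto.smul_const ?_ v)
        have := tendsto_one_div_add_atTop_nhds_zero_nat (𝕜 := ℂ)
        simpa using this
      rw [zero_smul, add_zero] at this
      exact this (hU.mem_nhds hx)
    -- The offset `K` keeps every difference quotient inside `U`, where measurability is known.
    obtain ⟨K, hK⟩ := eventually_atTop.1 hε
    refine aestronglyMeasurable_of_tendsto_ae atTop
      (f := fun (k : ℕ) a => ((k + K : ℕ) + 1 : ℂ) •
        (f (x + (((k + K : ℕ) + 1 : ℂ)⁻¹) • v) a - f x a)) (fun k => ?_)
      (Eventually.of_forall fun a => ?_)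
    · exact AEStronglyMeasurable.const_smul
        ((hm _ (hK _ (Nat.le_add_left K k))).sub (hm x hx)) ((k + K : ℕ) + 1 : ℂ)
    · have hda : HasFDerivAt (fun y => f y a) (fderiv ℂ (fun y => f y a) x) x :=
        ((hd a).differentiableAt (hU.mem_nhds hx)).hasFDerivAt
      refine hda.lim v (c := fun k : ℕ => ((k + K : ℕ) + 1 : ℂ)) ?_
      have h1 : ∀ k : ℕ, ‖((k + K : ℕ) + 1 : ℂ)‖ = (k + K : ℕ) + 1 := fun k => by
        rw [← Nat.cast_succ, Complex.norm_natCast, Nat.cast_succ]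
      simp only [h1]
      exact tendsto_atTop_add_const_right _ _
        (tendsto_natCast_atTop_atTop.comp (tendsto_add_atTop_nat K))
  set b := Module.finBasis ℂ E
  have hsum : ∀ L : E →L[ℂ] ℂ, L = ∑ i, (L (b i)) • (b.coord i).toContinuousLinearMap := by
    intro L
    ext v
    have := congrArg L (b.sum_repr v)
    rw [map_sum] at this
    rw [← this]
    simp [mul_comm]
  have : (fun a => fderiv ℂ (fun y => f y a) x) = fun a => ∑ i,
      (fderiv ℂ (fun y => f y a) x (b i)) • (b.coord i).toContinuousLinearMap :=
    funext fun a => hsum _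
  rw [this]
  exact Finset.aestronglyMeasurable_fun_sum _ fun i _ => (hdir (b i)).smul_const _

/-- For holomorphic integrands a majorant of the function is enough: Cauchy's estimate on smaller
balls turns it into a majorant of the derivative. -/
theorem hasFDerivAt_integral_of_holomorphic {E : Type*} [NormedAddCommGroup E] [NormedSpace ℂ E]
    [FiniteDimensional ℂ E] {α : Type*} [MeasurableSpace α] {μ : Measure α} {U : Set E}
    (hU : IsOpen U) {f : E → α → ℂ} (hm : ∀ x ∈ U, AEStronglyMeasurable (f x) μ)
    (hd : ∀ a, DifferentiableOn ℂ (fun x => f x a) U) {x₀ : E} (hx : x₀ ∈ U)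
    {V : Set E} (hV : V ∈ 𝓝 x₀) {b : α → ℝ} (hb : Integrable b μ)
    (hfb : ∀ x ∈ V, ∀ a, ‖f x a‖ ≤ b a) :
    HasFDerivAt (fun x => ∫ a, f x a ∂μ) (∫ a, fderiv ℂ (fun x => f x a) x₀ ∂μ) x₀ := by
  obtain ⟨r, hr, hball⟩ := Metric.mem_nhds_iff.1 (inter_mem hV (hU.mem_nhds hx))
  have hsub : ∀ x ∈ Metric.ball x₀ (r / 2), Metric.ball x (r / 2) ⊆ V ∩ U := fun x hx =>
    (Metric.ball_subset_ball' (by rw [Metric.mem_ball] at hx; linarith)).trans hball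
  refine hasFDerivAt_integral_of_dominated_of_fderiv_le (bound := fun a => b a / (r / 2 / 2))
    (F' := fun x a => fderiv ℂ (fun x => f x a) x) (Metric.ball_mem_nhds x₀ (half_pos hr))
    ?_ ?_ ?_ ?_ ?_ ?_
  · filter_upwards [hU.mem_nhds hx] with x hx using hm x hx
  · refine hb.mono' (hm x₀ hx) (Eventually.of_forall fun a => hfb x₀ (mem_of_mem_nhds hV) a)
  · exact aestronglyMeasurable_fderiv hU hm hd hx
  · refine Eventually.of_forall fun a x hx => ?_
    refine norm_fderiv_le_of_norm_le (half_pos hr) ?_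
      ((hd a).mono ((hsub x hx).trans Set.inter_subset_right))
      fun y hy => hfb y (hsub x hx hy).1 a
    exact (norm_nonneg _).trans (hfb x₀ (mem_of_mem_nhds hV) a)
  · exact hb.div_const _
  · refine Eventually.of_forall fun a x hx => ?_
    exact ((hd a).differentiableAt (hU.mem_nhds
      (hsub x hx (Metric.mem_ball_self (half_pos hr))).2)).hasFDerivAt

/-- A holomorphic function on a convex open set that contains the real axis and that is constant
on the real axis is constant. -/
theorem eq_of_eq_on_real {S : Set ℂ} (hS : IsOpen S) (hconv : Convex ℝ S)
    (hreal : ∀ t : ℝ, (t : ℂ) ∈ S) {φ : ℂ → ℂ} (hφ : DifferentiableOn ℂ φ S) {k : ℂ}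
    (hk : ∀ t : ℝ, φ t = k) {ζ : ℂ} (hζ : ζ ∈ S) : φ ζ = k := by
  have h := (hφ.analyticOnNhd hS).eqOn_of_preconnected_of_frequently_eq
    (analyticOnNhd_const (v := k)) hconv.isPreconnected (z₀ := 0) (by simpa using hreal 0) ?_
  · exact h hζ
  -- The real points `1/(j+1)` accumulate at `0`, as the identity theorem requires.
  · have : Tendsto (fun j : ℕ => (((1 / ((j : ℝ) + 1) : ℝ)) : ℂ)) atTop (𝓝[≠] 0) := by
      refine tendsto_nhdsWithin_iff.2 ⟨?_, Eventually.of_forall fun j => ?_⟩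
      · have h := tendsto_one_div_add_atTop_nhds_zero_nat (𝕜 := ℝ)
        simpa [Function.comp_def] using (Complex.continuous_ofReal.tendsto 0).comp h
      · have : (0 : ℝ) < 1 / ((j : ℝ) + 1) := by positivity
        simpa using (Complex.ofReal_ne_zero.2 this.ne')
    exact this.frequently (Frequently.of_forall fun j => hk _)

end RationalRuijsenaars

end

/-! ### Contour shifts, and the kernel and weight at complex arguments. -/

noncomputable section

namespace RationalRuijsenaars

open MeasureTheory Filter Topology

/-- The product of `n` horizontal strips of half-width `s`. -/
def strip (n : ℕ) (s : ℝ) : Set (Fin n → ℂ) := {l | ∀ k, |(l k).im| < s}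

/-- The vector of real parts. -/
def reVec {n : ℕ} (l : Fin n → ℂ) : Fin n → ℝ := fun k => (l k).re

/-- The inclusion of the real into the complex space. -/
def ofRealVec {n : ℕ} (t : Fin n → ℝ) : Fin n → ℂ := fun k => (t k : ℂ)

theorem reVec_ofRealVec {n : ℕ} (t : Fin n → ℝ) : reVec (ofRealVec t) = t := by
  ext k; simp [reVec, ofRealVec]

theorem continuous_ofRealVec {n : ℕ} : Continuous (ofRealVec (n := n)) :=
  continuous_pi fun k => Complex.continuous_ofReal.comp (continuous_apply k)

theorem ofRealVec_mem_strip {n : ℕ} {s : ℝ} (hs : 0 < s) (t : Fin n → ℝ) :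
    ofRealVec t ∈ strip n s := fun k => by simpa [ofRealVec] using hs

theorem isOpen_strip (n : ℕ) (s : ℝ) : IsOpen (strip n s) := by
  have : strip n s = ⋂ k, {l | |(l k).im| < s} := by ext; simp [strip]
  rw [this]
  exact isOpen_iInter_of_finite fun k => isOpen_lt (by fun_prop) continuous_const

theorem strip_mono {n : ℕ} {s s' : ℝ} (h : s ≤ s') : strip n s ⊆ strip n s' :=
  fun _ hl k => (hl k).trans_le h

/-- Shift of the domain of integration of a holomorphic function in imaginary directions. -/
theorem integral_shift {n : ℕ} {s C : ℝ} {f : (Fin n → ℂ) → ℂ}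
    (hd : DifferentiableOn ℂ f (strip n s))
    (hb : ∀ z ∈ strip n s, ‖f z‖ ≤ C * ((weight (reVec z)) ^ 2)⁻¹)
    (v : Fin n → ℝ) (hv : ∀ k, |v k| < s) :
    ∫ t : Fin n → ℝ, f (fun k => t k + v k * Complex.I) = ∫ t : Fin n → ℝ, f (ofRealVec t) := by
  -- The translation `t ↦ t + ζ v` is made to depend on a complex `ζ`. The integral is holomorphic
  -- in `ζ`, and constant for real `ζ` by translation invariance, hence it has the same value at `ζ
  -- = i`.
  set S : Set ℂ := {ζ | ∀ k, |ζ.im * v k| < s} with hSdef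
  set p : ℂ → (Fin n → ℝ) → Fin n → ℂ := fun ζ t k => t k + ζ * v k with hp
  have hpS : ∀ ζ ∈ S, ∀ t, p ζ t ∈ strip n s := fun ζ hζ t k => by
    simpa [hp] using hζ k
  have hSo : IsOpen S := by
    have : S = ⋂ k, {ζ : ℂ | |ζ.im * v k| < s} := by ext; simp [hSdef]
    rw [this]
    exact isOpen_iInter_of_finite fun k => isOpen_lt (by fun_prop) continuous_const
  have hSc : Convex ℝ S := by
    have : S = ⋂ k, (fun ζ : ℂ => ζ.im * v k) ⁻¹' (Set.Ioo (-s) s) := by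
      ext; simp only [hSdef, abs_lt, Set.mem_ofPred_eq, Set.mem_iInter, Set.mem_preimage, Set.mem_Ioo]
    rw [this]
    refine convex_iInter fun k => ?_
    have hl : IsLinearMap ℝ fun ζ : ℂ => ζ.im * v k := by
      constructor
      · intro x y; simp [add_mul]
      · intro c x; simp [mul_assoc]
    exact (convex_Ioo (-s) s).is_linear_preimage hl
  have hcontf := hd.continuousOn
  have hreal : ∀ t : ℝ, (t : ℂ) ∈ S := fun t k => by
    simpa using (abs_nonneg _).trans_lt (hv k)
  have hmeas : ∀ ζ ∈ S, AEStronglyMeasurable (fun t => f (p ζ t)) volume := fun ζ hζ => by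
    refine Continuous.aestronglyMeasurable ?_
    refine hcontf.comp_continuous ?_ (hpS ζ hζ)
    exact continuous_pi fun k => by fun_prop
  have hφ : DifferentiableOn ℂ (fun ζ => ∫ t, f (p ζ t)) S := by
    intro ζ₀ hζ₀
    -- For `ζ` near `ζ₀` the real translation is at most `B |v k|` in each coordinate, so it changes
    -- the weight by at most the factor `w`.
    set B := |ζ₀.re| + 1
    set w := weight fun k => B * |v k|
    refine (hasFDerivAt_integral_of_holomorphic hSo hmeas (fun t => ?_) hζ₀
      (V := S ∩ Metric.ball ζ₀ 1) (inter_mem (hSo.mem_nhds hζ₀) (Metric.ball_mem_nhds _ one_pos))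
      (b := fun t => |C| * w ^ 2 * ((weight t) ^ 2)⁻¹)
      (integrable_weight_inv_sq.const_mul _) ?_).differentiableAt.differentiableWithinAt
    · exact hd.comp (by fun_prop) fun ζ hζ => hpS ζ hζ t
    · intro ζ ⟨hζ, hball⟩ t
      refine (hb _ (hpS ζ hζ t)).trans ?_
      have hre : |ζ.re| ≤ B := by
        have h1 : |ζ.re - ζ₀.re| ≤ 1 := by
          have := Complex.abs_re_le_norm (ζ - ζ₀)
          rw [mem_ball_iff_norm] at hball
          simpa using this.trans hball.le
        have := abs_sub_abs_le_abs_sub ζ.re ζ₀.re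
        simp only [B]; linarith
      have hw : weight t ≤ weight (reVec (p ζ t)) * w := by
        have e : t = reVec (p ζ t) + fun k => -(ζ.re * v k) := by
          ext k; simp [reVec, hp]
        have h1 := weight_add_le (reVec (p ζ t)) fun k => -(ζ.re * v k)
        rw [← e] at h1
        refine h1.trans (mul_le_mul_of_nonneg_left ?_ (weight_pos _).le)
        refine Finset.prod_le_prod (fun _ _ => by positivity) fun k _ => ?_
        have hB : 0 ≤ B := by positivity
        rw [abs_neg, abs_mul, abs_mul, abs_abs, abs_of_nonneg hB]
        gcongr
      have hw0 : 0 < w := weight_pos _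
      have h3 := weight_pos (reVec (p ζ t))
      have h4 := weight_pos t
      rw [mul_assoc]
      refine mul_le_mul (le_abs_self C) ?_ (by positivity) (abs_nonneg _)
      rw [← div_eq_mul_inv, inv_le_comm₀ (by positivity) (by positivity), inv_div,
        div_le_iff₀ (by positivity), ← mul_pow]
      gcongr
  have hconst : ∀ r : ℝ, ∫ t, f (p r t) = ∫ t, f (ofRealVec t) := fun r => by
    rw [← integral_add_right_eq_self (fun t => f (ofRealVec t)) (fun k => r * v k)]
    congr 1; ext t; congr 1; ext k
    simp [hp, ofRealVec]
  have hI : Complex.I ∈ S := fun k => by simpa using hv k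
  have := eq_of_eq_on_real hSo hSc hreal hφ hconst hI
  rw [← this]
  congr 1; ext t; congr 1; ext k
  simp [hp, mul_comm]

theorem integrable_shift {n : ℕ} {s C : ℝ} {f : (Fin n → ℂ) → ℂ}
    (hd : DifferentiableOn ℂ f (strip n s))
    (hb : ∀ z ∈ strip n s, ‖f z‖ ≤ C * ((weight (reVec z)) ^ 2)⁻¹)
    (v : Fin n → ℝ) (hv : ∀ k, |v k| < s) :
    Integrable fun t : Fin n → ℝ => f (fun k => t k + v k * Complex.I) := by
  have hmem : ∀ t : Fin n → ℝ, (fun k => (t k + v k * Complex.I : ℂ)) ∈ strip n s := fun t k => by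
    simpa using hv k
  refine (integrable_weight_inv_sq.const_mul C).mono' (Continuous.aestronglyMeasurable ?_)
    (Eventually.of_forall fun t => (hb _ (hmem t)).trans (le_of_eq ?_))
  · exact hd.continuousOn.comp_continuous (by fun_prop) hmem
  · congr 4
    ext k; simp [reVec]

/-- The kernel function of a complex variable. -/
def KC (g : ℝ) (z : ℂ) : ℂ :=
  Complex.Gamma (Complex.I * z + g / 2) * Complex.Gamma (-(Complex.I * z) + g / 2)

/-- The weight function of a complex variable. -/
def WC (g : ℝ) (z : ℂ) : ℂ :=
  (Complex.Gamma (Complex.I * z))⁻¹ * (Complex.Gamma (-(Complex.I * z) + g))⁻¹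

theorem differentiable_WC (g : ℝ) : Differentiable ℂ (WC g) := by
  have h := Complex.differentiable_one_div_Gamma
  unfold WC
  refine Differentiable.mul ?_ ?_
  · exact h.comp (f := fun z : ℂ => Complex.I * z) (by fun_prop)
  · exact h.comp (f := fun z : ℂ => -(Complex.I * z) + g) (by fun_prop)

theorem differentiableAt_Gamma_of_re_pos {s : ℂ} (hs : 0 < s.re) :
    DifferentiableAt ℂ Complex.Gamma s := by
  refine Complex.differentiableAt_Gamma s fun m h => ?_
  have hm : (0 : ℝ) ≤ m := m.cast_nonneg
  rw [h] at hs
  simp at hs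
  linarith

/-- A product of two Gamma functions on complementary lines. -/
def gammaPair (a b : ℝ) (z : ℂ) : ℂ :=
  Complex.Gamma (Complex.I * z + a) * Complex.Gamma (-(Complex.I * z) + b)

theorem KC_eq_gammaPair (g : ℝ) : KC g = gammaPair (g / 2) (g / 2) := by
  ext z; simp [KC, gammaPair]

theorem differentiableAt_gammaPair {a b : ℝ} {z : ℂ} (h1 : z.im < a) (h2 : -b < z.im) :
    DifferentiableAt ℂ (gammaPair a b) z := by
  unfold gammaPair
  refine DifferentiableAt.mul ?_ ?_
  · refine DifferentiableAt.comp z (g := Complex.Gamma) (f := fun z : ℂ => Complex.I * z + a)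
      (differentiableAt_Gamma_of_re_pos ?_) (by fun_prop)
    simpa using h1
  · refine DifferentiableAt.comp z (g := Complex.Gamma) (f := fun z : ℂ => -(Complex.I * z) + b)
      (differentiableAt_Gamma_of_re_pos ?_) (by fun_prop)
    simp
    linarith

/-- Each of the two Gamma factors contributes `exp(-π|Re z|/2)`. Unequal `a` and `b` occur once the
contour has been moved towards the poles. -/
theorem exists_norm_gammaPair_le {a b s : ℝ} (ha : s < a) (hb : s < b) :
    ∃ C : ℝ, ∃ N : ℕ, 1 ≤ C ∧ ∀ z : ℂ, |z.im| ≤ s →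
      ‖gammaPair a b z‖ ≤ C * (1 + |z.re|) ^ N * Real.exp (-Real.pi * |z.re|) := by
  obtain ⟨C, N, hC, h⟩ := exists_norm_Gamma_le (a := a - s) (b := a + s) (by linarith)
  obtain ⟨C', N', hC', h'⟩ := exists_norm_Gamma_le (a := b - s) (b := b + s) (by linarith)
  refine ⟨C * C' + 1, N + N', by nlinarith [mul_nonneg hC hC'], fun z hz => ?_⟩
  rw [abs_le] at hz
  have h1 := h (Complex.I * z + a) (by simp; linarith) (by simp; linarith)
  have h2 := h' (-(Complex.I * z) + b) (by simp; linarith) (by simp; linarith)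
  simp only [Complex.add_im, Complex.mul_im, Complex.I_re, zero_mul, Complex.I_im, one_mul,
    zero_add, Complex.neg_im, Complex.ofReal_im, add_zero, abs_neg] at h1 h2
  rw [gammaPair, norm_mul]
  have he : Real.exp (-(Real.pi / 2 * |z.re|)) * Real.exp (-(Real.pi / 2 * |z.re|))
      = Real.exp (-Real.pi * |z.re|) := by rw [← Real.exp_add]; ring_nf
  calc _ ≤ (C * (1 + |z.re|) ^ N * Real.exp (-(Real.pi / 2 * |z.re|))) *
        (C' * (1 + |z.re|) ^ N' * Real.exp (-(Real.pi / 2 * |z.re|))) := by gcongr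
    _ = (C * C') * (1 + |z.re|) ^ (N + N') * Real.exp (-Real.pi * |z.re|) := by
      rw [← he, pow_add]; ring
    _ ≤ _ := by gcongr; linarith

theorem exists_norm_inv_gammaPair_le (a b s : ℝ) :
    ∃ C : ℝ, ∃ N : ℕ, 1 ≤ C ∧ ∀ z : ℂ, |z.im| ≤ s →
      ‖(Complex.Gamma (Complex.I * z + a))⁻¹ * (Complex.Gamma (-(Complex.I * z) + b))⁻¹‖
        ≤ C * (1 + |z.re|) ^ N * Real.exp (Real.pi * |z.re|) := by
  obtain ⟨C, N, hC, h⟩ := exists_norm_Gamma_inv_le (a - s) (a + s)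
  obtain ⟨C', N', hC', h'⟩ := exists_norm_Gamma_inv_le (b - s) (b + s)
  refine ⟨C * C' + 1, N + N', by nlinarith [mul_nonneg hC hC'], fun z hz => ?_⟩
  rw [abs_le] at hz
  have h1 := h (Complex.I * z + a) (by simp; linarith) (by simp; linarith)
  have h2 := h' (-(Complex.I * z) + b) (by simp; linarith) (by simp; linarith)
  simp only [Complex.add_im, Complex.mul_im, Complex.I_re, zero_mul, Complex.I_im, one_mul,
    zero_add, Complex.neg_im, Complex.ofReal_im, add_zero, abs_neg] at h1 h2
  rw [norm_mul]
  have he : Real.exp (Real.pi / 2 * |z.re|) * Real.exp (Real.pi / 2 * |z.re|)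
      = Real.exp (Real.pi * |z.re|) := by rw [← Real.exp_add]; ring_nf
  calc _ ≤ (C * (1 + |z.re|) ^ N * Real.exp (Real.pi / 2 * |z.re|)) *
        (C' * (1 + |z.re|) ^ N' * Real.exp (Real.pi / 2 * |z.re|)) := by gcongr
    _ = (C * C') * (1 + |z.re|) ^ (N + N') * Real.exp (Real.pi * |z.re|) := by
      rw [← he, pow_add]; ring
    _ ≤ _ := by gcongr; linarith

theorem exists_norm_WC_le (g s : ℝ) :
    ∃ C : ℝ, ∃ N : ℕ, 1 ≤ C ∧ ∀ z : ℂ, |z.im| ≤ s →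
      ‖WC g z‖ ≤ C * (1 + |z.re|) ^ N * Real.exp (Real.pi * |z.re|) := by
  obtain ⟨C, N, hC, h⟩ := exists_norm_inv_gammaPair_le 0 g s
  refine ⟨C, N, hC, fun z hz => ?_⟩
  simpa [WC] using h z hz

theorem weight_mul_one_le {n m : ℕ} (l : Fin n → ℝ) (c : Fin m → ℝ) (i : Fin n) (a : Fin m) :
    1 + |l i - c a| ≤ weight l * weight c :=
  (one_add_abs_sub_le _ _).trans (mul_le_mul (one_add_abs_le_weight l i)
    (one_add_abs_le_weight c a) (by positivity) (weight_pos l).le)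

/-- Product over pairs of factors with a polynomial times exponential bound. -/
theorem norm_prod_prod_le {n m : ℕ} (s : Fin n → Finset (Fin m)) (F : Fin n → Fin m → ℂ)
    (l : Fin n → ℝ) (c : Fin m → ℝ) {C κ : ℝ} {N : ℕ} (hC : 1 ≤ C)
    (hF : ∀ i, ∀ a ∈ s i, ‖F i a‖ ≤ C * (1 + |l i - c a|) ^ N * Real.exp (κ * |l i - c a|)) :
    ‖∏ i, ∏ a ∈ s i, F i a‖ ≤ C ^ (n * m) * (weight l * weight c) ^ (N * (n * m))
      * Real.exp (κ * ∑ i, ∑ a ∈ s i, |l i - c a|) := by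
  have hw : 1 ≤ weight l * weight c := one_le_mul_of_one_le_of_one_le (one_le_weight l)
    (one_le_weight c)
  set D := C * (weight l * weight c) ^ N
  have hD : 1 ≤ D := one_le_mul_of_one_le_of_one_le hC (one_le_pow₀ hw)
  have h1 : ∀ i, ‖∏ a ∈ s i, F i a‖ ≤ D ^ m * Real.exp (κ * ∑ a ∈ s i, |l i - c a|) := by
    intro i
    rw [norm_prod]
    have : ∏ a ∈ s i, ‖F i a‖ ≤ ∏ a ∈ s i, D * Real.exp (κ * |l i - c a|) := by
      refine Finset.prod_le_prod (fun _ _ => norm_nonneg _) fun a ha => (hF i a ha).trans ?_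
      have := weight_mul_one_le l c i a
      simp only [D]
      gcongr
    refine this.trans ?_
    rw [Finset.prod_mul_distrib, Finset.prod_const, ← Real.exp_sum, ← Finset.mul_sum]
    gcongr
    simpa using Finset.card_le_univ (s i)
  rw [norm_prod]
  refine (Finset.prod_le_prod (fun _ _ => norm_nonneg _) fun i _ => h1 i).trans (le_of_eq ?_)
  rw [Finset.prod_mul_distrib, Finset.prod_const, ← Real.exp_sum, ← Finset.mul_sum,
    Finset.card_univ, Fintype.card_fin, ← pow_mul, mul_pow, mul_comm m n, ← pow_mul]

theorem exists_prod_gammaPair_le {a b s : ℝ} (ha : s < a) (hb : s < b) (n m : ℕ) :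
    ∃ C : ℝ, ∃ N : ℕ, 1 ≤ C ∧ ∀ (l : Fin n → ℂ) (c : Fin m → ℂ),
      (∀ i a, |(l i - c a).im| ≤ s) →
      ‖∏ i, ∏ k, gammaPair a b (l i - c k)‖ ≤ C * (weight (reVec l) * weight (reVec c)) ^ N *
        Real.exp (-Real.pi * crossEnergy (reVec l) (reVec c)) := by
  obtain ⟨C, N, hC, h⟩ := exists_norm_gammaPair_le ha hb
  refine ⟨C ^ (n * m), N * (n * m), one_le_pow₀ hC, fun l c hlc => ?_⟩
  exact norm_prod_prod_le (fun _ => Finset.univ) _ (reVec l) (reVec c) hC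
    fun i k _ => by simpa [reVec] using h (l i - c k) (hlc i k)

theorem differentiableAt_prod {E ι : Type*} [NormedAddCommGroup E] [NormedSpace ℂ E]
    (s : Finset ι) {f : ι → E → ℂ} {x : E} (h : ∀ i ∈ s, DifferentiableAt ℂ (f i) x) :
    DifferentiableAt ℂ (fun y => ∏ i ∈ s, f i y) x := by
  classical
  induction s using Finset.induction_on with
  | empty => simp
  | insert i s hi ih =>
    simp only [Finset.prod_insert hi]
    exact (h i (by simp)).mul (ih fun j hj => h j (by simp [hj]))

/-- The product of weight functions over ordered pairs of distinct indices, with shifts. -/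
def offProd (g : ℝ) {n : ℕ} (δ : Fin n → Fin n → ℂ) (c : Fin n → ℂ) : ℂ :=
  ∏ i, ∏ j ∈ ({i}ᶜ : Finset (Fin n)), WC g (c i - c j - δ i j)

theorem differentiable_offProd (g : ℝ) {n : ℕ} (δ : Fin n → Fin n → ℂ) :
    Differentiable ℂ (offProd g δ) := by
  unfold offProd
  intro c
  refine differentiableAt_prod _ fun i _ => differentiableAt_prod _ fun j _ => ?_
  exact (differentiable_WC g).differentiableAt.comp c
    (f := fun c : Fin n → ℂ => c i - c j - δ i j) (by fun_prop)

theorem sum_compl_abs_sub {n : ℕ} (t : Fin n → ℝ) :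
    ∑ i, ∑ j ∈ ({i}ᶜ : Finset (Fin n)), |t i - t j| = 2 * pairEnergy t := by
  rw [two_mul_pairEnergy]
  refine Finset.sum_congr rfl fun i _ => ?_
  rw [← Finset.sum_add_sum_compl {i} (fun j => |t i - t j|)]
  simp

/-- The shifts are purely imaginary, so they do not affect the exponential rate. The factor 2
appears because each unordered pair occurs in both orders. The weight being entire, `s` is
arbitrary. -/
theorem exists_offProd_le (g : ℝ) {n : ℕ} (δ : Fin n → Fin n → ℂ)
    (hδ : ∀ i j, (δ i j).re = 0) (s : ℝ) :
    ∃ C : ℝ, ∃ N : ℕ, 1 ≤ C ∧ ∀ c : Fin n → ℂ, (∀ k, |(c k).im| ≤ s) →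
      ‖offProd g δ c‖ ≤ C * (weight (reVec c)) ^ N *
        Real.exp (2 * Real.pi * pairEnergy (reVec c)) := by
  obtain ⟨C, N, hC, h⟩ := exists_norm_WC_le g (s + s + ∑ i, ∑ j, |(δ i j).im|)
  refine ⟨C ^ (n * n), 2 * (N * (n * n)), one_le_pow₀ hC, fun c hc => ?_⟩
  have := norm_prod_prod_le (fun i => ({i}ᶜ : Finset (Fin n)))
    (fun i j => WC g (c i - c j - δ i j)) (reVec c) (reVec c) hC
    (κ := Real.pi) (N := N) fun i j _ => ?_
  · rw [offProd]
    refine this.trans (le_of_eq ?_)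
    rw [sum_compl_abs_sub, ← sq (weight _), ← pow_mul]
    ring_nf
  · have := h (c i - c j - δ i j) ?_
    · simpa [reVec, hδ] using this
    · have h1 : |(δ i j).im| ≤ ∑ i, ∑ j, |(δ i j).im| :=
        (Finset.single_le_sum (f := fun j => |(δ i j).im|) (fun _ _ => abs_nonneg _)
          (Finset.mem_univ j)).trans
        (Finset.single_le_sum (f := fun i => ∑ j, |(δ i j).im|)
          (fun _ _ => Finset.sum_nonneg fun _ _ => abs_nonneg _) (Finset.mem_univ i))
      rw [Complex.sub_im, Complex.sub_im]
      have := abs_sub ((c i).im - (c j).im) (δ i j).im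
      have := abs_sub (c i).im (c j).im
      linarith [hc i, hc j]

theorem hatMuProd_eq_offProd (g : ℝ) {n : ℕ} (l : Fin n → ℝ) :
    hatMuProd g l = offProd g 0 (ofRealVec l) := by
  have h := Finset.prod_prod_Ioi_mul_eq_prod_prod_off_diag
    (fun i j : Fin n => WC g (ofRealVec l j - ofRealVec l i))
  simp only [offProd, Pi.zero_apply, sub_zero]
  rw [← h, hatMuProd]
  refine Finset.prod_congr rfl fun i _ => Finset.prod_congr rfl fun j _ => ?_
  simp [hatMu, hatW, WC, ofRealVec]

end RationalRuijsenaars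

end

/-! ### Bounds for the kernels of the raising and Baxter operators. -/

noncomputable section

namespace RationalRuijsenaars

open MeasureTheory Filter Topology

theorem pairEnergy_nonneg {n : ℕ} (t : Fin n → ℝ) : 0 ≤ pairEnergy t :=
  Finset.sum_nonneg fun _ _ => Finset.sum_nonneg fun _ _ => abs_nonneg _

theorem abs_le_weight {n : ℕ} (t : Fin n → ℝ) (k : Fin n) : |t k| ≤ weight t :=
  (le_add_of_nonneg_left zero_le_one).trans (one_add_abs_le_weight t k)

/-- Exponential decay outside the box of radius `weight l` absorbs every power of `weight c`, at the
price of a power of `weight l`. -/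
theorem exists_weight_decay {κ : ℝ} (hκ : 0 < κ) (n m N P : ℕ) :
    ∃ C : ℝ, ∃ N' : ℕ, 0 ≤ C ∧ ∀ (l : Fin n → ℝ) (c : Fin m → ℝ),
      weight c ^ N * Real.exp (-(κ * ∑ a, max (|c a| - weight l) 0))
        ≤ C * weight l ^ N' * (weight c ^ P)⁻¹ := by
  obtain ⟨C, hC, h⟩ := exists_exp_neg_sum_le hκ m (N + P)
  refine ⟨C * 2 ^ ((N + P) * m), (N + P) * m, by positivity, fun l c => ?_⟩
  have h1 := h (weight l) (weight_pos l).le c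
  have hc := weight_pos c
  have h2 : 1 + weight l ≤ 2 * weight l := by linarith [one_le_weight l]
  rw [← div_eq_mul_inv, le_div_iff₀ (by positivity)]
  calc _ = Real.exp (-(κ * ∑ a, max (|c a| - weight l) 0)) * weight c ^ (N + P) := by
        rw [pow_add]; ring
    _ ≤ C * (1 + weight l) ^ ((N + P) * m) := h1
    _ ≤ C * (2 * weight l) ^ ((N + P) * m) := by
      have := weight_pos l
      gcongr
    _ = _ := by rw [mul_pow]; ring

/-- The three exponentials are the sizes of kernel, measure and wave function. After the energy
inequality there remain the wave bound in `l` and integrable decay in `c`; this makes the induction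
on the number of variables possible. -/
theorem exists_raising_decay (m N P : ℕ) :
    ∃ C : ℝ, ∃ N' : ℕ, 0 ≤ C ∧ ∀ (l : Fin (m + 1) → ℝ) (c : Fin m → ℝ),
      weight c ^ N * (Real.exp (-Real.pi * crossEnergy l c) *
        Real.exp (2 * Real.pi * pairEnergy c) * Real.exp (-Real.pi * pairEnergy c))
        ≤ C * weight l ^ N' * Real.exp (-Real.pi * pairEnergy l) * (weight c ^ P)⁻¹ := by
  obtain ⟨C, N', hC, h⟩ := exists_weight_decay Real.pi_pos (m + 1) m N P
  refine ⟨C, N', hC, fun l c => ?_⟩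
  have hE := energy_le_crossEnergy_succ l c (weight_pos l).le (abs_le_weight l)
  have hc := weight_pos c
  rw [← Real.exp_add, ← Real.exp_add]
  calc _ ≤ weight c ^ N * (Real.exp (-Real.pi * pairEnergy l) *
        Real.exp (-(Real.pi * ∑ a, max (|c a| - weight l) 0))) := by
        rw [← Real.exp_add]
        refine mul_le_mul_of_nonneg_left (Real.exp_le_exp.2 ?_) (by positivity)
        nlinarith [mul_le_mul_of_nonneg_left hE Real.pi_pos.le]
    _ = (weight c ^ N * Real.exp (-(Real.pi * ∑ a, max (|c a| - weight l) 0)))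
        * Real.exp (-Real.pi * pairEnergy l) := by ring
    _ ≤ (C * weight l ^ N' * (weight c ^ P)⁻¹) * Real.exp (-Real.pi * pairEnergy l) := by
        exact mul_le_mul_of_nonneg_right (h l c) (Real.exp_pos _).le
    _ = _ := by ring

/-- The last exponential is the growth of the Baxter kernel for `2|Im z| ≤ κ`. The condition `κ < 1`
is the origin of the restriction `|Im x| < 1/2`. -/
theorem exists_baxter_decay {κ : ℝ} (hκ0 : 0 ≤ κ) (hκ : κ < 1) (n N P : ℕ) :
    ∃ C : ℝ, ∃ N' : ℕ, 0 ≤ C ∧ ∀ (l c : Fin n → ℝ),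
      weight c ^ N * (Real.exp (-Real.pi * crossEnergy l c) *
        Real.exp (2 * Real.pi * pairEnergy c) * Real.exp (-Real.pi * pairEnergy c) *
        Real.exp (Real.pi * κ * |(∑ i, l i) - ∑ a, c a|))
        ≤ C * weight l ^ N' * (weight c ^ P)⁻¹ := by
  obtain ⟨C, N', hC, h⟩ := exists_weight_decay (κ := Real.pi * (1 - κ))
    (mul_pos Real.pi_pos (by linarith)) n n N P
  refine ⟨C, N', hC, fun l c => ?_⟩
  obtain ⟨h1, h2⟩ := energy_le_crossEnergy l c (weight_pos l).le (abs_le_weight l)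
  have hc := weight_pos c
  refine le_trans ?_ (h l c)
  rw [← Real.exp_add, ← Real.exp_add, ← Real.exp_add]
  refine mul_le_mul_of_nonneg_left (Real.exp_le_exp.2 ?_) (by positivity)
  -- A convex combination of the two energy inequalities, with weights `1 - κ` and `κ`: the second
  -- absorbs the drift, the first keeps some decay.
  have h3 : pairEnergy c + (1 - κ) * ∑ a, max (|c a| - weight l) 0
      + κ * |(∑ i, l i) - ∑ a, c a| ≤ crossEnergy l c := by
    nlinarith [pairEnergy_nonneg l, mul_le_mul_of_nonneg_left h1 (by linarith : 0 ≤ 1 - κ),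
      mul_le_mul_of_nonneg_left h2 hκ0]
  nlinarith [mul_le_mul_of_nonneg_left h3 Real.pi_pos.le]

/-- The common form of the kernels, for complex variables and with shifts in the measure. -/
def kernelC (g : ℝ) {n m : ℕ} (δ : Fin m → Fin m → ℂ) (l : Fin n → ℂ) (c : Fin m → ℂ) (z : ℂ) : ℂ :=
  Complex.exp (2 * Real.pi * Complex.I * z * ((∑ i, l i) - ∑ a, c a))
    * (∏ i, ∏ a, KC g (l i - c a)) * offProd g δ c

theorem hatKernel_eq_kernelC (g : ℝ) {n m : ℕ} (l : Fin n → ℝ) (c : Fin m → ℝ) (z : ℂ) :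
    hatKernel g l c z = kernelC g 0 (ofRealVec l) (ofRealVec c) z := by
  rw [hatKernel, kernelC, hatMuProd_eq_offProd]
  simp [ofRealVec, hatKProd, hatK, KC]

theorem norm_exp_two_pi_le (z S : ℂ) :
    ‖Complex.exp (2 * Real.pi * Complex.I * z * S)‖
      ≤ Real.exp (2 * Real.pi * (|z.im| * |S.re|)) * Real.exp (2 * Real.pi * (|z.re| * |S.im|)) := by
  rw [Complex.norm_exp, ← Real.exp_add, ← mul_add]
  have : (2 * Real.pi * Complex.I * z * S).re
      = 2 * Real.pi * (-(z.im * S.re) - z.re * S.im) := by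
    simp [Complex.mul_re, Complex.mul_im]; ring
  rw [this, ← abs_mul, ← abs_mul]
  gcongr
  linarith [neg_abs_le (z.im * S.re), neg_abs_le (z.re * S.im)]

/-- A bound of the type that the wave functions satisfy on strips. -/
def HasWaveBound (g : ℝ) {m : ℕ} (F : (Fin m → ℂ) → ℂ) : Prop :=
  ∀ s < g / 2, ∃ C : ℝ, ∃ N : ℕ, 0 ≤ C ∧ ∀ c : Fin m → ℂ, (∀ k, |(c k).im| ≤ s) →
    ‖F c‖ ≤ C * weight (reVec c) ^ N * Real.exp (-Real.pi * pairEnergy (reVec c))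

theorem exists_prod_KC_le {g s : ℝ} (hs : s < g / 2) (n m : ℕ) :
    ∃ C : ℝ, ∃ N : ℕ, 1 ≤ C ∧ ∀ (l : Fin n → ℂ) (c : Fin m → ℂ),
      (∀ i a, |(l i - c a).im| ≤ s) →
      ‖∏ i, ∏ k, KC g (l i - c k)‖ ≤ C * (weight (reVec l) * weight (reVec c)) ^ N *
        Real.exp (-Real.pi * crossEnergy (reVec l) (reVec c)) := by
  rw [KC_eq_gammaPair]
  exact exists_prod_gammaPair_le hs hs n m

/-- Kernel and wave function are taken at `c` and `c'` with equal real but different imaginary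
parts, as happens in contour shifts that move a shift from one factor to the other. Only the poles
of `K̂` and the strip of `F` restrict `s` and `s'`; the measure is entire, so `s₂` is free. -/
theorem exists_raising_bound {g : ℝ} {m : ℕ} {F : (Fin m → ℂ) → ℂ} (hF : HasWaveBound g F)
    (δ : Fin m → Fin m → ℂ) (hδ : ∀ i j, (δ i j).re = 0) {s s' : ℝ} (hs : s < g / 2)
    (hs' : s' < g / 2) (s₂ x B : ℝ) :
    ∃ C : ℝ, ∃ N : ℕ, 0 ≤ C ∧ ∀ (l : Fin (m + 1) → ℂ) (c c' : Fin m → ℂ),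
      (∀ i a, |(l i - c a).im| ≤ s) → (∀ a, |(c a).im| ≤ s₂) → (∀ a, |(c' a).im| ≤ s') →
      reVec c' = reVec c → |((∑ i, l i) - ∑ a, c a).im| ≤ B →
      ‖kernelC g δ l c x * F c'‖ ≤ C * weight (reVec l) ^ N *
        Real.exp (-Real.pi * pairEnergy (reVec l)) * (weight (reVec c) ^ 2)⁻¹ := by
  obtain ⟨C1, N1, hC1, h1⟩ := exists_prod_KC_le hs (m + 1) m
  obtain ⟨C2, N2, hC2, h2⟩ := exists_offProd_le g δ hδ s₂
  obtain ⟨C3, N3, hC3, h3⟩ := hF s' hs'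
  obtain ⟨C4, N4, hC4, h4⟩ := exists_raising_decay m (N1 + N2 + N3) 2
  refine ⟨Real.exp (2 * Real.pi * (|x| * B)) * C1 * C2 * C3 * C4, N1 + N4, by positivity,
    fun l c c' hlc hc hc' hcc hB => ?_⟩
  have hw := weight_pos (reVec l)
  have hwc := weight_pos (reVec c)
  have h0 := norm_exp_two_pi_le x ((∑ i, l i) - ∑ a, c a)
  simp only [Complex.ofReal_im, abs_zero, zero_mul, mul_zero, Real.exp_zero, one_mul,
    Complex.ofReal_re] at h0
  have h0' : Real.exp (2 * Real.pi * (|x| * |((∑ i, l i) - ∑ a, c a).im|))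
      ≤ Real.exp (2 * Real.pi * (|x| * B)) := by gcongr
  rw [kernelC, norm_mul, norm_mul, norm_mul]
  calc _ ≤ Real.exp (2 * Real.pi * (|x| * B)) *
        (C1 * (weight (reVec l) * weight (reVec c)) ^ N1 *
          Real.exp (-Real.pi * crossEnergy (reVec l) (reVec c))) *
        (C2 * weight (reVec c) ^ N2 * Real.exp (2 * Real.pi * pairEnergy (reVec c))) *
        (C3 * weight (reVec c) ^ N3 * Real.exp (-Real.pi * pairEnergy (reVec c))) := by
        gcongr
        · exact h0.trans h0'
        · exact h1 l c hlc
        · exact h2 c hc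
        · exact hcc ▸ h3 c' hc'
    _ = Real.exp (2 * Real.pi * (|x| * B)) * C1 * C2 * C3 * weight (reVec l) ^ N1 *
        (weight (reVec c) ^ (N1 + N2 + N3) *
        (Real.exp (-Real.pi * crossEnergy (reVec l) (reVec c)) *
          Real.exp (2 * Real.pi * pairEnergy (reVec c)) *
          Real.exp (-Real.pi * pairEnergy (reVec c)))) := by
        rw [mul_pow, pow_add, pow_add]; ring
    _ ≤ Real.exp (2 * Real.pi * (|x| * B)) * C1 * C2 * C3 * weight (reVec l) ^ N1 *
        (C4 * weight (reVec l) ^ N4 * Real.exp (-Real.pi * pairEnergy (reVec l)) *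
          (weight (reVec c) ^ 2)⁻¹) := by
        exact mul_le_mul_of_nonneg_left (h4 (reVec l) (reVec c)) (by positivity)
    _ = _ := by rw [pow_add]; ring

/-- The exponent `P` of decay is arbitrary, so that polynomial factors, such as those from
differentiation in `z`, can be absorbed. -/
theorem exists_baxter_bound {g : ℝ} {n : ℕ} {F : (Fin n → ℂ) → ℂ} (hF : HasWaveBound g F)
    (δ : Fin n → Fin n → ℂ) (hδ : ∀ i j, (δ i j).re = 0) {s s' κ : ℝ} (hs : s < g / 2)
    (hs' : s' < g / 2) (hκ0 : 0 ≤ κ) (hκ : κ < 1) (s₂ A B : ℝ) (P : ℕ) :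
    ∃ C : ℝ, ∃ N : ℕ, 0 ≤ C ∧ ∀ (l c c' : Fin n → ℂ) (z : ℂ),
      (∀ i a, |(l i - c a).im| ≤ s) → (∀ a, |(c a).im| ≤ s₂) → (∀ a, |(c' a).im| ≤ s') →
      reVec c' = reVec c → |((∑ i, l i) - ∑ a, c a).im| ≤ B → |z.re| ≤ A → 2 * |z.im| ≤ κ →
      ‖kernelC g δ l c z * F c'‖ ≤ C * weight (reVec l) ^ N * (weight (reVec c) ^ P)⁻¹ := by
  obtain ⟨C1, N1, hC1, h1⟩ := exists_prod_KC_le hs n n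
  obtain ⟨C2, N2, hC2, h2⟩ := exists_offProd_le g δ hδ s₂
  obtain ⟨C3, N3, hC3, h3⟩ := hF s' hs'
  obtain ⟨C4, N4, hC4, h4⟩ := exists_baxter_decay hκ0 hκ n (N1 + N2 + N3) P
  refine ⟨Real.exp (2 * Real.pi * (A * B)) * C1 * C2 * C3 * C4, N1 + N4, by positivity,
    fun l c c' z hlc hc hc' hcc hB hz1 hz2 => ?_⟩
  have hw := weight_pos (reVec l)
  have hwc := weight_pos (reVec c)
  have hre : ((∑ i, l i) - ∑ a, c a).re = (∑ i, reVec l i) - ∑ a, reVec c a := by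
    simp [reVec]
  have h0 : ‖Complex.exp (2 * Real.pi * Complex.I * z * ((∑ i, l i) - ∑ a, c a))‖
      ≤ Real.exp (Real.pi * κ * |(∑ i, reVec l i) - ∑ a, reVec c a|) *
        Real.exp (2 * Real.pi * (A * B)) := by
    refine (norm_exp_two_pi_le z _).trans ?_
    rw [hre]
    have hA : 0 ≤ A := (abs_nonneg _).trans hz1
    refine mul_le_mul (Real.exp_le_exp.2 ?_) (by gcongr) (Real.exp_pos _).le (Real.exp_pos _).le
    have := mul_le_mul_of_nonneg_right hz2 (abs_nonneg ((∑ i, reVec l i) - ∑ a, reVec c a))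
    nlinarith [Real.pi_pos]
  rw [kernelC, norm_mul, norm_mul, norm_mul]
  calc _ ≤ (Real.exp (Real.pi * κ * |(∑ i, reVec l i) - ∑ a, reVec c a|) *
          Real.exp (2 * Real.pi * (A * B))) *
        (C1 * (weight (reVec l) * weight (reVec c)) ^ N1 *
          Real.exp (-Real.pi * crossEnergy (reVec l) (reVec c))) *
        (C2 * weight (reVec c) ^ N2 * Real.exp (2 * Real.pi * pairEnergy (reVec c))) *
        (C3 * weight (reVec c) ^ N3 * Real.exp (-Real.pi * pairEnergy (reVec c))) := by
        gcongr
        · exact h1 l c hlc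
        · exact h2 c hc
        · exact hcc ▸ h3 c' hc'
    _ = Real.exp (2 * Real.pi * (A * B)) * C1 * C2 * C3 * weight (reVec l) ^ N1 *
        (weight (reVec c) ^ (N1 + N2 + N3) *
        (Real.exp (-Real.pi * crossEnergy (reVec l) (reVec c)) *
          Real.exp (2 * Real.pi * pairEnergy (reVec c)) *
          Real.exp (-Real.pi * pairEnergy (reVec c)) *
          Real.exp (Real.pi * κ * |(∑ i, reVec l i) - ∑ a, reVec c a|))) := by
        rw [mul_pow, pow_add, pow_add]; ring
    _ ≤ Real.exp (2 * Real.pi * (A * B)) * C1 * C2 * C3 * weight (reVec l) ^ N1 *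
        (C4 * weight (reVec l) ^ N4 * (weight (reVec c) ^ P)⁻¹) := by
        exact mul_le_mul_of_nonneg_left (h4 (reVec l) (reVec c)) (by positivity)
    _ = _ := by rw [pow_add]; ring

theorem differentiableAt_KC {g : ℝ} {z : ℂ} (hz : |z.im| < g / 2) :
    DifferentiableAt ℂ (KC g) z := by
  rw [KC_eq_gammaPair]
  rw [abs_lt] at hz
  exact differentiableAt_gammaPair hz.2 hz.1

/-- Holomorphy of the kernel along a holomorphic family of arguments. -/
theorem differentiableAt_kernelC {E : Type*} [NormedAddCommGroup E] [NormedSpace ℂ E] {g : ℝ}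
    {n m : ℕ} (δ : Fin m → Fin m → ℂ) {l : E → Fin n → ℂ} {c : E → Fin m → ℂ} {z : E → ℂ} {e : E}
    (hl : DifferentiableAt ℂ l e) (hc : DifferentiableAt ℂ c e) (hz : DifferentiableAt ℂ z e)
    (him : ∀ i a, |(l e i - c e a).im| < g / 2) :
    DifferentiableAt ℂ (fun e => kernelC g δ (l e) (c e) (z e)) e := by
  have hl' : ∀ i, DifferentiableAt ℂ (fun e => l e i) e := differentiableAt_pi.1 hl
  have hc' : ∀ a, DifferentiableAt ℂ (fun e => c e a) e := differentiableAt_pi.1 hc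
  unfold kernelC
  refine DifferentiableAt.mul (DifferentiableAt.mul ?_ ?_) ?_
  · refine DifferentiableAt.cexp (DifferentiableAt.mul (by fun_prop) (DifferentiableAt.sub ?_ ?_))
    · exact DifferentiableAt.fun_sum fun i _ => hl' i
    · exact DifferentiableAt.fun_sum fun a _ => hc' a
  · refine differentiableAt_prod _ fun i _ => differentiableAt_prod _ fun a _ => ?_
    exact DifferentiableAt.comp e (g := KC g) (f := fun e => l e i - c e a)
      (differentiableAt_KC (him i a)) ((hl' i).sub (hc' a))
  · exact (differentiable_offProd g δ).differentiableAt.comp e hc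

end RationalRuijsenaars

end

/-! ### The wave function on a strip and its translation covariance. -/

noncomputable section

namespace RationalRuijsenaars

open MeasureTheory Filter Topology

/-- The wave function with complex spectral variables in a strip. -/
def waveC (g : ℝ) : (n : ℕ) → (Fin n → ℝ) → (Fin n → ℂ) → ℂ
  | 0, _, _ => 1
  | 1, x, l => Complex.exp (2 * Real.pi * Complex.I * l 0 * x 0)
  | m + 2, x, l => hatD (m + 1) g * ∫ c : Fin (m + 1) → ℝ,
      kernelC g 0 l (ofRealVec c) (x (Fin.last (m + 1)) : ℂ) * wave g (m + 1) (Fin.init x) c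

theorem waveC_ofRealVec (g : ℝ) (n : ℕ) (x l : Fin n → ℝ) :
    waveC g n x (ofRealVec l) = wave g n x l := by
  match n with
  | 0 => rfl
  | 1 => simp [waveC, wave, ofRealVec]
  | m + 2 => simp only [waveC, wave, raising, hatKernel_eq_kernelC]

theorem exists_mem_strip_of_mem_strip {n : ℕ} {a : ℝ} (ha : 0 < a) {l : Fin n → ℂ}
    (hl : l ∈ strip n a) : ∃ s < a, 0 < s ∧ l ∈ strip n s := by
  have h1 : ∀ᶠ s in 𝓝[<] a, ∀ k, |(l k).im| < s :=
    eventually_all.2 fun k => (lt_mem_nhds (hl k)).filter_mono nhdsWithin_le_nhds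
  have h2 : ∀ᶠ s in 𝓝[<] a, 0 < s := (lt_mem_nhds ha).filter_mono nhdsWithin_le_nhds
  obtain ⟨s, hs1, hs2, hs3⟩ := (h1.and (h2.and self_mem_nhdsWithin)).exists
  exact ⟨s, hs3, hs2, hs1⟩

theorem continuous_reVec {n : ℕ} : Continuous (reVec (n := n)) :=
  continuous_pi fun k => Complex.continuous_re.comp (continuous_apply k)

theorem continuous_pairEnergy {n : ℕ} : Continuous (pairEnergy (n := n)) := by
  unfold pairEnergy; fun_prop

theorem continuous_kernelC_ofRealVec {g : ℝ} {n m : ℕ} (δ : Fin m → Fin m → ℂ) {l : Fin n → ℂ}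
    (hl : l ∈ strip n (g / 2)) (z : ℂ) :
    Continuous fun c : Fin m → ℝ => kernelC g δ l (ofRealVec c) z := by
  refine continuous_iff_continuousAt.2 fun c => ?_
  have h := differentiableAt_kernelC (g := g) δ (l := fun _ => l) (c := id) (z := fun _ => z)
    (e := ofRealVec c) (by fun_prop) (by fun_prop) (by fun_prop)
    fun i a => by simpa [ofRealVec] using hl i
  exact ContinuousAt.comp (f := ofRealVec) h.continuousAt continuous_ofRealVec.continuousAt

theorem abs_im_sum_sub_le {n m : ℕ} {l : Fin n → ℂ} {c : Fin m → ℂ} {s s' : ℝ}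
    (hl : ∀ k, |(l k).im| ≤ s) (hc : ∀ k, |(c k).im| ≤ s') :
    |((∑ i, l i) - ∑ a, c a).im| ≤ n * s + m * s' := by
  rw [Complex.sub_im, Complex.im_sum, Complex.im_sum]
  refine (abs_sub _ _).trans (add_le_add ?_ ?_)
  · refine (Finset.abs_sum_le_sum_abs _ _).trans ?_
    simpa using Finset.sum_le_card_nsmul Finset.univ (fun i => |(l i).im|) s fun i _ => hl i
  · refine (Finset.abs_sum_le_sum_abs _ _).trans ?_
    simpa using Finset.sum_le_card_nsmul Finset.univ (fun i => |(c i).im|) s' fun i _ => hc i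

theorem hasWaveBound_exp {g : ℝ} (x : Fin 1 → ℝ) : HasWaveBound g (waveC g 1 x) := by
  intro s _
  refine ⟨Real.exp (2 * Real.pi * (|x 0| * |s|)), 0, by positivity, fun c hc => ?_⟩
  have hE : pairEnergy (reVec c) = 0 := by simp [pairEnergy]
  rw [hE, pow_zero, mul_zero, Real.exp_zero, mul_one, mul_one, waveC]
  have h := norm_exp_two_pi_le (x 0) (c 0)
  simp only [Complex.ofReal_im, abs_zero, zero_mul, mul_zero, Real.exp_zero, one_mul,
    Complex.ofReal_re] at h
  rw [mul_right_comm]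
  refine h.trans ?_
  have : |(c 0).im| ≤ |s| := (hc 0).trans (le_abs_self s)
  gcongr

theorem integrable_raising {g : ℝ} (hg : 0 < g) {m : ℕ} {F : (Fin m → ℂ) → ℂ}
    (hd : DifferentiableOn ℂ F (strip m (g / 2))) (hb : HasWaveBound g F) (y : ℝ)
    {l : Fin (m + 1) → ℂ} (hl : l ∈ strip (m + 1) (g / 2)) :
    Integrable fun c : Fin m → ℝ => kernelC g 0 l (ofRealVec c) (y : ℂ) * F (ofRealVec c) := by
  have hg2 : 0 < g / 2 := by positivity
  obtain ⟨s, hs, -, hls⟩ := exists_mem_strip_of_mem_strip hg2 hl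
  obtain ⟨C, N, hC, h⟩ := exists_raising_bound hb 0 (by simp) hs (half_lt_self hg2) 0 y
    (((m + 1 : ℕ) : ℝ) * s + (m : ℝ) * 0)
  have hFc : Continuous fun c : Fin m → ℝ => F (ofRealVec c) :=
    hd.continuousOn.comp_continuous continuous_ofRealVec (ofRealVec_mem_strip hg2)
  refine (integrable_weight_inv_sq.const_mul (C * weight (reVec l) ^ N *
    Real.exp (-Real.pi * pairEnergy (reVec l)))).mono'
    ((continuous_kernelC_ofRealVec 0 hl y).mul hFc).aestronglyMeasurable
    (Eventually.of_forall fun c => ?_)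
  have := h l (ofRealVec c) (ofRealVec c) (fun i a => by simpa [ofRealVec] using (hls i).le)
    (fun a => by simp [ofRealVec]) (fun a => by simpa [ofRealVec] using (half_pos hg2).le) rfl
    (abs_im_sum_sub_le (fun k => (hls k).le) fun k => by simp [ofRealVec])
  rwa [reVec_ofRealVec] at this

/-- The three properties are proved together: convergence and holomorphy for one more variable need
the bound for the previous wave function, and the raising integral returns a bound of the same form.
-/
theorem waveC_properties {g : ℝ} (hg : 0 < g) (n : ℕ) (hn : 1 ≤ n) (x : Fin n → ℝ) :
    DifferentiableOn ℂ (waveC g n x) (strip n (g / 2)) ∧ HasWaveBound g (waveC g n x) ∧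
      WaveConverges g n x := by
  induction n, hn using Nat.le_induction with
  | base =>
    refine ⟨?_, hasWaveBound_exp x, trivial⟩
    have : waveC g 1 x = fun l => Complex.exp (2 * Real.pi * Complex.I * l 0 * x 0) := by
      ext l; rfl
    rw [this]
    fun_prop
  | succ n hn ih =>
    obtain ⟨m, rfl⟩ : ∃ m, n = m + 1 := ⟨n - 1, by omega⟩
    obtain ⟨hd, hb, hconv⟩ := ih (Fin.init x)
    have hg2 : 0 < g / 2 := by positivity
    set F := waveC g (m + 1) (Fin.init x) with hF
    set y := x (Fin.last (m + 1)) with hy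
    have hwave : ∀ l, waveC g (m + 2) x l = hatD (m + 1) g * ∫ c : Fin (m + 1) → ℝ,
        kernelC g 0 l (ofRealVec c) (y : ℂ) * F (ofRealVec c) := fun l => by
      simp only [waveC, hF, waveC_ofRealVec, hy]
    have hFc : Continuous fun c : Fin (m + 1) → ℝ => F (ofRealVec c) :=
      hd.continuousOn.comp_continuous continuous_ofRealVec (ofRealVec_mem_strip hg2)
    have hcont : ∀ l ∈ strip (m + 2) (g / 2), Continuous fun c : Fin (m + 1) → ℝ =>
        kernelC g 0 l (ofRealVec c) (y : ℂ) * F (ofRealVec c) := fun l hl =>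
      (continuous_kernelC_ofRealVec 0 hl y).mul hFc
    have hbound : ∀ s < g / 2, ∃ C : ℝ, ∃ N : ℕ, 0 ≤ C ∧ ∀ l : Fin (m + 2) → ℂ,
        (∀ k, |(l k).im| ≤ s) → ∀ c : Fin (m + 1) → ℝ,
        ‖kernelC g 0 l (ofRealVec c) (y : ℂ) * F (ofRealVec c)‖ ≤ C * weight (reVec l) ^ N *
          Real.exp (-Real.pi * pairEnergy (reVec l)) * (weight c ^ 2)⁻¹ := by
      intro s hs
      obtain ⟨C, N, hC, h⟩ := exists_raising_bound hb 0 (by simp) hs (half_lt_self hg2) 0 y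
        (((m + 2 : ℕ) : ℝ) * s + ((m + 1 : ℕ) : ℝ) * 0)
      refine ⟨C, N, hC, fun l hl c => ?_⟩
      have := h l (ofRealVec c) (ofRealVec c) (fun i a => by simpa [ofRealVec] using hl i)
        (fun a => by simp [ofRealVec]) (fun a => by simpa [ofRealVec] using (half_pos hg2).le) rfl
        (abs_im_sum_sub_le hl fun k => by simp [ofRealVec])
      rwa [reVec_ofRealVec] at this
    refine ⟨?_, ?_, hconv, fun l => ?_⟩
    · have : waveC g (m + 2) x = fun l => hatD (m + 1) g * ∫ c : Fin (m + 1) → ℝ,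
          kernelC g 0 l (ofRealVec c) (y : ℂ) * F (ofRealVec c) := funext hwave
      rw [this]
      refine DifferentiableOn.const_mul ?_ _
      intro l₀ hl₀
      obtain ⟨s, hs, -, hls⟩ := exists_mem_strip_of_mem_strip hg2 hl₀
      obtain ⟨C, N, hC, h⟩ := hbound s hs
      -- Near `l₀` the continuous prefactor is below `G l₀ + 1`, which gives a majorant independent
      -- of `l`.
      set G : (Fin (m + 2) → ℂ) → ℝ := fun l => C * weight (reVec l) ^ N *
        Real.exp (-Real.pi * pairEnergy (reVec l)) with hG
      have hGc : Continuous G := by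
        have h1 := continuous_weight.comp (continuous_reVec (n := m + 2))
        have h2 := continuous_pairEnergy.comp (continuous_reVec (n := m + 2))
        simp only [Function.comp_def] at h1 h2
        fun_prop
      have hV : strip (m + 2) s ∩ {l | G l < G l₀ + 1} ∈ 𝓝 l₀ :=
        inter_mem ((isOpen_strip _ _).mem_nhds hls)
          ((isOpen_lt hGc continuous_const).mem_nhds (by simp))
      refine (hasFDerivAt_integral_of_holomorphic (isOpen_strip _ _)
        (fun l hl => (hcont l hl).aestronglyMeasurable) (fun c l hl => ?_) hl₀ hV
        (b := fun c => (G l₀ + 1) * (weight c ^ 2)⁻¹) (integrable_weight_inv_sq.const_mul _)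
        ?_).differentiableAt.differentiableWithinAt
      · refine DifferentiableAt.differentiableWithinAt (DifferentiableAt.mul_const ?_ _)
        exact differentiableAt_kernelC (g := g) 0 (l := id) (c := fun _ => ofRealVec c)
          (z := fun _ => (y : ℂ)) (by fun_prop) (by fun_prop) (by fun_prop)
          fun i a => by simpa [ofRealVec] using hl i
      · intro l ⟨hl, hGl⟩ c
        refine (h l (fun k => (hl k).le) c).trans ?_
        have := weight_pos c
        exact mul_le_mul_of_nonneg_right hGl.le (by positivity)
    · intro s hs
      obtain ⟨C, N, hC, h⟩ := hbound s hs
      refine ⟨‖hatD (m + 1) g‖ * (C * ∫ c : Fin (m + 1) → ℝ, (weight c ^ 2)⁻¹), N, ?_,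
        fun l hl => ?_⟩
      · have : 0 ≤ ∫ c : Fin (m + 1) → ℝ, (weight c ^ 2)⁻¹ :=
          integral_nonneg fun c => by positivity
        positivity
      · rw [hwave, norm_mul]
        have := norm_integral_le_of_norm_le (integrable_weight_inv_sq.const_mul _)
          (Eventually.of_forall fun c => h l hl c)
        rw [integral_const_mul] at this
        calc _ ≤ ‖hatD (m + 1) g‖ * _ := mul_le_mul_of_nonneg_left this (norm_nonneg _)
          _ = _ := by ring
    · have := integrable_raising hg hd hb y (ofRealVec_mem_strip hg2 l)
      simpa only [hF, waveC_ofRealVec, hatKernel_eq_kernelC] using this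

theorem integral_kernelC_mul_eq {g : ℝ} {m : ℕ} (x : Fin (m + 2) → ℝ) (l : Fin (m + 2) → ℂ) :
    waveC g (m + 2) x l = hatD (m + 1) g * ∫ c : Fin (m + 1) → ℝ,
      kernelC g 0 l (ofRealVec c) (x (Fin.last (m + 1)) : ℂ) *
        waveC g (m + 1) (Fin.init x) (ofRealVec c) := by
  simp only [waveC_ofRealVec]
  rfl

theorem kernelC_add_const (g : ℝ) {n m : ℕ} (l : Fin n → ℂ) (c : Fin m → ℂ) (z t : ℂ) :
    kernelC g 0 (fun k => l k + t) (fun k => c k + t) z =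
      Complex.exp (2 * Real.pi * Complex.I * z * ((n - m) * t)) * kernelC g 0 l c z := by
  simp only [kernelC, offProd, add_sub_add_right_eq_sub, Finset.sum_add_distrib, Finset.sum_const,
    Finset.card_univ, Fintype.card_fin, nsmul_eq_mul]
  rw [← mul_assoc, ← mul_assoc, ← Complex.exp_add]
  congr 3
  ring_nf

/-- Apart from the exponential factor the kernel depends only on differences, so a real `t` can be
absorbed by translating the integration variables. -/
theorem waveC_add_real {g : ℝ} (n : ℕ) (hn : 1 ≤ n) (x : Fin n → ℝ) (l : Fin n → ℂ) (t : ℝ) :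
    waveC g n x (fun k => l k + t) =
      Complex.exp (2 * Real.pi * Complex.I * t * ∑ k, x k) * waveC g n x l := by
  induction n, hn using Nat.le_induction with
  | base =>
    simp only [waveC, ← Complex.exp_add]
    simp
    ring_nf
  | succ n hn ih =>
    obtain ⟨m, rfl⟩ : ∃ m, n = m + 1 := ⟨n - 1, by omega⟩
    rw [integral_kernelC_mul_eq, integral_kernelC_mul_eq, mul_left_comm (Complex.exp _)]
    refine congrArg (hatD (m + 1) g * ·) ?_
    rw [← integral_add_right_eq_self (fun c : Fin (m + 1) → ℝ =>
        kernelC g 0 (fun k => l k + t) (ofRealVec c) (x (Fin.last (m + 1)) : ℂ) *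
        waveC g (m + 1) (Fin.init x) (ofRealVec c)) (fun _ => t), ← integral_const_mul]
    refine integral_congr_ae (Eventually.of_forall fun c => ?_)
    beta_reduce
    have e : ofRealVec (c + fun _ => t) = fun k => ofRealVec c k + t := by
      ext k; simp [ofRealVec]
    rw [e, ih, kernelC_add_const, Fin.sum_univ_castSucc (fun k => x k)]
    have : Complex.exp (2 * Real.pi * Complex.I * t *
        ((∑ k : Fin (m + 1), x k.castSucc + x (Fin.last (m + 1)) : ℝ) : ℂ))
        = Complex.exp (2 * Real.pi * Complex.I * x (Fin.last (m + 1)) *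
            ((((m + 1 + 1 : ℕ) : ℂ) - ((m + 1 : ℕ) : ℂ)) * t)) *
          Complex.exp (2 * Real.pi * Complex.I * t * ((∑ k, Fin.init x k : ℝ) : ℂ)) := by
      rw [← Complex.exp_add]
      congr 1
      push_cast [Fin.init]
      ring
    rw [this]
    ring

/-- For complex `t` the contour cannot simply be translated. Instead the quotient of the two sides
is holomorphic in `t` on a convex strip and constant on the real axis. -/
theorem waveC_add {g : ℝ} (hg : 0 < g) {n : ℕ} (hn : 1 ≤ n) (x : Fin n → ℝ) {l : Fin n → ℂ}
    {t : ℂ} (hl : l ∈ strip n (g / 2)) (hlt : (fun k => l k + t) ∈ strip n (g / 2)) :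
    waveC g n x (fun k => l k + t) =
      Complex.exp (2 * Real.pi * Complex.I * t * ∑ k, x k) * waveC g n x l := by
  set S : Set ℂ := {ζ | (fun k => l k + ζ) ∈ strip n (g / 2)} with hS
  have hcont : Continuous fun ζ : ℂ => fun k => l k + ζ := by fun_prop
  have hSo : IsOpen S := (isOpen_strip n (g / 2)).preimage hcont
  have hSc : Convex ℝ S := by
    have : S = ⋂ k, (fun ζ : ℂ => ζ.im) ⁻¹' (Set.Ioo (-(g / 2) - (l k).im) (g / 2 - (l k).im)) := by
      ext ζ
      simp only [hS, strip, abs_lt, Set.mem_ofPred_eq, Set.mem_iInter, Set.mem_preimage,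
        Set.mem_Ioo, Complex.add_im]
      refine forall_congr' fun k => ?_
      constructor <;> rintro ⟨h1, h2⟩ <;> constructor <;> linarith
    rw [this]
    refine convex_iInter fun k => ?_
    exact (convex_Ioo _ _).is_linear_preimage Complex.imLm.isLinear
  have hd := (waveC_properties hg n hn x).1
  have hφ : DifferentiableOn ℂ (fun ζ : ℂ => waveC g n x (fun k => l k + ζ) *
      Complex.exp (-(2 * Real.pi * Complex.I * ζ * ∑ k, x k))) S := by
    refine DifferentiableOn.mul ?_ (by fun_prop)
    exact hd.comp (by fun_prop) fun ζ hζ => hζ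
  have := eq_of_eq_on_real hSo hSc (fun r k => by simpa using hl k) hφ (k := waveC g n x l)
    (fun r => by
      rw [waveC_add_real n hn, mul_right_comm, ← Complex.exp_add]
      simp) hlt
  rw [← this, mul_left_comm, ← Complex.exp_add]
  simp

end RationalRuijsenaars

end

/-! ### Cauchy determinants and sums over subsets. -/

noncomputable section

namespace RationalRuijsenaars

section Determinants

variable {K : Type*} [Field K]

/-- The product of the differences `t i - t j` over pairs `i < j`. -/
def diffProd {n : ℕ} (t : Fin n → K) : K := ∏ i, ∏ j ∈ Finset.Ioi i, (t i - t j)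

theorem diffProd_succ {n : ℕ} (t : Fin (n + 1) → K) :
    diffProd t = (∏ j : Fin n, (t 0 - t j.succ)) * diffProd fun i => t i.succ := by
  rw [diffProd, Fin.prod_univ_succ, Fin.prod_Ioi_zero]
  simp only [Fin.prod_Ioi_succ, diffProd]

theorem diffProd_neg_eq_prod {n : ℕ} (t : Fin n → K) :
    diffProd (-t) = ∏ i, ∏ j ∈ Finset.Ioi i, (t j - t i) := by
  simp [diffProd, neg_add_eq_sub]

/-- The Cauchy matrix with a column of ones put in front. -/
def borderedCauchy {m : ℕ} (x : Fin (m + 1) → K) (y : Fin m → K) :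
    Matrix (Fin (m + 1)) (Fin (m + 1)) K :=
  Matrix.of fun k => Fin.cons 1 fun c => (x k - y c)⁻¹

/-- Subtracting the top row leaves a single nonzero entry in the column of ones, and `(x k - y c)⁻¹
- (x 0 - y c)⁻¹` factors as `(x 0 - x k)` times both inverses. -/
theorem det_borderedCauchy_eq_mul {m : ℕ} (x : Fin (m + 1) → K) (y : Fin m → K)
    (h : ∀ k c, x k - y c ≠ 0) :
    (borderedCauchy x y).det = (∏ k : Fin m, (x 0 - x k.succ)) * (∏ c, (x 0 - y c)⁻¹) *
      (Matrix.of fun (k : Fin m) c => (x k.succ - y c)⁻¹).det := by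
  set B : Matrix (Fin (m + 1)) (Fin (m + 1)) K := Matrix.of fun k => if k = 0 then
    borderedCauchy x y 0 else borderedCauchy x y k - borderedCauchy x y 0 with hB
  have h1 : (borderedCauchy x y).det = B.det := by
    refine Matrix.det_eq_of_forall_row_eq_smul_add_const (fun k => if k = 0 then 0 else 1) 0
      (by simp) fun i j => ?_
    by_cases hi : i = 0 <;> simp [hB, hi]
  rw [h1, Matrix.det_succ_column_zero, Finset.sum_eq_single 0]
  · have h2 : B.submatrix (Fin.succAbove 0) Fin.succ = Matrix.of fun (k : Fin m) c =>
        (x 0 - x k.succ) * (Matrix.of (fun (k : Fin m) c => (x 0 - y c)⁻¹ *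
          (Matrix.of (fun (k : Fin m) c => (x k.succ - y c)⁻¹)) k c)) k c := by
      ext k c
      simp only [hB, Matrix.submatrix_apply, Fin.succAbove_zero, Matrix.of_apply,
        Fin.succ_ne_zero, if_false, Pi.sub_apply, borderedCauchy, Fin.cons_succ]
      have := h k.succ c
      have := h 0 c
      field_simp
      ring
    rw [h2, Matrix.det_mul_column, Matrix.det_mul_row]
    simp [hB, borderedCauchy, mul_assoc]
  · intro i _ hi
    simp [hB, hi, borderedCauchy]
  · simp

/-- Multiplying row `k` by `x k - y 0` produces a column of ones. Subtracting it from the others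
gives `(x k - y 0)/(x k - y c) - 1 = (y c - y 0)/(x k - y c)`. -/
theorem det_cauchy_eq_mul {m : ℕ} (x y : Fin (m + 1) → K) (h : ∀ k c, x k - y c ≠ 0) :
    (Matrix.of fun k c => (x k - y c)⁻¹).det = (∏ k, (x k - y 0)⁻¹) *
      (∏ c : Fin m, (y c.succ - y 0)) * (borderedCauchy x fun c => y c.succ).det := by
  set v : Fin (m + 1) → K := Fin.cons 1 fun c => y c.succ - y 0 with hv
  set B : Matrix (Fin (m + 1)) (Fin (m + 1)) K := Matrix.of fun k c =>
    v c * borderedCauchy x (fun c => y c.succ) k c with hB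
  set D : Matrix (Fin (m + 1)) (Fin (m + 1)) K := Matrix.of fun k c =>
    (x k - y 0) * (Matrix.of fun k c => (x k - y c)⁻¹) k c with hD
  have h1 : D.det = B.det := by
    rw [← Matrix.det_transpose, ← Matrix.det_transpose B]
    refine Matrix.det_eq_of_forall_row_eq_smul_add_const (fun k => if k = 0 then 0 else 1) 0
      (by simp) fun i j => ?_
    have hj0 := h j 0
    refine Fin.cases ?_ (fun c => ?_) i
    · simp [hB, hD, hv, borderedCauchy, hj0]
    · have := h j c.succ
      simp [hB, hD, hv, borderedCauchy]
      field_simp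
      ring
  have h2 : D.det = (∏ k, (x k - y 0)) * (Matrix.of fun k c => (x k - y c)⁻¹).det :=
    Matrix.det_mul_column _ _
  have h3 : B.det = (∏ c, v c) * (borderedCauchy x fun c => y c.succ).det :=
    Matrix.det_mul_row _ _
  have h4 : ∏ k, (x k - y 0) ≠ 0 := Finset.prod_ne_zero_iff.2 fun k _ => h k 0
  have h5 : ∏ c, v c = ∏ c : Fin m, (y c.succ - y 0) := by
    rw [Fin.prod_univ_succ]; simp [hv]
  rw [← h5, mul_assoc, ← h3, ← h1, h2, Finset.prod_inv_distrib, inv_mul_cancel_left₀ h4]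

/-- The two reductions alternate: one removes a `y`, the other an `x`. -/
theorem det_cauchy {n : ℕ} (x y : Fin n → K) (h : ∀ k c, x k - y c ≠ 0) :
    (Matrix.of fun k c => (x k - y c)⁻¹).det =
      diffProd x * diffProd (-y) * ∏ k, ∏ c, (x k - y c)⁻¹ := by
  induction n with
  | zero => simp [diffProd]
  | succ m ih =>
    rw [det_cauchy_eq_mul x y h, det_borderedCauchy_eq_mul _ _ fun k c => h k c.succ,
      ih (fun k => x k.succ) (fun c => y c.succ) fun k c => h k.succ c.succ,
      diffProd_succ x, diffProd_succ (-y), Fin.prod_univ_succ (fun k => ∏ c, (x k - y c)⁻¹)]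
    simp only [Fin.prod_univ_succ (fun c => (x _ - y c)⁻¹), Finset.prod_mul_distrib]
    rw [Fin.prod_univ_succ (fun k => (x k - y 0)⁻¹)]
    simp only [Pi.neg_apply, neg_sub_neg]
    have : (fun i : Fin m => -y i.succ) = -fun c : Fin m => y c.succ := rfl
    rw [this]
    ring

theorem det_borderedCauchy {m : ℕ} (x : Fin (m + 1) → K) (y : Fin m → K)
    (h : ∀ k c, x k - y c ≠ 0) :
    (borderedCauchy x y).det = diffProd x * diffProd (-y) * ∏ k, ∏ c, (x k - y c)⁻¹ := by
  rw [det_borderedCauchy_eq_mul x y h, det_cauchy _ _ fun k c => h k.succ c, diffProd_succ x,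
    Fin.prod_univ_succ (fun k => ∏ c, (x k - y c)⁻¹)]
  ring

/-- This is how generating functions over subsets arise from determinants: every argument is a sum
of two vectors, one of them weighted by `v`. -/
theorem multilinear_smul_add {ι M : Type*} [Fintype ι] [DecidableEq ι] [AddCommGroup M]
    [Module K M] (f : MultilinearMap K (fun _ : ι => M) K) (v : K) (A B : ι → M) :
    f (fun i => v • A i + B i) = ∑ s : Finset ι, v ^ s.card * f (s.piecewise A B) := by
  have h1 : (fun i => v • A i + B i) = (fun i => v • A i) + B := rfl
  rw [h1, MultilinearMap.map_add_univ]
  refine Finset.sum_congr rfl fun s _ => ?_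
  have h2 : s.piecewise (fun i => v • A i) B
      = s.piecewise (fun i => v • s.piecewise A B i) (s.piecewise A B) := by
    ext i
    by_cases hi : i ∈ s <;> simp [hi]
  rw [h2, MultilinearMap.map_piecewise_smul]
  simp

/-- The duality identity between sums over subsets for `m + 1` and for `m` variables. -/
theorem sum_subsets_duality {m : ℕ} (a : Fin (m + 1) → K) (b : Fin m → K) (h v : K)
    (h₁ : ∀ k c, a k - b c + h ≠ 0) (h₂ : ∀ k c, a k - b c - h ≠ 0) :
    ∑ s : Finset (Fin (m + 1)), v ^ s.card *
        (diffProd (s.piecewise (fun k => a k - h) fun k => a k + h) * diffProd (-b) *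
          ∏ k, ∏ c, (s.piecewise (fun k => a k - h) (fun k => a k + h) k - b c)⁻¹) =
      (1 + v) * ∑ s : Finset (Fin m), v ^ s.card *
        (diffProd a * diffProd (-s.piecewise (fun c => b c + h) fun c => b c - h) *
          ∏ k, ∏ c, (a k - s.piecewise (fun c => b c + h) (fun c => b c - h) c)⁻¹) := by
  -- Row `k` of this matrix is `v` times a bordered Cauchy row at `a k - h` plus one at `a k + h`.
  -- Seen by columns it is the constant column `1 + v`, followed by `v` times a Cauchy column at `b
  -- c + h` plus one at `b c - h`. The two expansions of its determinant are the two sides.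
  set D : Matrix (Fin (m + 1)) (Fin (m + 1)) K := Matrix.of fun k =>
    v • (Fin.cons 1 (fun c => (a k - h - b c)⁻¹) : Fin (m + 1) → K)
      + (Fin.cons 1 fun c => (a k + h - b c)⁻¹) with hD
  have hrow : D.det = ∑ s : Finset (Fin (m + 1)), v ^ s.card *
      (borderedCauchy (s.piecewise (fun k => a k - h) fun k => a k + h) b).det := by
    refine (multilinear_smul_add (Matrix.detRowAlternating (R := K)
      (n := Fin (m + 1))).toMultilinearMap v _ _).trans ?_
    refine Finset.sum_congr rfl fun s _ => ?_
    congr 1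
    change Matrix.det _ = _
    congr 1
    ext k j
    by_cases hk : k ∈ s <;> simp [hk, borderedCauchy]
  have hcol : D.det = (1 + v) * ∑ s : Finset (Fin m), v ^ s.card *
      (borderedCauchy a (s.piecewise (fun c => b c + h) fun c => b c - h)).det := by
    -- Currying freezes the constant column `1 + v`, so that only the remaining `m` columns are
    -- expanded.
    set f := (Matrix.detRowAlternating (R := K) (n := Fin (m + 1))).toMultilinearMap.curryLeft
      (fun _ : Fin (m + 1) => (1 + v : K)) with hf
    have e1 : D.det = f fun c => v • (fun k => (a k - (b c + h))⁻¹)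
        + (fun k => (a k - (b c - h))⁻¹) := by
      rw [← Matrix.det_transpose, hf, MultilinearMap.curryLeft_apply]
      change _ = Matrix.det _
      congr 1
      ext j k
      refine Fin.cases ?_ (fun c => ?_) j
      · simp [hD, add_comm]
      · simp only [hD, Matrix.transpose_apply, Matrix.of_apply, Pi.add_apply, Pi.smul_apply,
          Fin.cons_succ, smul_eq_mul]
        rw [show a k - h - b c = a k - (b c + h) by ring,
          show a k + h - b c = a k - (b c - h) by ring]
    rw [e1, multilinear_smul_add, Finset.mul_sum]
    refine Finset.sum_congr rfl fun s _ => ?_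
    rw [mul_left_comm]
    congr 1
    rw [hf, MultilinearMap.curryLeft_apply, ← Matrix.det_transpose (borderedCauchy _ _)]
    have e2 : (Matrix.of fun (j k : Fin (m + 1)) => (Fin.cons (1 + v) (fun _ => 1) :
        Fin (m + 1) → K) j * (borderedCauchy a
          (s.piecewise (fun c => b c + h) fun c => b c - h)).transpose j k)
        = Fin.cons (fun _ : Fin (m + 1) => (1 + v : K)) (s.piecewise
          (fun c k => (a k - (b c + h))⁻¹) fun c k => (a k - (b c - h))⁻¹) := by
      ext j k
      refine Fin.cases ?_ (fun c => ?_) j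
      · simp [borderedCauchy]
      · by_cases hc : c ∈ s <;> simp [borderedCauchy, hc]
    change Matrix.det _ = _
    rw [← e2, Matrix.det_mul_column, Fin.prod_univ_succ]
    simp
  have hx : ∀ (s : Finset (Fin (m + 1))) k c,
      s.piecewise (fun k => a k - h) (fun k => a k + h) k - b c ≠ 0 := fun s k c => by
    by_cases hk : k ∈ s
    · simpa [hk, sub_right_comm] using h₂ k c
    · simpa [hk, sub_add_eq_add_sub] using h₁ k c
  have hy : ∀ (s : Finset (Fin m)) k c,
      a k - s.piecewise (fun c => b c + h) (fun c => b c - h) c ≠ 0 := fun s k c => by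
    by_cases hc : c ∈ s
    · simpa [hc, sub_sub] using h₂ k c
    · simpa [hc, sub_sub_eq_add_sub, sub_add_eq_add_sub] using h₁ k c
  rw [hrow] at hcol
  simp only [det_borderedCauchy _ _ (hx _), det_borderedCauchy _ _ (hy _)] at hcol
  exact hcol

-- At the nodes `y c` the polynomial `∏ (X - a k)` agrees with its difference from `∏ (X - y k)`.
-- That difference has degree at most `m`, with coefficient `∑ y - ∑ a` at `X^m`, so the matrix is a
-- Vandermonde matrix times a triangular one.
open Polynomial in
theorem det_pow_prod_sub {m : ℕ} (a y : Fin (m + 1) → K) :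
    (Matrix.of fun (c j : Fin (m + 1)) => if j = Fin.last m then ∏ k, (y c - a k)
      else y c ^ (j : ℕ)).det = (∑ c, y c - ∑ k, a k) * diffProd (-y) := by
  set A : K[X] := ∏ k, (X - C (a k)) with hA
  set Y : K[X] := ∏ k, (X - C (y k)) with hY
  have hAm : A.Monic := monic_prod_of_monic _ _ fun k _ => monic_X_sub_C _
  have hYm : Y.Monic := monic_prod_of_monic _ _ fun k _ => monic_X_sub_C _
  have hAd : A.natDegree = m + 1 := by
    rw [hA, natDegree_prod_of_monic _ _ fun k _ => monic_X_sub_C _]; simp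
  have hYd : Y.natDegree = m + 1 := by
    rw [hY, natDegree_prod_of_monic _ _ fun k _ => monic_X_sub_C _]; simp
  set q := A - Y with hq
  have hqd : q.natDegree ≤ m := by
    rw [natDegree_le_iff_coeff_eq_zero]
    intro N hN
    rw [hq, coeff_sub]
    rcases (Nat.succ_le_of_lt hN).eq_or_lt with h | h
    · have h1 : A.coeff N = 1 := by rw [← h, Nat.succ_eq_add_one, ← hAd]; exact hAm.coeff_natDegree
      have h2 : Y.coeff N = 1 := by rw [← h, Nat.succ_eq_add_one, ← hYd]; exact hYm.coeff_natDegree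
      rw [h1, h2, sub_self]
    · rw [coeff_eq_zero_of_natDegree_lt (by omega), coeff_eq_zero_of_natDegree_lt (by omega),
        sub_self]
  have hqc : q.coeff m = ∑ c, y c - ∑ k, a k := by
    have h1 := prod_X_sub_C_coeff_card_pred (Finset.univ : Finset (Fin (m + 1))) a (by simp)
    have h2 := prod_X_sub_C_coeff_card_pred (Finset.univ : Finset (Fin (m + 1))) y (by simp)
    simp only [Finset.card_univ, Fintype.card_fin, Nat.add_sub_cancel] at h1 h2
    rw [hq, coeff_sub, hA, hY, h1, h2]
    ring
  set p : Fin (m + 1) → K[X] := fun j => if j = Fin.last m then q else X ^ (j : ℕ) with hp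
  have hpd : ∀ j, (p j).natDegree ≤ (j : ℕ) := fun j => by
    by_cases hj : j = Fin.last m
    · simpa [hp, hj] using hqd
    · simp [hp, hj]
  have h1 := Matrix.eval_matrixOfPolynomials_eq_vandermonde_mul_matrixOfPolynomials y p hpd
  have h2 : (Matrix.of fun (c j : Fin (m + 1)) => if j = Fin.last m then ∏ k, (y c - a k)
      else y c ^ (j : ℕ)) = Matrix.of fun c j => ((p j).eval (y c)) := by
    ext c j
    by_cases hj : j = Fin.last m
    · have hY0 : ∏ k, (y c - y k) = 0 := Finset.prod_eq_zero (Finset.mem_univ c) (sub_self _)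
      simp [hp, hj, hq, hA, hY, eval_prod, hY0]
    · simp [hp, hj]
  rw [h2, h1, Matrix.det_mul, Matrix.det_vandermonde, diffProd_neg_eq_prod, mul_comm]
  congr 1
  rw [Matrix.det_of_isUpperTriangular]
  · rw [Fin.prod_univ_castSucc]
    simp only [Matrix.of_apply, hp, Fin.castSucc_ne_last, if_false, if_true, Fin.val_last, hqc]
    simp
  · intro i j hij
    have hij' : (j : ℕ) < i := hij
    exact coeff_eq_zero_of_natDegree_lt ((hpd j).trans_lt hij')

/-- The row `R (b c + h) - R (b c - h)` has last entry `1 - 1 = 0`, so the determinant of these rows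
vanishes. Its expansion over subsets is evaluated by `det_pow_prod_sub`. -/
theorem sum_subsets_eq_zero {n : ℕ} (hn : 1 ≤ n) (a b : Fin n → K) (h : K)
    (h₁ : ∀ k c, b c + h - a k ≠ 0) (h₂ : ∀ k c, b c - h - a k ≠ 0) :
    ∑ s : Finset (Fin n), (-1) ^ s.card *
      ((∑ c, s.piecewise (fun c => b c + h) (fun c => b c - h) c - ∑ k, a k) *
        diffProd (-s.piecewise (fun c => b c + h) fun c => b c - h) *
        ∏ c, ∏ k, (s.piecewise (fun c => b c + h) (fun c => b c - h) c - a k)⁻¹) = 0 := by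
  obtain ⟨m, rfl⟩ : ∃ m, n = m + 1 := ⟨n - 1, by omega⟩
  set R : K → Fin (m + 1) → K := fun t j => if j = Fin.last m then 1
    else t ^ (j : ℕ) * ∏ k, (t - a k)⁻¹ with hR
  have h0 := multilinear_smul_add (Matrix.detRowAlternating (R := K)
      (n := Fin (m + 1))).toMultilinearMap (-1) (fun c => R (b c + h)) (fun c => R (b c - h))
  have hzero : (Matrix.detRowAlternating (R := K) (n := Fin (m + 1))).toMultilinearMap
      (fun c => (-1 : K) • R (b c + h) + R (b c - h)) = 0 := by
    change Matrix.det _ = 0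
    refine Matrix.det_eq_zero_of_column_eq_zero (Fin.last m) fun c => ?_
    simp [hR]
  rw [hzero] at h0
  rw [h0]
  refine Finset.sum_congr rfl fun s _ => ?_
  congr 1
  set y := s.piecewise (fun c => b c + h) fun c => b c - h with hy
  have hne : ∀ c k, y c - a k ≠ 0 := fun c k => by
    by_cases hc : c ∈ s
    · simpa [hy, hc] using h₁ k c
    · simpa [hy, hc] using h₂ k c
  rw [← det_pow_prod_sub, mul_comm, ← Matrix.det_mul_column]
  change _ = Matrix.det _
  congr 1
  ext c j
  have hp : ∏ k, (y c - a k) ≠ 0 := Finset.prod_ne_zero_iff.2 fun k _ => hne c k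
  have hpw : (s.piecewise (fun c => R (b c + h)) fun c => R (b c - h)) c = R (y c) := by
    by_cases hc : c ∈ s <;> simp [hy, hc]
  rw [hpw]
  by_cases hj : j = Fin.last m
  · simp [hR, hj, Finset.prod_inv_distrib, hp]
  · simp [hR, hj, mul_comm]

end Determinants

end RationalRuijsenaars

end

/-! ### Shift vectors, Macdonald coefficients and functional equations of the factors. -/

noncomputable section

namespace RationalRuijsenaars

open MeasureTheory Filter Topology

/-- The coefficients of the difference operators are singular where coordinates coincide; under
integrals this null set may be ignored. -/
theorem ae_injective (m : ℕ) : ∀ᵐ c : Fin m → ℝ, Function.Injective c := by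
  have h : ∀ i j : Fin m, i ≠ j → ∀ᵐ c : Fin m → ℝ, c i ≠ c j := by
    intro i j hij
    set p : Submodule ℝ (Fin m → ℝ) :=
      LinearMap.ker ((LinearMap.proj i : (Fin m → ℝ) →ₗ[ℝ] ℝ) - LinearMap.proj j) with hp
    have hp' : p ≠ ⊤ := by
      intro htop
      have : (Pi.single i 1 : Fin m → ℝ) ∈ p := htop ▸ Submodule.mem_top
      simp [hp, hij.symm] at this
    have := Measure.addHaar_submodule volume p hp'
    refine (measure_eq_zero_iff_ae_notMem.1 this).mono fun c hc h => hc ?_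
    simp [hp, h]
  have h' : ∀ᵐ c : Fin m → ℝ, ∀ i j, i ≠ j → c i ≠ c j := by
    rw [ae_all_iff]; intro i
    rw [ae_all_iff]; intro j
    by_cases hij : i = j
    · simp [hij]
    · filter_upwards [h i j hij] with c hc _ using hc
  filter_upwards [h'] with c hc i j hij
  by_contra hne
  exact hc i j hne hij

/-- The vector with entries `i/2` on `s` and `-i/2` off `s`. -/
def halfShift {n : ℕ} (s : Finset (Fin n)) (k : Fin n) : ℂ :=
  if k ∈ s then Complex.I / 2 else -(Complex.I / 2)

/-- The shifts of the measure that correspond to a subset of the variables. -/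
def cutShift {n : ℕ} (s : Finset (Fin n)) (i j : Fin n) : ℂ :=
  if i ∈ s ∧ j ∉ s then Complex.I else 0

/-- The coefficients of the rational Ruijsenaars–Macdonald operators. -/
def macCoeff (g : ℝ) {n : ℕ} (s : Finset (Fin n)) (l : Fin n → ℂ) : ℂ :=
  (-1) ^ (s.card * (n - 1)) * ∏ i ∈ s, ∏ j ∈ sᶜ, (l i - l j - Complex.I * (1 - g)) / (l i - l j)

/-- Both Gamma factors change by one unit, and each functional equation supplies a linear factor.
The zero of the second linear factor is treated separately. -/
theorem WC_sub_I (g : ℝ) {z : ℂ} (hz : z ≠ 0) :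
    WC g (z - Complex.I) = WC g z * -((z - Complex.I * (1 - g)) / z) := by
  have hI : Complex.I * z ≠ 0 := mul_ne_zero Complex.I_ne_zero hz
  have e1 : Complex.I * (z - Complex.I) = Complex.I * z + 1 := by
    rw [mul_sub, Complex.I_mul_I]; ring
  have e2 : (Complex.Gamma (-(Complex.I * (z - Complex.I)) + g))⁻¹
      = (-(Complex.I * z) + g - 1) * (Complex.Gamma (-(Complex.I * z) + g))⁻¹ := by
    rw [e1]
    by_cases h : -(Complex.I * z) + g - 1 = 0
    · rw [show -(Complex.I * z + 1) + (g : ℂ) = -(Complex.I * z) + g - 1 by ring, h]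
      simp
    · rw [show -(Complex.I * z) + (g : ℂ) = (-(Complex.I * z) + g - 1) + 1 by ring,
        Complex.Gamma_add_one _ h, mul_inv]
      rw [show -(Complex.I * z) + (g : ℂ) - 1 + 1 - 1 = -(Complex.I * z) + g - 1 by ring,
        mul_inv_cancel_left₀ h]
      ring_nf
  rw [WC, WC, e2, e1, Complex.Gamma_add_one _ hI, mul_inv]
  have : (Complex.I * z)⁻¹ * (-(Complex.I * z) + g - 1) = -((z - Complex.I * (1 - g)) / z) := by
    field_simp
    linear_combination (-((1 : ℂ) - g)) * Complex.I_sq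
  rw [← this]
  ring

theorem prod_compl_ite {n : ℕ} (s : Finset (Fin n)) (f : Fin n → Fin n → ℂ) :
    ∏ i, ∏ j ∈ ({i}ᶜ : Finset (Fin n)), (if i ∈ s ∧ j ∉ s then f i j else 1)
      = ∏ i ∈ s, ∏ j ∈ sᶜ, f i j := by
  rw [← Finset.prod_mul_prod_compl s]
  rw [Finset.prod_eq_one (s := sᶜ), mul_one]
  · refine Finset.prod_congr rfl fun i hi => ?_
    simp only [hi, true_and]
    rw [← Finset.prod_filter]
    refine Finset.prod_congr ?_ fun _ _ => rfl
    ext j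
    simp only [Finset.mem_filter, Finset.mem_compl, Finset.mem_singleton]
    constructor
    · exact fun h => h.2
    · exact fun h => ⟨fun hji => h (hji ▸ hi), h⟩
  · intro i hi
    rw [Finset.mem_compl] at hi
    simp [hi]

/-- The Macdonald coefficients are, up to sign, the ratio between shifted and unshifted measure. A
shift in the measure can thus be traded for the coefficient of a difference operator. -/
theorem offProd_cutShift (g : ℝ) {n : ℕ} (s : Finset (Fin n)) {c : Fin n → ℂ}
    (hc : Function.Injective c) :
    offProd g (cutShift s) c = offProd g 0 c *
      ∏ i ∈ s, ∏ j ∈ sᶜ, -((c i - c j - Complex.I * (1 - g)) / (c i - c j)) := by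
  rw [← prod_compl_ite, offProd, offProd, ← Finset.prod_mul_distrib]
  refine Finset.prod_congr rfl fun i _ => ?_
  rw [← Finset.prod_mul_distrib]
  refine Finset.prod_congr rfl fun j hj => ?_
  have hij : c i - c j ≠ 0 := by
    rw [sub_ne_zero]
    intro h
    rw [Finset.mem_compl, Finset.mem_singleton] at hj
    exact hj (hc h).symm
  by_cases h : i ∈ s ∧ j ∉ s
  · simp only [cutShift, h, not_false_eq_true, and_self, if_true, WC_sub_I g hij]
    simp
  · simp [cutShift, h]

/-- For nonempty `s`, `n - 1 = |sᶜ| + (|s| - 1)`, and `|s|(|s| - 1)` is even. -/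
theorem neg_one_pow_card_mul {n : ℕ} (s : Finset (Fin n)) :
    (-1 : ℂ) ^ (s.card * (n - 1)) = (-1) ^ (s.card * sᶜ.card) := by
  have h1 : sᶜ.card + s.card = n := by simp
  rw [neg_one_pow_eq_pow_mod_two, neg_one_pow_eq_pow_mod_two (n := s.card * sᶜ.card)]
  congr 1
  generalize s.card = r at *
  generalize sᶜ.card = t at *
  rcases Nat.eq_zero_or_pos r with h0 | h0
  · simp [h0]
  · obtain ⟨q, rfl⟩ : ∃ q, r = q + 1 := ⟨r - 1, by omega⟩
    have : n - 1 = t + q := by omega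
    rw [this, mul_add]
    have hq : Even ((q + 1) * q) := by
      rw [mul_comm]; exact Nat.even_mul_succ_self q
    obtain ⟨w, hw⟩ := hq
    omega

theorem offProd_cutShift_eq_macCoeff (g : ℝ) {n : ℕ} (s : Finset (Fin n)) {c : Fin n → ℂ}
    (hc : Function.Injective c) :
    offProd g (cutShift s) c = offProd g 0 c * macCoeff g s c := by
  rw [offProd_cutShift g s hc, macCoeff, neg_one_pow_card_mul]
  congr 1
  simp only [Finset.prod_neg, Finset.prod_mul_distrib, Finset.prod_const]
  rw [← pow_mul, mul_comm s.card]

/-- For `i ∈ s`, `j ∉ s` the half shifts add `i` to the difference, which cancels the cut; for the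
reversed pair they subtract `i`, which is the cut of the complement. -/
theorem offProd_add_halfShift (g : ℝ) {n : ℕ} (s : Finset (Fin n)) (c : Fin n → ℂ) :
    offProd g (cutShift s) (fun k => c k + halfShift s k) = offProd g (cutShift sᶜ) c := by
  refine Finset.prod_congr rfl fun i _ => Finset.prod_congr rfl fun j _ => ?_
  congr 1
  by_cases hi : i ∈ s <;> by_cases hj : j ∈ s <;> simp [cutShift, halfShift, hi, hj] <;> ring

/-- Expresses the coefficients of the difference operators as ratios of Vandermonde products, the
form in which they occur in Cauchy determinants. -/
theorem diffProd_piecewise {n : ℕ} (s : Finset (Fin n)) {t : Fin n → ℂ}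
    (ht : Function.Injective t) (h : ℂ) :
    diffProd (s.piecewise (fun k => t k - h) fun k => t k + h) =
      diffProd t * ∏ i ∈ s, ∏ j ∈ sᶜ, (t i - t j - 2 * h) / (t i - t j) := by
  rw [← prod_compl_ite s fun i j => (t i - t j - 2 * h) / (t i - t j)]
  have := Finset.prod_prod_Ioi_mul_eq_prod_prod_off_diag
    (fun j i : Fin n => if i ∈ s ∧ j ∉ s then (t i - t j - 2 * h) / (t i - t j) else (1 : ℂ))
  rw [← this, diffProd, diffProd, ← Finset.prod_mul_distrib]
  refine Finset.prod_congr rfl fun i _ => ?_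
  rw [← Finset.prod_mul_distrib]
  refine Finset.prod_congr rfl fun j hj => ?_
  have hne : i ≠ j := (Finset.mem_Ioi.1 hj).ne
  have h1 : t i - t j ≠ 0 := sub_ne_zero.2 fun e => hne (ht e)
  have h2 : t j - t i ≠ 0 := sub_ne_zero.2 fun e => hne (ht e).symm
  by_cases hi : i ∈ s <;> by_cases hj : j ∈ s <;> simp [hi, hj] <;> field_simp <;> ring

theorem diffProd_ne_zero {n : ℕ} {t : Fin n → ℂ} (ht : Function.Injective t) :
    diffProd t ≠ 0 :=
  Finset.prod_ne_zero_iff.2 fun _ _ => Finset.prod_ne_zero_iff.2 fun _ hj =>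
    sub_ne_zero.2 fun e => (Finset.mem_Ioi.1 hj).ne (ht e)

/-- The two half-shifted kernels share a product of Gamma functions at `(g - 1)/2` and differ only
by a linear factor. -/
theorem KC_sub_half {g : ℝ} {z : ℂ} (h : Complex.I * z + (g - 1) / 2 ≠ 0) :
    KC g (z - Complex.I / 2) = (Complex.I * z + (g - 1) / 2) *
      (Complex.Gamma (Complex.I * z + (g - 1) / 2) *
        Complex.Gamma (-(Complex.I * z) + (g - 1) / 2)) := by
  have e : Complex.I * (z - Complex.I / 2) = Complex.I * z + 1 / 2 := by
    linear_combination (-1 / 2 : ℂ) * Complex.I_sq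
  rw [KC, e, ← mul_assoc, ← Complex.Gamma_add_one _ h]
  congr 2 <;> ring

theorem KC_add_half {g : ℝ} {z : ℂ} (h : -(Complex.I * z) + (g - 1) / 2 ≠ 0) :
    KC g (z + Complex.I / 2) = (-(Complex.I * z) + (g - 1) / 2) *
      (Complex.Gamma (Complex.I * z + (g - 1) / 2) *
        Complex.Gamma (-(Complex.I * z) + (g - 1) / 2)) := by
  have e : Complex.I * (z + Complex.I / 2) = Complex.I * z - 1 / 2 := by
    linear_combination (1 / 2 : ℂ) * Complex.I_sq
  rw [KC, e, mul_left_comm, ← Complex.Gamma_add_one _ h]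
  congr 2 <;> ring

theorem sum_halfShift {n : ℕ} (s : Finset (Fin n)) :
    ∑ k, halfShift s k = Complex.I / 2 * (2 * s.card - n) := by
  have h1 : ((sᶜ.card : ℕ) : ℂ) + s.card = n := by
    exact_mod_cast (by simp : sᶜ.card + s.card = n)
  rw [← Finset.sum_add_sum_compl s, Finset.sum_congr rfl fun k hk =>
    show halfShift s k = Complex.I / 2 by simp [halfShift, hk],
    Finset.sum_congr (s₁ := sᶜ) rfl fun k hk =>
    show halfShift s k = -(Complex.I / 2) by simp [halfShift, Finset.mem_compl.1 hk]]
  simp only [Finset.sum_const, nsmul_eq_mul]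
  rw [← h1]
  ring

end RationalRuijsenaars

end

/-! ### The kernel function identity for the raising kernel. -/

noncomputable section

namespace RationalRuijsenaars

open MeasureTheory Filter Topology

/-- The factor that the kernel functions with arguments shifted by `±i/2` have in common. -/
def commonFactor (g : ℝ) {n m : ℕ} (l : Fin n → ℂ) (c : Fin m → ℂ) : ℂ :=
  ∏ k, ∏ a, (Complex.Gamma (Complex.I * (l k - c a) + (g - 1) / 2) *
    Complex.Gamma (-(Complex.I * (l k - c a)) + (g - 1) / 2) *
    ((Complex.I * (l k - c a) + (g - 1) / 2) * (Complex.I * (l k - c a) - (g - 1) / 2)))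

theorem prod_ite_neg_one {n : ℕ} (s : Finset (Fin n)) :
    ∏ k, (if k ∈ s then (1 : ℂ) else -1) = (-1) ^ sᶜ.card := by
  rw [← Finset.prod_mul_prod_compl s, Finset.prod_congr rfl fun k hk => if_pos hk,
    Finset.prod_congr (s₁ := sᶜ) rfl fun k hk => if_neg (Finset.mem_compl.1 hk)]
  simp

section

variable {g : ℝ} {n m : ℕ} {l : Fin n → ℂ} {c : Fin m → ℂ}

/-- `commonFactor` contains both linear factors, so each half-shifted kernel is, up to sign, the
common factor divided by one difference: the shape of the product in a Cauchy determinant. -/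
theorem prod_KC_sub_halfShift (h₁ : ∀ k a, Complex.I * (l k - c a) + (g - 1) / 2 ≠ 0)
    (h₂ : ∀ k a, Complex.I * (l k - c a) - (g - 1) / 2 ≠ 0) (s : Finset (Fin n)) :
    ∏ k, ∏ a, KC g (l k - halfShift s k - c a) = (-1) ^ (sᶜ.card * m) * (commonFactor g l c *
      ∏ k, ∏ a, (s.piecewise (fun k => Complex.I * l k - (g - 1) / 2)
        (fun k => Complex.I * l k + (g - 1) / 2) k - Complex.I * c a)⁻¹) := by
  have hsign : (-1 : ℂ) ^ (sᶜ.card * m) = ∏ k, ∏ _a : Fin m, if k ∈ s then (1 : ℂ) else -1 := by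
    simp only [Finset.prod_const, Finset.card_univ, Fintype.card_fin, Finset.prod_pow,
      prod_ite_neg_one, pow_mul]
  rw [hsign, commonFactor, ← Finset.prod_mul_distrib, ← Finset.prod_mul_distrib]
  refine Finset.prod_congr rfl fun k _ => ?_
  rw [← Finset.prod_mul_distrib, ← Finset.prod_mul_distrib]
  refine Finset.prod_congr rfl fun a _ => ?_
  have h1 := h₁ k a
  have h2 := h₂ k a
  have h3 : -(Complex.I * (l k - c a)) + (g - 1) / 2 ≠ 0 := by
    rw [← neg_ne_zero]; convert h2 using 1; ring
  by_cases hk : k ∈ s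
  · simp only [hk, halfShift, if_true, Finset.piecewise_eq_of_mem, one_mul]
    rw [show l k - Complex.I / 2 - c a = (l k - c a) - Complex.I / 2 by ring, KC_sub_half h1,
      show Complex.I * l k - (g - 1) / 2 - Complex.I * c a
        = Complex.I * (l k - c a) - (g - 1) / 2 by ring]
    linear_combination (-((Complex.I * (l k - c a) + (g - 1) / 2) *
      (Complex.Gamma (Complex.I * (l k - c a) + (g - 1) / 2) *
      Complex.Gamma (-(Complex.I * (l k - c a)) + (g - 1) / 2)))) * mul_inv_cancel₀ h2
  · simp only [hk, halfShift, if_false, Finset.piecewise_eq_of_notMem, not_false_eq_true]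
    rw [show l k - -(Complex.I / 2) - c a = (l k - c a) + Complex.I / 2 by ring, KC_add_half h3,
      show Complex.I * l k + (g - 1) / 2 - Complex.I * c a
        = Complex.I * (l k - c a) + (g - 1) / 2 by ring]
    linear_combination ((Complex.I * (l k - c a) - (g - 1) / 2) *
      (Complex.Gamma (Complex.I * (l k - c a) + (g - 1) / 2) *
      Complex.Gamma (-(Complex.I * (l k - c a)) + (g - 1) / 2))) * mul_inv_cancel₀ h1

theorem prod_KC_add_halfShift (h₁ : ∀ k a, Complex.I * (l k - c a) + (g - 1) / 2 ≠ 0)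
    (h₂ : ∀ k a, Complex.I * (l k - c a) - (g - 1) / 2 ≠ 0) (s : Finset (Fin m)) :
    ∏ k, ∏ a, KC g (l k - (c a + halfShift s a)) = (-1) ^ (sᶜ.card * n) * (commonFactor g l c *
      ∏ k, ∏ a, (Complex.I * l k - s.piecewise (fun a => Complex.I * c a + (g - 1) / 2)
        (fun a => Complex.I * c a - (g - 1) / 2) a)⁻¹) := by
  have hsign : (-1 : ℂ) ^ (sᶜ.card * n) = ∏ _k : Fin n, ∏ a, if a ∈ s then (1 : ℂ) else -1 := by
    simp only [Finset.prod_const, Finset.card_univ, Fintype.card_fin, prod_ite_neg_one, pow_mul]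
  rw [hsign, commonFactor, ← Finset.prod_mul_distrib, ← Finset.prod_mul_distrib]
  refine Finset.prod_congr rfl fun k _ => ?_
  rw [← Finset.prod_mul_distrib, ← Finset.prod_mul_distrib]
  refine Finset.prod_congr rfl fun a _ => ?_
  have h1 := h₁ k a
  have h2 := h₂ k a
  have h3 : -(Complex.I * (l k - c a)) + (g - 1) / 2 ≠ 0 := by
    rw [← neg_ne_zero]; convert h2 using 1; ring
  by_cases ha : a ∈ s
  · simp only [ha, halfShift, if_true, Finset.piecewise_eq_of_mem, one_mul]
    rw [show l k - (c a + Complex.I / 2) = (l k - c a) - Complex.I / 2 by ring, KC_sub_half h1,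
      show Complex.I * l k - (Complex.I * c a + (g - 1) / 2)
        = Complex.I * (l k - c a) - (g - 1) / 2 by ring]
    linear_combination (-((Complex.I * (l k - c a) + (g - 1) / 2) *
      (Complex.Gamma (Complex.I * (l k - c a) + (g - 1) / 2) *
      Complex.Gamma (-(Complex.I * (l k - c a)) + (g - 1) / 2)))) * mul_inv_cancel₀ h2
  · simp only [ha, halfShift, if_false, Finset.piecewise_eq_of_notMem, not_false_eq_true]
    rw [show l k - (c a + -(Complex.I / 2)) = (l k - c a) + Complex.I / 2 by ring, KC_add_half h3,
      show Complex.I * l k - (Complex.I * c a - (g - 1) / 2)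
        = Complex.I * (l k - c a) + (g - 1) / 2 by ring]
    linear_combination ((Complex.I * (l k - c a) - (g - 1) / 2) *
      (Complex.Gamma (Complex.I * (l k - c a) + (g - 1) / 2) *
      Complex.Gamma (-(Complex.I * (l k - c a)) + (g - 1) / 2))) * mul_inv_cancel₀ h1

theorem macCoeff_mul_diffProd (hl : Function.Injective l) (s : Finset (Fin n)) :
    macCoeff g s l * diffProd (fun k => Complex.I * l k) = (-1) ^ (s.card * (n - 1)) *
      diffProd (s.piecewise (fun k => Complex.I * l k - (g - 1) / 2)
        fun k => Complex.I * l k + (g - 1) / 2) := by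
  have hinj : Function.Injective fun k => Complex.I * l k := fun i j h =>
    hl (mul_left_cancel₀ Complex.I_ne_zero h)
  rw [diffProd_piecewise s hinj, macCoeff]
  have : ∏ i ∈ s, ∏ j ∈ sᶜ, (l i - l j - Complex.I * (1 - g)) / (l i - l j)
      = ∏ i ∈ s, ∏ j ∈ sᶜ, (Complex.I * l i - Complex.I * l j - 2 * ((g - 1) / 2)) /
        (Complex.I * l i - Complex.I * l j) := by
    refine Finset.prod_congr rfl fun i _ => Finset.prod_congr rfl fun j _ => ?_
    rw [← mul_div_mul_left _ (l i - l j) Complex.I_ne_zero]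
    congr 1
    · linear_combination (-((1 : ℂ) - g)) * Complex.I_sq
    · ring
  rw [this]
  ring

theorem offProd_add_halfShift_mul_diffProd (hc : Function.Injective c) (s : Finset (Fin m)) :
    offProd g (cutShift s) (fun k => c k + halfShift s k) * diffProd (-fun a => Complex.I * c a) =
      (-1) ^ (sᶜ.card * s.card) * (offProd g 0 c *
        diffProd (-s.piecewise (fun a => Complex.I * c a + (g - 1) / 2)
          fun a => Complex.I * c a - (g - 1) / 2)) := by
  have hinj : Function.Injective (-fun a => Complex.I * c a) := fun i j h =>
    hc (mul_left_cancel₀ Complex.I_ne_zero (neg_injective h))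
  have e : (-s.piecewise (fun a => Complex.I * c a + (g - 1) / 2)
      fun a => Complex.I * c a - (g - 1) / 2) = s.piecewise
      (fun k => (-fun a => Complex.I * c a) k - (g - 1) / 2)
      fun k => (-fun a => Complex.I * c a) k + (g - 1) / 2 := by
    ext k
    by_cases hk : k ∈ s <;> simp [hk] <;> ring
  rw [offProd_add_halfShift, offProd_cutShift g _ hc, e, diffProd_piecewise s hinj]
  have : ∏ i ∈ sᶜ, ∏ j ∈ sᶜᶜ, -((c i - c j - Complex.I * (1 - g)) / (c i - c j))
      = (-1) ^ (sᶜ.card * s.card) * ∏ i ∈ s, ∏ j ∈ sᶜ,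
        ((-fun a => Complex.I * c a) i - (-fun a => Complex.I * c a) j - 2 * ((g - 1) / 2)) /
        ((-fun a => Complex.I * c a) i - (-fun a => Complex.I * c a) j) := by
    rw [compl_compl, Finset.prod_comm]
    have hs : (-1 : ℂ) ^ (sᶜ.card * s.card) = ∏ i ∈ s, ∏ j ∈ sᶜ, (-1 : ℂ) := by
      simp [pow_mul]
    rw [hs, ← Finset.prod_mul_distrib]
    refine Finset.prod_congr rfl fun i _ => ?_
    rw [← Finset.prod_mul_distrib]
    refine Finset.prod_congr rfl fun j _ => ?_
    rw [← mul_div_mul_left _ (c j - c i) Complex.I_ne_zero, neg_one_mul]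
    congr 2
    · simp only [Pi.neg_apply]
      linear_combination (-((1 : ℂ) - g)) * Complex.I_sq
    · simp only [Pi.neg_apply]
      ring
  rw [this]
  ring

theorem exp_sub_sum_halfShift (y S : ℂ) (s : Finset (Fin n)) :
    Complex.exp (2 * Real.pi * Complex.I * y * (S - ∑ k, halfShift s k)) =
      Complex.exp (2 * Real.pi * Complex.I * y * S) * Complex.exp (-(Real.pi * y * n)) *
        Complex.exp (2 * Real.pi * y) ^ s.card := by
  rw [sum_halfShift, ← Complex.exp_nat_mul, ← Complex.exp_add, ← Complex.exp_add]
  congr 1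
  linear_combination (-(Real.pi : ℂ) * y * (2 * s.card - n)) * Complex.I_sq

end

/-- The kernel function identity that intertwines the difference operators in `m + 1` and in
`m` variables. -/
theorem sum_macCoeff_kernelC {g : ℝ} {m : ℕ} {l : Fin (m + 1) → ℂ} {c : Fin m → ℂ}
    (hl : Function.Injective l) (hc : Function.Injective c)
    (h₁ : ∀ k a, Complex.I * (l k - c a) + (g - 1) / 2 ≠ 0)
    (h₂ : ∀ k a, Complex.I * (l k - c a) - (g - 1) / 2 ≠ 0) (y v : ℂ) :
    ∑ s : Finset (Fin (m + 1)), v ^ s.card *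
        (macCoeff g s l * kernelC g 0 (fun k => l k - halfShift s k) c y) =
      Complex.exp (-(Real.pi * y)) * (1 + v * Complex.exp (2 * Real.pi * y)) *
      ∑ s : Finset (Fin m), v ^ s.card *
        kernelC g (cutShift s) l (fun k => c k + halfShift s k) y := by
  set V := v * Complex.exp (2 * Real.pi * y) with hV
  set a : Fin (m + 1) → ℂ := fun k => Complex.I * l k with ha
  set b : Fin m → ℂ := fun k => Complex.I * c k with hb
  have hDa : diffProd a ≠ 0 := diffProd_ne_zero fun i j h =>
    hl (mul_left_cancel₀ Complex.I_ne_zero h)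
  have hDb : diffProd (-b) ≠ 0 := diffProd_ne_zero fun i j h =>
    hc (mul_left_cancel₀ Complex.I_ne_zero (neg_injective h))
  -- The half step is `(g - 1)/2`, and `V` includes the factor `exp(2πy)` that the exponential in
  -- the kernel gives for each shifted index.
  have key := sum_subsets_duality a b ((g - 1) / 2) V
    (fun k i => by convert h₁ k i using 1; simp only [ha, hb]; ring)
    (fun k i => by convert h₂ k i using 1; simp only [ha, hb]; ring)
  set E := Complex.exp (2 * Real.pi * Complex.I * y * ((∑ k, l k) - ∑ k, c k))
  set P := E * Complex.exp (-(Real.pi * y * (m + 1 : ℕ))) * commonFactor g l c * offProd g 0 c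
    with hP
  have hL : ∀ s : Finset (Fin (m + 1)), v ^ s.card *
      (macCoeff g s l * kernelC g 0 (fun k => l k - halfShift s k) c y) * diffProd a *
        diffProd (-b) = P * (V ^ s.card *
        (diffProd (s.piecewise (fun k => a k - (g - 1) / 2) fun k => a k + (g - 1) / 2) *
          diffProd (-b) * ∏ k, ∏ i, (s.piecewise (fun k => a k - (g - 1) / 2)
            (fun k => a k + (g - 1) / 2) k - b i)⁻¹)) := by
    intro s
    have e1 : (∑ k, (l k - halfShift s k)) - ∑ k, c k
        = ((∑ k, l k) - ∑ k, c k) - ∑ k, halfShift s k := by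
      rw [Finset.sum_sub_distrib]; ring
    have e2 := macCoeff_mul_diffProd (g := g) hl s
    -- The total exponent is `m(m + 1)`, hence even.
    have e3 : (-1 : ℂ) ^ (s.card * (m + 1 - 1)) * (-1) ^ (sᶜ.card * m) = 1 := by
      have hcard : sᶜ.card + s.card = m + 1 := by simp
      rw [Nat.add_sub_cancel, ← pow_add, ← add_mul, add_comm s.card, hcard, mul_comm]
      exact Even.neg_one_pow (Nat.even_mul_succ_self m)
    rw [kernelC, e1, exp_sub_sum_halfShift, prod_KC_sub_halfShift h₁ h₂, hV, mul_pow, hP]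
    linear_combination (v ^ s.card * E * Complex.exp (-(Real.pi * y * (m + 1 : ℕ))) *
      Complex.exp (2 * Real.pi * y) ^ s.card * ((-1) ^ (sᶜ.card * m) * (commonFactor g l c *
      ∏ k, ∏ i, (s.piecewise (fun k => a k - (g - 1) / 2)
            (fun k => a k + (g - 1) / 2) k - b i)⁻¹)) * offProd g 0 c * diffProd (-b)) * e2 +
      (v ^ s.card * E * Complex.exp (-(Real.pi * y * (m + 1 : ℕ))) *
      Complex.exp (2 * Real.pi * y) ^ s.card * (commonFactor g l c *
      ∏ k, ∏ i, (s.piecewise (fun k => a k - (g - 1) / 2)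
            (fun k => a k + (g - 1) / 2) k - b i)⁻¹) * offProd g 0 c * diffProd (-b) *
        diffProd (s.piecewise (fun k => a k - (g - 1) / 2) fun k => a k + (g - 1) / 2)) * e3
  have hR : ∀ s : Finset (Fin m), Complex.exp (-(Real.pi * y)) * (v ^ s.card *
      kernelC g (cutShift s) l (fun k => c k + halfShift s k) y) * diffProd a * diffProd (-b) =
        P * (V ^ s.card * (diffProd a *
          diffProd (-s.piecewise (fun k => b k + (g - 1) / 2) fun k => b k - (g - 1) / 2) *
          ∏ k, ∏ i, (a k - s.piecewise (fun k => b k + (g - 1) / 2)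
            (fun k => b k - (g - 1) / 2) i)⁻¹)) := by
    intro s
    have e1 : (∑ k, l k) - ∑ k, (c k + halfShift s k)
        = ((∑ k, l k) - ∑ k, c k) - ∑ k, halfShift s k := by
      rw [Finset.sum_add_distrib]; ring
    have e2 := offProd_add_halfShift_mul_diffProd (g := g) hc s
    -- With `m = |s| + |sᶜ|` the exponent is `|sᶜ|(|sᶜ| + 1)` plus an even number.
    have e3 : (-1 : ℂ) ^ (sᶜ.card * (m + 1)) * (-1) ^ (sᶜ.card * s.card) = 1 := by
      have hcard : sᶜ.card + s.card = m := by simp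
      rw [← pow_add, ← mul_add]
      refine Even.neg_one_pow ?_
      have := Nat.even_mul_succ_self sᶜ.card
      obtain ⟨w, hw⟩ := this
      exact ⟨w + sᶜ.card * s.card, by nlinarith⟩
    have e4 : Complex.exp (-(Real.pi * y)) * Complex.exp (-(Real.pi * y * m))
        = Complex.exp (-(Real.pi * y * (m + 1 : ℕ))) := by
      rw [← Complex.exp_add]; congr 1; push_cast; ring
    rw [kernelC, e1, exp_sub_sum_halfShift, prod_KC_add_halfShift h₁ h₂, hV, mul_pow, hP, ← e4]
    linear_combination (Complex.exp (-(Real.pi * y)) * v ^ s.card * E *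
      Complex.exp (-(Real.pi * y * m)) *
      Complex.exp (2 * Real.pi * y) ^ s.card * ((-1) ^ (sᶜ.card * (m + 1)) * (commonFactor g l c *
      ∏ k, ∏ i, (a k - s.piecewise (fun k => b k + (g - 1) / 2)
            (fun k => b k - (g - 1) / 2) i)⁻¹)) * diffProd a) * e2 +
      (Complex.exp (-(Real.pi * y)) * v ^ s.card * E * Complex.exp (-(Real.pi * y * m)) *
      Complex.exp (2 * Real.pi * y) ^ s.card * (commonFactor g l c *
      ∏ k, ∏ i, (a k - s.piecewise (fun k => b k + (g - 1) / 2)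
            (fun k => b k - (g - 1) / 2) i)⁻¹) * diffProd a * offProd g 0 c *
        diffProd (-s.piecewise (fun k => b k + (g - 1) / 2) fun k => b k - (g - 1) / 2)) * e3
  -- The comparison is made after multiplication by the nonzero Vandermonde products, which clears
  -- the denominators of the coefficients.
  refine mul_right_cancel₀ hDa (mul_right_cancel₀ hDb ?_)
  have hL' := congrArg (P * ·) key
  simp only [Finset.mul_sum] at hL'
  rw [Finset.sum_mul, Finset.sum_mul, Finset.sum_congr rfl fun s _ => hL s, hL', Finset.mul_sum,
    Finset.sum_mul, Finset.sum_mul]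
  refine Finset.sum_congr rfl fun s _ => ?_
  linear_combination -(1 + V) * hR s

end RationalRuijsenaars

end

/-! ### Contour shifts by half steps and the difference equations. -/

noncomputable section

namespace RationalRuijsenaars

open MeasureTheory Filter Topology

theorem im_halfShift {n : ℕ} (s : Finset (Fin n)) (k : Fin n) : |(halfShift s k).im| = 1 / 2 := by
  unfold halfShift
  split_ifs <;> norm_num [abs_of_pos]

theorem re_halfShift {n : ℕ} (s : Finset (Fin n)) (k : Fin n) : (halfShift s k).re = 0 := by
  unfold halfShift
  split_ifs <;> norm_num

theorem re_cutShift {n : ℕ} (s : Finset (Fin n)) (i j : Fin n) : (cutShift s i j).re = 0 := by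
  unfold cutShift
  split_ifs <;> simp

theorem kernelC_cutShift (g : ℝ) {n m : ℕ} (s : Finset (Fin m)) (l : Fin n → ℂ) {c : Fin m → ℂ}
    (hc : Function.Injective c) (z : ℂ) :
    kernelC g (cutShift s) l c z = kernelC g 0 l c z * macCoeff g s c := by
  rw [kernelC, kernelC, offProd_cutShift_eq_macCoeff g s hc]
  ring

/-- Moving a shift by `±i/2` from one factor of an integrand to the other. -/
theorem integral_halfShift {m : ℕ} (s : Finset (Fin m)) {G F : (Fin m → ℂ) → ℂ} {η C : ℝ}
    (hη : 1 / 4 < η)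
    (hd : DifferentiableOn ℂ (fun w => G (fun k => w k + halfShift s k / 2) *
      F (fun k => w k - halfShift s k / 2)) (strip m η))
    (hb : ∀ w ∈ strip m η, ‖G (fun k => w k + halfShift s k / 2) *
      F (fun k => w k - halfShift s k / 2)‖ ≤ C * ((weight (reVec w)) ^ 2)⁻¹) :
    Integrable (fun c : Fin m → ℝ => G (fun k => ofRealVec c k + halfShift s k) *
      F (ofRealVec c)) ∧
    Integrable (fun c : Fin m → ℝ => G (ofRealVec c) *
      F (fun k => ofRealVec c k - halfShift s k)) ∧
    ∫ c : Fin m → ℝ, G (fun k => ofRealVec c k + halfShift s k) * F (ofRealVec c) =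
      ∫ c : Fin m → ℝ, G (ofRealVec c) * F (fun k => ofRealVec c k - halfShift s k) := by
  -- The half shift is divided equally between `G` and `F`. Both integrals are then shifts of the
  -- central one by `±i/4` per coordinate, and a strip only slightly wider than `1/4` suffices.
  set v : Fin m → ℝ := fun k => (halfShift s k).im / 2 with hv
  have hvI : ∀ k, ((v k : ℝ) : ℂ) * Complex.I = halfShift s k / 2 := fun k => by
    apply Complex.ext <;> simp [hv, re_halfShift]
  have hvη : ∀ k, |v k| < η := fun k => by
    rw [hv]
    simp only [abs_div, im_halfShift, Nat.abs_ofNat]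
    linarith
  have hvη' : ∀ k, |(-v) k| < η := fun k => by simpa using hvη k
  have e1 : ∀ c : Fin m → ℝ, (G fun k => ((c k : ℂ) + v k * Complex.I) + halfShift s k / 2) *
      F (fun k => ((c k : ℂ) + v k * Complex.I) - halfShift s k / 2)
      = G (fun k => ofRealVec c k + halfShift s k) * F (ofRealVec c) := fun c => by
    congr 2
    · ext k; rw [hvI, ofRealVec]; ring
    · ext k; rw [hvI, ofRealVec]; ring
  have e2 : ∀ c : Fin m → ℝ, (G fun k => ((c k : ℂ) + ((-v) k : ℝ) * Complex.I) +
      halfShift s k / 2) * F (fun k => ((c k : ℂ) + ((-v) k : ℝ) * Complex.I) - halfShift s k / 2)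
      = G (ofRealVec c) * F (fun k => ofRealVec c k - halfShift s k) := fun c => by
    congr 2
    · ext k
      rw [Pi.neg_apply, Complex.ofReal_neg, neg_mul, hvI, ofRealVec]; ring
    · ext k
      rw [Pi.neg_apply, Complex.ofReal_neg, neg_mul, hvI, ofRealVec]; ring
  have i1 := integral_shift hd hb v hvη
  have i2 := integral_shift hd hb (-v) hvη'
  have j1 := integrable_shift hd hb v hvη
  have j2 := integrable_shift hd hb (-v) hvη'
  simp only [e1] at i1 j1
  simp only [e2] at i2 j2
  exact ⟨j1, j2, i1.trans i2.symm⟩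

theorem abs_im_add_halfShift_half_lt {m : ℕ} (s : Finset (Fin m)) {w : Fin m → ℂ} {η : ℝ}
    (hw : w ∈ strip m η) (k : Fin m) :
    |(w k + halfShift s k / 2).im| < η + 1 / 4 ∧ |(w k - halfShift s k / 2).im| < η + 1 / 4 := by
  have h1 := hw k
  have h2 : |(halfShift s k / 2).im| = 1 / 4 := by
    simp [abs_div, im_halfShift]; norm_num
  rw [Complex.add_im, Complex.sub_im]
  constructor
  · have := abs_add_le (w k).im (halfShift s k / 2).im
    linarith
  · have := abs_sub (w k).im (halfShift s k / 2).im
    linarith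

theorem reVec_add_halfShift_half {m : ℕ} (s : Finset (Fin m)) (w : Fin m → ℂ) :
    reVec (fun k => w k + halfShift s k / 2) = reVec w ∧
      reVec (fun k => w k - halfShift s k / 2) = reVec w := by
  constructor <;> ext k <;> simp [reVec, re_halfShift]

theorem integral_raising_halfShift {g : ℝ} (hg : 1 < g) {m : ℕ} {F : (Fin m → ℂ) → ℂ}
    (hd : DifferentiableOn ℂ F (strip m (g / 2))) (hb : HasWaveBound g F) (y : ℝ)
    {l : Fin (m + 1) → ℂ} (hl : l ∈ strip (m + 1) ((g - 1) / 2)) (s : Finset (Fin m)) :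
    Integrable (fun c : Fin m → ℝ =>
      kernelC g (cutShift s) l (fun k => ofRealVec c k + halfShift s k) y * F (ofRealVec c)) ∧
    Integrable (fun c : Fin m → ℝ =>
      kernelC g (cutShift s) l (ofRealVec c) y * F (fun k => ofRealVec c k - halfShift s k)) ∧
    ∫ c : Fin m → ℝ,
      kernelC g (cutShift s) l (fun k => ofRealVec c k + halfShift s k) y * F (ofRealVec c) =
    ∫ c : Fin m → ℝ,
      kernelC g (cutShift s) l (ofRealVec c) y * F (fun k => ofRealVec c k - halfShift s k) := by
  obtain ⟨s₀, hs₀, hs₀', hls⟩ := exists_mem_strip_of_mem_strip (by linarith) hl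
  -- The arguments of the kernel have imaginary part below `s₀ + η + 1/4`, which must stay under
  -- `g/2`. The gap `(g - 1)/2 - s₀` is positive and half of it is used.
  set η := 1 / 4 + ((g - 1) / 2 - s₀) / 2 with hη
  have hη4 : 1 / 4 < η := by rw [hη]; linarith
  have h1 : s₀ + (η + 1 / 4) < g / 2 := by rw [hη]; linarith
  have h2 : η + 1 / 4 < g / 2 := by linarith
  have him : ∀ w ∈ strip m η, ∀ i a, |(l i - (w a + halfShift s a / 2)).im| < s₀ + (η + 1 / 4) := by
    intro w hw i a
    have := (abs_im_add_halfShift_half_lt s hw a).1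
    have h3 := hls i
    rw [Complex.sub_im]
    have h4 := abs_sub (l i).im (w a + halfShift s a / 2).im
    linarith
  obtain ⟨C, N, hC, h⟩ := exists_raising_bound hb (cutShift s) (re_cutShift s) h1 h2 (η + 1 / 4) y
    (((m + 1 : ℕ) : ℝ) * s₀ + (m : ℝ) * (η + 1 / 4))
  refine integral_halfShift s (G := fun c => kernelC g (cutShift s) l c y) (F := F) hη4 ?_
    (C := C * weight (reVec l) ^ N * Real.exp (-Real.pi * pairEnergy (reVec l))) ?_
  · intro w hw
    have hmem : (fun k => w k - halfShift s k / 2) ∈ strip m (g / 2) := fun k =>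
      (abs_im_add_halfShift_half_lt s hw k).2.trans h2
    have k1 : DifferentiableAt ℂ (fun w : Fin m → ℂ =>
        kernelC g (cutShift s) l (fun k => w k + halfShift s k / 2) y) w :=
      differentiableAt_kernelC (E := Fin m → ℂ) (g := g) (cutShift s) (e := w) (l := fun _ => l)
        (c := fun w k => w k + halfShift s k / 2) (z := fun _ => (y : ℂ)) (by fun_prop)
        (by fun_prop) (by fun_prop) fun i a => (him w hw i a).trans h1
    have k2 : DifferentiableAt ℂ (fun w : Fin m → ℂ => F (fun k => w k - halfShift s k / 2)) w :=
      DifferentiableAt.comp w (g := F) (f := fun w k => w k - halfShift s k / 2)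
        ((hd _ hmem).differentiableAt ((isOpen_strip _ _).mem_nhds hmem)) (by fun_prop)
    exact (k1.mul k2).differentiableWithinAt
  · intro w hw
    obtain ⟨e1, e2⟩ := reVec_add_halfShift_half s w
    have := h l (fun k => w k + halfShift s k / 2) (fun k => w k - halfShift s k / 2)
      (fun i a => (him w hw i a).le) (fun a => (abs_im_add_halfShift_half_lt s hw a).1.le)
      (fun a => (abs_im_add_halfShift_half_lt s hw a).2.le) (by rw [e1, e2])
      (abs_im_sum_sub_le (fun k => (hls k).le)
        fun k => (abs_im_add_halfShift_half_lt s hw k).1.le)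
    rwa [e1] at this

/-- Here `(g - 1)/2 + 1/2 = g/2`: this fixes the width of the domain of the difference equations. -/
theorem sub_halfShift_mem_strip {g : ℝ} {n : ℕ} {l : Fin n → ℂ} (hl : l ∈ strip n ((g - 1) / 2))
    (s : Finset (Fin n)) : (fun k => l k - halfShift s k) ∈ strip n (g / 2) := fun k => by
  have h1 := hl k
  have h2 := im_halfShift s k
  have h3 := abs_sub (l k).im (halfShift s k).im
  rw [Complex.sub_im]
  linarith

theorem ofRealVec_injective {m : ℕ} {c : Fin m → ℝ} (hc : Function.Injective c) :
    Function.Injective (ofRealVec c) := fun _ _ h => hc (Complex.ofReal_injective h)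

theorem I_mul_add_ne_zero {g : ℝ} {l c : ℂ} (hl : |l.im| < (g - 1) / 2) (hc : c.im = 0) :
    Complex.I * (l - c) + (g - 1) / 2 ≠ 0 ∧ Complex.I * (l - c) - (g - 1) / 2 ≠ 0 := by
  rw [abs_lt] at hl
  have e1 : (Complex.I * (l - c) + (g - 1) / 2).re = -l.im + (g - 1) / 2 := by
    simp [hc]
  have e2 : (Complex.I * (l - c) - (g - 1) / 2).re = -l.im - (g - 1) / 2 := by
    simp [hc]
  constructor
  · intro h
    rw [h, Complex.zero_re] at e1; linarith
  · intro h
    rw [h, Complex.zero_re] at e2; linarith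

/-- The generating function of the difference equations, in symmetric form. -/
theorem sum_macCoeff_waveC {g : ℝ} (hg : 1 < g) (n : ℕ) (hn : 1 ≤ n) (x : Fin n → ℝ)
    {l : Fin n → ℂ} (hl : l ∈ strip n ((g - 1) / 2)) (hinj : Function.Injective l) (v : ℂ) :
    ∑ s : Finset (Fin n), v ^ s.card *
        (macCoeff g s l * waveC g n x (fun k => l k - halfShift s k)) =
      (∏ j, Complex.exp (-(Real.pi * x j)) * (1 + v * Complex.exp (2 * Real.pi * x j))) *
        waveC g n x l := by
  induction n, hn using Nat.le_induction with
  | base =>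
    have hu : (Finset.univ : Finset (Finset (Fin 1))) = {∅, {0}} := by decide
    rw [hu, Finset.sum_pair (by decide)]
    simp only [macCoeff, halfShift, waveC]
    simp only [Finset.card_empty, pow_zero, Nat.zero_mul, Finset.prod_empty, Finset.notMem_empty,
      if_false, Finset.card_singleton, pow_one, one_mul, Nat.sub_self, Finset.mem_singleton,
      Finset.univ_unique, Fin.default_eq_zero, if_true, Finset.prod_singleton]
    have h1 : ((({0} : Finset (Fin 1))ᶜ)) = ∅ := by decide
    rw [h1, Finset.prod_empty, one_mul, mul_add, mul_one, add_mul,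
      ← Complex.exp_add, mul_left_comm (Complex.exp _) v, mul_assoc v,
      ← Complex.exp_add, ← Complex.exp_add]
    congr 2
    · linear_combination (Real.pi * x 0 : ℂ) * Complex.I_sq
    · congr 1
      linear_combination (-(Real.pi * x 0) : ℂ) * Complex.I_sq
  | succ n hn ih =>
    obtain ⟨m, rfl⟩ : ∃ m, n = m + 1 := ⟨n - 1, by omega⟩
    obtain ⟨hd, hb, -⟩ := waveC_properties (by linarith : 0 < g) (m + 1) (by omega) (Fin.init x)
    set F := waveC g (m + 1) (Fin.init x) with hF
    set y := x (Fin.last (m + 1)) with hy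
    have hI1 : ∀ s : Finset (Fin (m + 1 + 1)), Integrable fun c : Fin (m + 1) → ℝ =>
        v ^ s.card * (macCoeff g s l * (kernelC g 0 (fun k => l k - halfShift s k) (ofRealVec c) y *
          F (ofRealVec c))) := fun s =>
      ((integrable_raising (by linarith) hd hb y (sub_halfShift_mem_strip hl s)).const_mul
        _).const_mul _
    have hI2 := fun s => integral_raising_halfShift hg hd hb y hl s
    have hsum : ∀ s : Finset (Fin (m + 1 + 1)), v ^ s.card *
        (macCoeff g s l * waveC g (m + 1 + 1) x (fun k => l k - halfShift s k)) =
        hatD (m + 1) g * ∫ c : Fin (m + 1) → ℝ, v ^ s.card * (macCoeff g s l *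
          (kernelC g 0 (fun k => l k - halfShift s k) (ofRealVec c) y * F (ofRealVec c))) := by
      intro s
      rw [integral_kernelC_mul_eq, integral_const_mul, integral_const_mul]
      ring
    rw [Finset.sum_congr rfl fun s _ => hsum s, ← Finset.mul_sum,
      ← integral_finsetSum _ fun s _ => hI1 s, integral_kernelC_mul_eq, ← hF, ← hy,
      mul_left_comm (∏ j, _)]
    refine congrArg (hatD (m + 1) g * ·) ?_
    -- The kernel identity, valid for almost every `c`, turns shifts in `l` into shifts in `c`.
    have step1 : ∫ c : Fin (m + 1) → ℝ, ∑ s : Finset (Fin (m + 1 + 1)), v ^ s.card *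
        (macCoeff g s l * (kernelC g 0 (fun k => l k - halfShift s k) (ofRealVec c) y *
          F (ofRealVec c))) = ∫ c : Fin (m + 1) → ℝ, (Complex.exp (-(Real.pi * y)) *
          (1 + v * Complex.exp (2 * Real.pi * y))) * ∑ s : Finset (Fin (m + 1)), v ^ s.card *
          (kernelC g (cutShift s) l (fun k => ofRealVec c k + halfShift s k) y *
            F (ofRealVec c)) := by
      refine integral_congr_ae ((ae_injective (m + 1)).mono fun c hc => ?_)
      have := sum_macCoeff_kernelC (g := g) hinj (ofRealVec_injective hc)
        (fun k a => (I_mul_add_ne_zero (hl k) (by simp [ofRealVec])).1)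
        (fun k a => (I_mul_add_ne_zero (hl k) (by simp [ofRealVec])).2) y v
      have h2 := congrArg (· * F (ofRealVec c)) this
      simp only [Finset.sum_mul, mul_assoc] at h2
      simp only [mul_assoc]
      rw [h2]
    -- A contour shift moves the half steps from the kernel to the wave function.
    have step2 : ∫ c : Fin (m + 1) → ℝ, ∑ s : Finset (Fin (m + 1)), v ^ s.card *
          (kernelC g (cutShift s) l (fun k => ofRealVec c k + halfShift s k) y *
            F (ofRealVec c)) = ∫ c : Fin (m + 1) → ℝ, ∑ s : Finset (Fin (m + 1)), v ^ s.card *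
          (kernelC g (cutShift s) l (ofRealVec c) y *
            F (fun k => ofRealVec c k - halfShift s k)) := by
      rw [integral_finsetSum _ fun s _ => (hI2 s).1.const_mul _,
        integral_finsetSum _ fun s _ => (hI2 s).2.1.const_mul _]
      refine Finset.sum_congr rfl fun s _ => ?_
      rw [integral_const_mul, integral_const_mul, (hI2 s).2.2]
    -- The cut in the measure is the Macdonald coefficient in `c`, so the sum is the difference
    -- operator acting on the wave function of `m + 1` variables, and the induction hypothesis
    -- applies.
    have step3 : ∫ c : Fin (m + 1) → ℝ, ∑ s : Finset (Fin (m + 1)), v ^ s.card *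
          (kernelC g (cutShift s) l (ofRealVec c) y *
            F (fun k => ofRealVec c k - halfShift s k)) = ∫ c : Fin (m + 1) → ℝ,
          (∏ j, Complex.exp (-(Real.pi * Fin.init x j)) *
            (1 + v * Complex.exp (2 * Real.pi * Fin.init x j))) *
          (kernelC g 0 l (ofRealVec c) y * F (ofRealVec c)) := by
      refine integral_congr_ae ((ae_injective (m + 1)).mono fun c hc => ?_)
      have hc' := ofRealVec_injective hc
      have := ih (Fin.init x) (ofRealVec_mem_strip (by linarith) c) hc'
      beta_reduce
      rw [mul_left_comm, ← this, Finset.mul_sum]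
      refine Finset.sum_congr rfl fun s _ => ?_
      rw [kernelC_cutShift g s l hc']
      ring
    rw [step1, integral_const_mul, step2, step3, integral_const_mul,
      Fin.prod_univ_castSucc (n := m + 1)]
    simp only [Fin.init, hy]
    ring

end RationalRuijsenaars

end

/-! ### Coefficients of the generating function and continuation to the tube. -/

noncomputable section

namespace RationalRuijsenaars

open MeasureTheory Filter Topology

/-- Comparison of coefficients of generating functions over subsets. -/
theorem sum_powersetCard_eq_of_generating {n : ℕ} {A B : Finset (Fin n) → ℂ}
    (h : ∀ v : ℂ, ∑ s : Finset (Fin n), v ^ s.card * A s = ∑ s, v ^ s.card * B s) (r : ℕ) :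
    ∑ s ∈ Finset.powersetCard r (Finset.univ : Finset (Fin n)), A s =
      ∑ s ∈ Finset.powersetCard r (Finset.univ : Finset (Fin n)), B s := by
  have hp : (∑ s : Finset (Fin n), Polynomial.monomial s.card (A s) : Polynomial ℂ) =
      ∑ s : Finset (Fin n), Polynomial.monomial s.card (B s) := by
    refine Polynomial.funext fun v => ?_
    simp only [Polynomial.eval_finsetSum, Polynomial.eval_monomial]
    simpa only [mul_comm] using h v
  have := congrArg (fun p => Polynomial.coeff p r) hp
  simp only [Polynomial.finsetSum_coeff, Polynomial.coeff_monomial] at this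
  have hf : Finset.powersetCard r (Finset.univ : Finset (Fin n)) =
      Finset.univ.filter fun s => s.card = r := by
    ext s; simp [Finset.mem_powersetCard]
  rw [hf, Finset.sum_filter, Finset.sum_filter, this]

/-- Equality of all coefficients permits any weight depending only on the cardinality. The
differential equation needs one that is not a power. -/
theorem sum_card_mul_eq_of_generating {n : ℕ} {A B : Finset (Fin n) → ℂ}
    (h : ∀ v : ℂ, ∑ s : Finset (Fin n), v ^ s.card * A s = ∑ s, v ^ s.card * B s) (φ : ℕ → ℂ) :
    ∑ s : Finset (Fin n), φ s.card * A s = ∑ s, φ s.card * B s := by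
  rw [← Finset.powerset_univ, Finset.sum_powerset, Finset.sum_powerset]
  refine Finset.sum_congr rfl fun r _ => ?_
  rw [Finset.sum_congr rfl fun s hs => by rw [(Finset.mem_powersetCard.1 hs).2],
    ← Finset.mul_sum, sum_powersetCard_eq_of_generating h, Finset.mul_sum]
  exact Finset.sum_congr rfl fun s hs => by rw [(Finset.mem_powersetCard.1 hs).2]

theorem prod_one_add_mul {n : ℕ} (v : ℂ) (X : Fin n → ℂ) :
    ∏ j, (1 + v * X j) = ∑ s : Finset (Fin n), v ^ s.card * ∏ j ∈ s, X j := by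
  rw [Finset.prod_one_add, Finset.powerset_univ]
  refine Finset.sum_congr rfl fun s _ => ?_
  rw [Finset.prod_mul_distrib, Finset.prod_const]

/-- The midpoint between the largest and the smallest imaginary part works. -/
theorem exists_sub_mem_strip {n : ℕ} (hn : 1 ≤ n) {a : ℝ} {l : Fin n → ℂ} (hl : l ∈ tube n a) :
    ∃ c : ℝ, (fun k => l k - c * Complex.I) ∈ strip n (a / 2) := by
  have : Nonempty (Fin n) := ⟨⟨0, hn⟩⟩
  obtain ⟨i, hi⟩ := Finite.exists_max fun k => (l k).im
  obtain ⟨j, hj⟩ := Finite.exists_min fun k => (l k).im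
  refine ⟨((l i).im + (l j).im) / 2, fun k => ?_⟩
  have h1 := hl i j
  have h2 := hi k
  have h3 := hj k
  rw [Complex.sub_im, abs_lt] at h1
  simp only [Complex.sub_im, Complex.mul_im, Complex.ofReal_re, Complex.I_im, Complex.ofReal_im,
    Complex.I_re, mul_one, mul_zero, add_zero]
  rw [abs_lt]
  constructor <;> linarith

open Classical in
/-- The continuation of the wave function to the tube. -/
def waveTube (g : ℝ) (n : ℕ) (x : Fin n → ℝ) (l : Fin n → ℂ) : ℂ :=
  if h : ∃ c : ℝ, (fun k => l k - c * Complex.I) ∈ strip n (g / 2) then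
    Complex.exp (-(2 * Real.pi * h.choose * ∑ k, x k)) *
      waveC g n x (fun k => l k - h.choose * Complex.I)
  else 0

/-- The value does not depend on the chosen `c`, by `waveC_add`. Since one `c` also serves all
nearby points, holomorphy follows. -/
theorem waveTube_eq {g : ℝ} (hg : 0 < g) {n : ℕ} (hn : 1 ≤ n) (x : Fin n → ℝ) {l : Fin n → ℂ}
    {c : ℝ} (hc : (fun k => l k - c * Complex.I) ∈ strip n (g / 2)) :
    waveTube g n x l = Complex.exp (-(2 * Real.pi * c * (∑ k, x k : ℝ))) *
      waveC g n x (fun k => l k - c * Complex.I) := by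
  have h : ∃ c : ℝ, (fun k => l k - c * Complex.I) ∈ strip n (g / 2) := ⟨c, hc⟩
  rw [waveTube, dif_pos h]
  set d := h.choose with hd
  have hd' : (fun k => l k - d * Complex.I) ∈ strip n (g / 2) := h.choose_spec
  have e : (fun k => l k - d * Complex.I) =
      fun k => (l k - c * Complex.I) + (c - d) * Complex.I := by
    ext k; ring
  rw [e, waveC_add hg hn x hc (by rwa [← e]), ← mul_assoc, ← Complex.exp_add]
  congr 2
  push_cast
  linear_combination (2 * Real.pi * (c - d) * ∑ k, (x k : ℂ)) * Complex.I_sq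

theorem isWaveContinuation_waveTube {g : ℝ} (hg : 0 < g) {n : ℕ} (hn : 1 ≤ n) (x : Fin n → ℝ) :
    IsWaveContinuation g n x (waveTube g n x) := by
  constructor
  · intro l hl
    obtain ⟨c, hc⟩ := exists_sub_mem_strip hn hl
    have hopen : IsOpen {l : Fin n → ℂ | (fun k => l k - c * Complex.I) ∈ strip n (g / 2)} :=
      (isOpen_strip _ _).preimage (by fun_prop)
    have hd := (waveC_properties hg n hn x).1
    have h2 : DifferentiableAt ℂ (fun l : Fin n → ℂ =>
        Complex.exp (-(2 * Real.pi * c * (∑ k, x k : ℝ))) *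
          waveC g n x (fun k => l k - c * Complex.I)) l := by
      refine DifferentiableAt.const_mul ?_ _
      exact DifferentiableAt.comp l (g := waveC g n x) (f := fun l k => l k - c * Complex.I)
        ((hd _ hc).differentiableAt ((isOpen_strip _ _).mem_nhds hc)) (by fun_prop)
    refine (h2.congr_of_eventuallyEq ?_).differentiableWithinAt
    filter_upwards [hopen.mem_nhds hc] with l hl
    exact waveTube_eq hg hn x hl
  · intro l
    have := waveTube_eq hg hn x (l := ofRealVec l) (c := 0) (by
      simpa using ofRealVec_mem_strip (by positivity) l)
    simp only [Complex.ofReal_zero, mul_zero, zero_mul, neg_zero, Complex.exp_zero, one_mul,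
      sub_zero] at this
    exact this.trans (waveC_ofRealVec g n x l)

/-- On the complex line `Re l + ζ Im l` real `ζ` give real points, where both functions equal the
wave function, and `ζ = i` gives `l`. -/
theorem IsWaveContinuation.eqOn {g : ℝ} (hg : 0 < g) {n : ℕ} {x : Fin n → ℝ}
    {F F' : (Fin n → ℂ) → ℂ} (hF : IsWaveContinuation g n x F)
    (hF' : IsWaveContinuation g n x F') : Set.EqOn F F' (tube n g) := by
  intro l hl
  set p : ℂ → Fin n → ℂ := fun ζ k => (l k).re + ζ * (l k).im with hp
  set S : Set ℂ := {ζ | ∀ i j, |ζ.im * ((l i).im - (l j).im)| < g} with hS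
  have hpS : ∀ ζ ∈ S, p ζ ∈ tube n g := fun ζ hζ i j => by
    have := hζ i j
    rw [mul_sub] at this
    simpa [hp] using this
  have hSo : IsOpen S := by
    have : S = ⋂ i, ⋂ j, {ζ : ℂ | |ζ.im * ((l i).im - (l j).im)| < g} := by ext; simp [hS]
    rw [this]
    exact isOpen_iInter_of_finite fun i => isOpen_iInter_of_finite fun j =>
      isOpen_lt (by fun_prop) continuous_const
  have hSc : Convex ℝ S := by
    have : S = ⋂ i, ⋂ j, (fun ζ : ℂ => ζ.im * ((l i).im - (l j).im)) ⁻¹' (Set.Ioo (-g) g) := by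
      ext; simp only [hS, abs_lt, Set.mem_ofPred_eq, Set.mem_iInter, Set.mem_preimage, Set.mem_Ioo]
    rw [this]
    refine convex_iInter fun i => convex_iInter fun j => ?_
    have hl : IsLinearMap ℝ fun ζ : ℂ => ζ.im * ((l i).im - (l j).im) := by
      constructor
      · intro x y; simp [add_mul]
      · intro c x; simp [mul_assoc]
    exact (convex_Ioo (-g) g).is_linear_preimage hl
  have hpd : Differentiable ℂ p := by
    rw [hp]; fun_prop
  have hφ : DifferentiableOn ℂ (fun ζ => F (p ζ) - F' (p ζ)) S :=
    (hF.1.comp hpd.differentiableOn hpS).sub (hF'.1.comp hpd.differentiableOn hpS)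
  have hI : Complex.I ∈ S := fun i j => by simpa using hl i j
  have := eq_of_eq_on_real hSo hSc (fun r i j => by simpa using hg) hφ (k := 0)
    (fun r => by
      have e : p r = fun k => (((l k).re + r * (l k).im : ℝ) : ℂ) := by ext k; simp [hp]
      simp only [e, hF.2, hF'.2, sub_self]) hI
  have e : p Complex.I = l := by
    ext k; simp only [hp]; rw [mul_comm]; exact Complex.re_add_im _
  rw [e] at this
  exact sub_eq_zero.1 this

theorem macdonald_eq {g : ℝ} (hg : 1 < g) {n : ℕ} (hn : 1 ≤ n) {x : Fin n → ℝ}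
    {F : (Fin n → ℂ) → ℂ} (hF : IsWaveContinuation g n x F) (r : ℕ) {l : Fin n → ℂ}
    (hl : l ∈ tube n (g - 1)) (hinj : Function.Injective l) :
    macdonald g n r F l = MvPolynomial.eval (fun j => Complex.exp (2 * Real.pi * x j))
      (MvPolynomial.esymm (Fin n) ℂ r) * F l := by
  have hg0 : 0 < g := by linarith
  have hFT := hF.eqOn hg0 (isWaveContinuation_waveTube hg0 hn x)
  obtain ⟨c, hc⟩ := exists_sub_mem_strip hn hl
  set l' : Fin n → ℂ := fun k => l k - c * Complex.I with hl'
  have hFl : F l = Complex.exp (-(2 * Real.pi * c * (∑ k, x k : ℝ))) * waveC g n x l' := by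
    rw [hFT fun i j => (hl i j).trans (by linarith)]
    exact waveTube_eq hg0 hn x (strip_mono (by linarith) hc)
  -- A shift by `-i` on `s` is the half shift followed by a common translation by `-i/2`. The
  -- translation produces `exp(π ∑ x)`, which cancels the prefactor of the symmetric form.
  have hFs : ∀ s : Finset (Fin n), F (fun k => if k ∈ s then l k - Complex.I else l k) =
      Complex.exp (-(2 * Real.pi * c * (∑ k, x k : ℝ))) * (Complex.exp (Real.pi * (∑ k, x k : ℝ)) *
        waveC g n x fun k => l' k - halfShift s k) := by
    intro s
    have e : (fun k => l' k - halfShift s k) = fun k => (if k ∈ s then l k - Complex.I else l k) -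
        ((c - 1 / 2 : ℝ) : ℂ) * Complex.I := by
      ext k
      simp only [hl', halfShift]
      split_ifs <;> push_cast <;> ring
    rw [hFT ?_, waveTube_eq hg0 hn x (c := c - 1 / 2) (by
      rw [← e]; exact sub_halfShift_mem_strip hc s), e, ← mul_assoc, ← Complex.exp_add]
    · congr 2
      push_cast
      ring
    · intro i j
      have h1 := hl i j
      rw [abs_lt] at h1 ⊢
      beta_reduce
      split_ifs <;> simp only [Complex.sub_im, Complex.I_im] at h1 ⊢ <;> constructor <;> linarith
  have hcoef : ∀ s, macCoeff g s l' = macCoeff g s l := fun s => by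
    simp only [macCoeff, hl', sub_sub_sub_cancel_right]
  have hinj' : Function.Injective l' := fun i j h => hinj (sub_left_injective h)
  have key := sum_powersetCard_eq_of_generating
    (A := fun s => macCoeff g s l * F (fun k => if k ∈ s then l k - Complex.I else l k))
    (B := fun s => (∏ j ∈ s, Complex.exp (2 * Real.pi * x j)) * F l) (fun v => by
      have := sum_macCoeff_waveC hg n hn x hc hinj' v
      rw [Finset.prod_mul_distrib, prod_one_add_mul, ← Complex.exp_sum] at this
      simp only [hFs, hFl]
      have e : Complex.exp (Real.pi * (∑ k, x k : ℝ)) * Complex.exp (∑ j, -(Real.pi * x j : ℂ)) = 1 := by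
        rw [← Complex.exp_add, ← Complex.exp_zero]
        congr 1
        push_cast
        rw [Finset.sum_neg_distrib, ← Finset.mul_sum]
        ring
      set P := Complex.exp (-(2 * Real.pi * c * (∑ k, x k : ℝ)))
      set Q := Complex.exp (Real.pi * (∑ k, x k : ℝ))
      calc _ = P * Q * ∑ s : Finset (Fin n), v ^ s.card *
            (macCoeff g s l' * waveC g n x (fun k => l' k - halfShift s k)) := by
            rw [Finset.mul_sum]
            refine Finset.sum_congr rfl fun s _ => ?_
            rw [hcoef]; ring
        _ = P * (Q * Complex.exp (∑ j, -(Real.pi * x j : ℂ))) *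
            ((∑ s : Finset (Fin n), v ^ s.card * ∏ j ∈ s, Complex.exp (2 * Real.pi * x j)) *
              waveC g n x l') := by
            rw [this]; ring
        _ = _ := by
            rw [e, Finset.sum_mul, Finset.mul_sum]
            refine Finset.sum_congr rfl fun s _ => ?_
            ring) r
  rw [MvPolynomial.esymm, map_sum, Finset.sum_mul]
  simp only [map_prod, MvPolynomial.eval_X]
  rw [← key, macdonald, Finset.mul_sum]
  refine Finset.sum_congr rfl fun s hs => ?_
  rw [macCoeff, (Finset.mem_powersetCard.1 hs).2]
  ring

end RationalRuijsenaars

end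

/-! ### The identity and the contour shift for the Baxter kernel. -/

noncomputable section

namespace RationalRuijsenaars

open MeasureTheory Filter Topology

/-- The kernel function identity behind the differential equation in the spectral parameter of the
Baxter operator. -/
theorem sum_kernelC_baxter_eq_zero {g : ℝ} {n : ℕ} (hn : 1 ≤ n) {l c : Fin n → ℂ}
    (hc : Function.Injective c)
    (h₁ : ∀ k a, Complex.I * (l k - c a) + (g - 1) / 2 ≠ 0)
    (h₂ : ∀ k a, Complex.I * (l k - c a) - (g - 1) / 2 ≠ 0) (z : ℂ) :
    ∑ s : Finset (Fin n), Complex.exp (2 * Real.pi * z) ^ (n - s.card) *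
      ((Real.pi * g * (n - 2 * s.card) +
        2 * Real.pi * Complex.I * ((∑ k, l k) - ∑ k, (c k + halfShift s k))) *
        kernelC g (cutShift s) l (fun k => c k + halfShift s k) z) = 0 := by
  set a : Fin n → ℂ := fun k => Complex.I * l k with ha
  set b : Fin n → ℂ := fun k => Complex.I * c k with hb
  have hDb : diffProd (-b) ≠ 0 := diffProd_ne_zero fun i j h =>
    hc (mul_left_cancel₀ Complex.I_ne_zero (neg_injective h))
  have key := sum_subsets_eq_zero hn a b ((g - 1) / 2)
    (fun k i => by rw [← neg_ne_zero]; convert h₂ k i using 1; simp only [ha, hb]; ring)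
    (fun k i => by rw [← neg_ne_zero]; convert h₁ k i using 1; simp only [ha, hb]; ring)
  set E := Complex.exp (2 * Real.pi * Complex.I * z * ((∑ k, l k) - ∑ k, c k))
  set w := Complex.exp (2 * Real.pi * z)
  set P := -(2 * Real.pi) * E * Complex.exp (-(Real.pi * z * n)) * w ^ n * commonFactor g l c *
    offProd g 0 c * ((-1) ^ n * (-1) ^ (n * n)) with hP
  have hterm : ∀ s : Finset (Fin n), w ^ (n - s.card) *
      ((Real.pi * g * (n - 2 * s.card) +
        2 * Real.pi * Complex.I * ((∑ k, l k) - ∑ k, (c k + halfShift s k))) *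
        kernelC g (cutShift s) l (fun k => c k + halfShift s k) z) * diffProd (-b) =
      P * ((-1) ^ s.card *
      ((∑ i, s.piecewise (fun i => b i + (g - 1) / 2) (fun i => b i - (g - 1) / 2) i -
          ∑ k, a k) *
        diffProd (-s.piecewise (fun i => b i + (g - 1) / 2) fun i => b i - (g - 1) / 2) *
        ∏ i, ∏ k, (s.piecewise (fun i => b i + (g - 1) / 2)
          (fun i => b i - (g - 1) / 2) i - a k)⁻¹)) := by
    intro s
    have hcard : sᶜ.card + s.card = n := by simp
    have hcardC : ((sᶜ.card : ℕ) : ℂ) + s.card = n := by exact_mod_cast hcard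
    have e1 : (∑ k, l k) - ∑ k, (c k + halfShift s k)
        = ((∑ k, l k) - ∑ k, c k) - ∑ k, halfShift s k := by
      rw [Finset.sum_add_distrib]; ring
    have e2 := offProd_add_halfShift_mul_diffProd (g := g) hc s
    -- Modulo 2, `|sᶜ|(n + |s|)` is `|sᶜ|²`, hence `|sᶜ|`, hence `n + |s|`.
    have e3 : (-1 : ℂ) ^ (sᶜ.card * n) * (-1) ^ (sᶜ.card * s.card) = (-1) ^ n * (-1) ^ s.card := by
      rw [← pow_add, ← pow_add, ← mul_add, neg_one_pow_eq_pow_mod_two,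
        neg_one_pow_eq_pow_mod_two (n := n + s.card)]
      congr 1
      have : sᶜ.card * (n + s.card) = sᶜ.card * sᶜ.card + 2 * (sᶜ.card * s.card) := by
        nlinarith
      have h2 : sᶜ.card * sᶜ.card % 2 = sᶜ.card % 2 := by
        rcases Nat.mod_two_eq_zero_or_one sᶜ.card with h | h <;> simp [Nat.mul_mod, h]
      rw [this, Nat.add_mul_mod_self_left, h2]
      omega
    have e4 : w ^ (n - s.card) * w ^ s.card = w ^ n := by
      rw [← pow_add]; congr 1; omega
    have e5 : ∏ k, ∏ i, (a k - s.piecewise (fun i => b i + (g - 1) / 2)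
        (fun i => b i - (g - 1) / 2) i)⁻¹ = (-1) ^ (n * n) *
        ∏ i, ∏ k, (s.piecewise (fun i => b i + (g - 1) / 2)
          (fun i => b i - (g - 1) / 2) i - a k)⁻¹ := by
      have : (-1 : ℂ) ^ (n * n) = ∏ _i : Fin n, ∏ _k : Fin n, (-1 : ℂ) := by
        simp [pow_mul]
      rw [Finset.prod_comm, this, ← Finset.prod_mul_distrib]
      refine Finset.prod_congr rfl fun i _ => ?_
      rw [← Finset.prod_mul_distrib]
      refine Finset.prod_congr rfl fun k _ => ?_
      rw [← neg_sub, inv_neg]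
      ring
    have e6 : ∑ i, s.piecewise (fun i => b i + (g - 1) / 2) (fun i => b i - (g - 1) / 2) i =
        ∑ i, b i + (g - 1) / 2 * (2 * s.card - n) := by
      have f1 : ∑ i ∈ s, s.piecewise (fun i => b i + (g - 1) / 2) (fun i => b i - (g - 1) / 2) i =
          ∑ i ∈ s, (b i + (g - 1) / 2) :=
        Finset.sum_congr rfl fun i hi => Finset.piecewise_eq_of_mem s _ _ hi
      have f2 : ∑ i ∈ sᶜ, s.piecewise (fun i => b i + (g - 1) / 2) (fun i => b i - (g - 1) / 2) i =
          ∑ i ∈ sᶜ, (b i - (g - 1) / 2) :=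
        Finset.sum_congr rfl fun i hi =>
          Finset.piecewise_eq_of_notMem s _ _ (Finset.mem_compl.1 hi)
      rw [← Finset.sum_add_sum_compl s, ← Finset.sum_add_sum_compl s b, f1, f2,
        Finset.sum_add_distrib, Finset.sum_sub_distrib]
      simp only [Finset.sum_const, nsmul_eq_mul]
      rw [← hcardC]
      ring
    -- The half shifts contribute `π(2|s| - n)`, which replaces `g` by `g - 1`. The linear factor
    -- becomes a multiple of the factor `∑ y - ∑ a` in `sum_subsets_eq_zero`.
    have e7 : (Real.pi * g * (n - 2 * s.card) +
        2 * Real.pi * Complex.I * ((∑ k, l k) - ∑ k, (c k + halfShift s k))) =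
        -(2 * Real.pi) * (∑ i, s.piecewise (fun i => b i + (g - 1) / 2)
          (fun i => b i - (g - 1) / 2) i - ∑ k, a k) := by
      rw [e1, e6, sum_halfShift]
      simp only [ha, hb, ← Finset.mul_sum]
      linear_combination (-(Real.pi * (2 * s.card - n)) : ℂ) * Complex.I_sq
    rw [e7, kernelC, e1, exp_sub_sum_halfShift, prod_KC_add_halfShift h₁ h₂, e5, hP]
    set Y := ∑ i, s.piecewise (fun i => b i + (g - 1) / 2) (fun i => b i - (g - 1) / 2) i -
      ∑ k, a k
    set R := ∏ i, ∏ k, (s.piecewise (fun i => b i + (g - 1) / 2)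
          (fun i => b i - (g - 1) / 2) i - a k)⁻¹
    set D := diffProd (-s.piecewise (fun i => b i + (g - 1) / 2) fun i => b i - (g - 1) / 2)
    set O := offProd g (cutShift s) fun k => c k + halfShift s k
    set X := Complex.exp (-(Real.pi * z * n))
    set S := commonFactor g l c
    linear_combination (-(2 * Real.pi) * Y * E * X * w ^ (n - s.card) * w ^ s.card *
        (-1) ^ (sᶜ.card * n) * S * (-1) ^ (n * n) * R) * e2 +
      (-(2 * Real.pi) * Y * E * X * w ^ (n - s.card) * w ^ s.card * S * (-1) ^ (n * n) * R *
        offProd g 0 c * D) * e3 +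
      (-(2 * Real.pi) * Y * E * X * S * (-1) ^ (n * n) * R *
        offProd g 0 c * D * ((-1) ^ n * (-1) ^ s.card)) * e4
  refine mul_right_cancel₀ hDb ?_
  rw [Finset.sum_mul, Finset.sum_congr rfl fun s _ => hterm s, ← Finset.mul_sum, key]
  ring

theorem norm_add_mul_sum_sub_le {n : ℕ} (A B : ℂ) (l c : Fin n → ℂ) {η : ℝ}
    (hc : ∀ k, |(c k).im| ≤ η) :
    ‖A + B * ((∑ k, l k) - ∑ k, c k)‖ ≤
      (‖A‖ + ‖B‖ * (‖∑ k, l k‖ + n * (1 + η))) * weight (reVec c) := by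
  have hw := one_le_weight (reVec c)
  have h1 : ‖∑ k, c k‖ ≤ n * (1 + η) * weight (reVec c) := by
    refine (norm_sum_le _ _).trans ?_
    have : ∀ k ∈ (Finset.univ : Finset (Fin n)), ‖c k‖ ≤ (1 + η) * weight (reVec c) := by
      intro k _
      have h2 := Complex.norm_le_abs_re_add_abs_im (c k)
      have h3 : 1 + |(c k).re| ≤ weight (reVec c) := one_add_abs_le_weight (reVec c) k
      have h4 := hc k
      have h5 := abs_nonneg (c k).im
      nlinarith
    refine (Finset.sum_le_sum this).trans (le_of_eq ?_)
    simp
    ring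
  have hl := norm_nonneg (∑ k, l k)
  calc _ ≤ ‖A‖ + ‖B‖ * (‖∑ k, l k‖ + ‖∑ k, c k‖) := by
        refine (norm_add_le _ _).trans ?_
        rw [norm_mul]
        gcongr
        exact norm_sub_le _ _
    _ ≤ ‖A‖ * weight (reVec c) + ‖B‖ * (‖∑ k, l k‖ * weight (reVec c) +
        n * (1 + η) * weight (reVec c)) := by
        gcongr
        · exact le_mul_of_one_le_right (norm_nonneg _) hw
        · exact le_mul_of_one_le_right hl hw
    _ = _ := by ring

section

variable {g : ℝ} {n : ℕ} {F : (Fin n → ℂ) → ℂ}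

theorem exists_linear_baxter_bound (hb : HasWaveBound g F) (δ : Fin n → Fin n → ℂ)
    (hδ : ∀ i j, (δ i j).re = 0) {s κ : ℝ} (hs0 : 0 ≤ s) (hs : s < g / 2) (hκ0 : 0 ≤ κ)
    (hκ : κ < 1) (R : ℝ) (A B : ℂ) (l : Fin n → ℝ) :
    ∃ C : ℝ, ∀ (c c' : Fin n → ℂ) (z : ℂ), (∀ a, |(c a).im| ≤ s) → (∀ a, |(c' a).im| ≤ s) →
      reVec c' = reVec c → |z.re| ≤ R → 2 * |z.im| ≤ κ →
      ‖(A + B * ((∑ k, ofRealVec l k) - ∑ k, c k)) * kernelC g δ (ofRealVec l) c z * F c'‖ ≤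
        C * (weight (reVec c) ^ 2)⁻¹ := by
  -- Decay of order 3 is requested: the linear factor costs one power of the weight and two must
  -- remain for integrability.
  obtain ⟨C, N, hC, h⟩ := exists_baxter_bound hb δ hδ hs hs hκ0 hκ s R
    ((n : ℝ) * 0 + (n : ℝ) * s) 3
  refine ⟨(‖A‖ + ‖B‖ * (‖∑ k, ofRealVec l k‖ + n * (1 + s))) *
    (C * weight (reVec (ofRealVec l)) ^ N), fun c c' z hc hc' hcc hz1 hz2 => ?_⟩
  have h1 := h (ofRealVec l) c c' z (fun i a => by simpa [ofRealVec] using hc a) hc hc' hcc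
    (abs_im_sum_sub_le (fun k => by simp [ofRealVec]) hc) hz1 hz2
  have h2 := norm_add_mul_sum_sub_le A B (ofRealVec l) c hc
  have hw := weight_pos (reVec c)
  rw [mul_assoc, norm_mul]
  refine (mul_le_mul h2 h1 (norm_nonneg _) (by positivity)).trans (le_of_eq ?_)
  field_simp

theorem integral_baxter_halfShift (hg : 1 < g) (hd : DifferentiableOn ℂ F (strip n (g / 2)))
    (hb : HasWaveBound g F) (A B : ℂ) {z : ℂ} (hz : |z.im| < 1 / 2) (l : Fin n → ℝ)
    (s : Finset (Fin n)) :
    Integrable (fun c : Fin n → ℝ =>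
      (A + B * ((∑ k, ofRealVec l k) - ∑ k, (ofRealVec c k + halfShift s k))) *
        kernelC g (cutShift s) (ofRealVec l) (fun k => ofRealVec c k + halfShift s k) z *
        F (ofRealVec c)) ∧
    Integrable (fun c : Fin n → ℝ =>
      (A + B * ((∑ k, ofRealVec l k) - ∑ k, ofRealVec c k)) *
        kernelC g (cutShift s) (ofRealVec l) (ofRealVec c) z *
        F (fun k => ofRealVec c k - halfShift s k)) ∧
    ∫ c : Fin n → ℝ,
      (A + B * ((∑ k, ofRealVec l k) - ∑ k, (ofRealVec c k + halfShift s k))) *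
        kernelC g (cutShift s) (ofRealVec l) (fun k => ofRealVec c k + halfShift s k) z *
        F (ofRealVec c) =
    ∫ c : Fin n → ℝ,
      (A + B * ((∑ k, ofRealVec l k) - ∑ k, ofRealVec c k)) *
        kernelC g (cutShift s) (ofRealVec l) (ofRealVec c) z *
        F (fun k => ofRealVec c k - halfShift s k) := by
  -- Since `l` is real, `η + 1/4 = 1/2 + (g - 1)/4 < g/2` is all that is needed.
  set η := 1 / 4 + (g - 1) / 4 with hη
  have hη4 : 1 / 4 < η := by rw [hη]; linarith
  have h2 : η + 1 / 4 < g / 2 := by rw [hη]; linarith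
  obtain ⟨C, h⟩ := exists_linear_baxter_bound hb (cutShift s) (re_cutShift s)
    (by linarith : 0 ≤ η + 1 / 4) h2 (by positivity : 0 ≤ 2 * |z.im|) (by linarith) |z.re| A B l
  refine integral_halfShift s (G := fun c => (A + B * ((∑ k, ofRealVec l k) - ∑ k, c k)) *
    kernelC g (cutShift s) (ofRealVec l) c z) (F := F) hη4 ?_ (C := C) ?_
  · intro w hw
    have hmem : (fun k => w k - halfShift s k / 2) ∈ strip n (g / 2) := fun k =>
      (abs_im_add_halfShift_half_lt s hw k).2.trans h2
    have k0 : DifferentiableAt ℂ (fun w : Fin n → ℂ =>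
        A + B * ((∑ k, ofRealVec l k) - ∑ k, (w k + halfShift s k / 2))) w := by
      fun_prop
    have k1 : DifferentiableAt ℂ (fun w : Fin n → ℂ =>
        kernelC g (cutShift s) (ofRealVec l) (fun k => w k + halfShift s k / 2) z) w :=
      differentiableAt_kernelC (E := Fin n → ℂ) (g := g) (cutShift s) (e := w)
        (l := fun _ => ofRealVec l) (c := fun w k => w k + halfShift s k / 2) (z := fun _ => z)
        (by fun_prop) (by fun_prop) (by fun_prop) fun i a => by
          have := (abs_im_add_halfShift_half_lt s hw a).1.trans h2
          simpa [ofRealVec, abs_sub_comm, abs_neg, ← neg_add_rev, add_comm] using this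
    have k2 : DifferentiableAt ℂ (fun w : Fin n → ℂ => F (fun k => w k - halfShift s k / 2)) w :=
      DifferentiableAt.comp w (g := F) (f := fun w k => w k - halfShift s k / 2)
        ((hd _ hmem).differentiableAt ((isOpen_strip _ _).mem_nhds hmem)) (by fun_prop)
    exact ((k0.mul k1).mul k2).differentiableWithinAt
  · intro w hw
    obtain ⟨e1, e2⟩ := reVec_add_halfShift_half s w
    have := h (fun k => w k + halfShift s k / 2) (fun k => w k - halfShift s k / 2) z
      (fun a => (abs_im_add_halfShift_half_lt s hw a).1.le)
      (fun a => (abs_im_add_halfShift_half_lt s hw a).2.le) (by rw [e1, e2]) le_rfl le_rfl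
    rwa [e1] at this

end

end RationalRuijsenaars

end

/-! ### The differential equation in the spectral parameter. -/

noncomputable section

namespace RationalRuijsenaars

open MeasureTheory Filter Topology

section

variable {g : ℝ} {n : ℕ} {F : (Fin n → ℂ) → ℂ}

theorem integrable_linear_baxter (hg : 0 < g) (hd : DifferentiableOn ℂ F (strip n (g / 2)))
    (hb : HasWaveBound g F) (A B : ℂ) {z : ℂ} (hz : |z.im| < 1 / 2) (l : Fin n → ℝ) :
    Integrable fun c : Fin n → ℝ => (A + B * ((∑ k, ofRealVec l k) - ∑ k, ofRealVec c k)) *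
      kernelC g 0 (ofRealVec l) (ofRealVec c) z * F (ofRealVec c) := by
  have hg2 : 0 < g / 2 := by positivity
  obtain ⟨C, h⟩ := exists_linear_baxter_bound hb 0 (by simp) le_rfl hg2
    (by positivity : 0 ≤ 2 * |z.im|) (by linarith) |z.re| A B l
  have hFc : Continuous fun c : Fin n → ℝ => F (ofRealVec c) :=
    hd.continuousOn.comp_continuous continuous_ofRealVec (ofRealVec_mem_strip hg2)
  have hsum : Continuous fun c : Fin n → ℝ => ∑ k, ofRealVec c k :=
    continuous_finsetSum _ fun k _ => (continuous_apply k).comp continuous_ofRealVec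
  refine (integrable_weight_inv_sq.const_mul C).mono' (((continuous_const.add
    (continuous_const.mul (continuous_const.sub hsum))).mul
    (continuous_kernelC_ofRealVec 0 (ofRealVec_mem_strip hg2 l) z)).mul hFc).aestronglyMeasurable
    (Eventually.of_forall fun c => ?_)
  have := h (ofRealVec c) (ofRealVec c) z (fun a => by simp [ofRealVec])
    (fun a => by simp [ofRealVec]) rfl le_rfl le_rfl
  rwa [reVec_ofRealVec] at this

theorem integrable_baxter (hg : 0 < g) (hd : DifferentiableOn ℂ F (strip n (g / 2)))
    (hb : HasWaveBound g F) {z : ℂ} (hz : |z.im| < 1 / 2) (l : Fin n → ℝ) :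
    Integrable fun c : Fin n → ℝ =>
      kernelC g 0 (ofRealVec l) (ofRealVec c) z * F (ofRealVec c) := by
  simpa using integrable_linear_baxter hg hd hb 1 0 hz l

theorem hasDerivAt_baxter (hg : 0 < g) (hd : DifferentiableOn ℂ F (strip n (g / 2)))
    (hb : HasWaveBound g F) {z : ℂ} (hz : |z.im| < 1 / 2) (l : Fin n → ℝ) :
    HasDerivAt (fun z => ∫ c : Fin n → ℝ,
        kernelC g 0 (ofRealVec l) (ofRealVec c) z * F (ofRealVec c))
      (∫ c : Fin n → ℝ, (0 + 2 * Real.pi * Complex.I * ((∑ k, ofRealVec l k) - ∑ k, ofRealVec c k)) *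
        kernelC g 0 (ofRealVec l) (ofRealVec c) z * F (ofRealVec c)) z := by
  have hg2 : 0 < g / 2 := by positivity
  -- Strictly between `2|Im z|` and `1`, so one majorant serves a neighbourhood of `z`.
  set κ := |z.im| + 1 / 2 with hκ
  obtain ⟨C, h⟩ := exists_linear_baxter_bound hb 0 (by simp) le_rfl hg2
    (by positivity : 0 ≤ κ) (by linarith) (|z.re| + 1) 0 (2 * Real.pi * Complex.I) l
  have hV : {w : ℂ | |w.re| < |z.re| + 1 ∧ 2 * |w.im| < κ} ∈ 𝓝 z := by
    refine IsOpen.mem_nhds ?_ ⟨by linarith, by rw [hκ]; linarith⟩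
    exact (isOpen_lt (Complex.continuous_re.abs) continuous_const).inter
      (isOpen_lt (continuous_const.mul Complex.continuous_im.abs) continuous_const)
  refine (hasDerivAt_integral_of_dominated_loc_of_deriv_le hV
    (F' := fun z c => (0 + 2 * Real.pi * Complex.I * ((∑ k, ofRealVec l k) - ∑ k, ofRealVec c k)) *
      kernelC g 0 (ofRealVec l) (ofRealVec c) z * F (ofRealVec c))
    (bound := fun c => C * (weight c ^ 2)⁻¹) ?_ (integrable_baxter hg hd hb hz l)
    (integrable_linear_baxter hg hd hb _ _ hz l).aestronglyMeasurable
    (Eventually.of_forall fun c w hw => ?_) (integrable_weight_inv_sq.const_mul C)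
    (Eventually.of_forall fun c w hw => ?_)).2
  · filter_upwards [hV] with w hw
    exact (integrable_baxter hg hd hb (by linarith [hw.2]) l).aestronglyMeasurable
  · have := h (ofRealVec c) (ofRealVec c) w (fun a => by simp [ofRealVec])
      (fun a => by simp [ofRealVec]) rfl hw.1.le hw.2.le
    rwa [reVec_ofRealVec] at this
  · refine HasDerivAt.mul_const ?_ _
    have h1 : HasDerivAt (fun w : ℂ => Complex.exp (2 * Real.pi * Complex.I * w *
        ((∑ k, ofRealVec l k) - ∑ k, ofRealVec c k))) (Complex.exp (2 * Real.pi * Complex.I * w *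
        ((∑ k, ofRealVec l k) - ∑ k, ofRealVec c k)) * (2 * Real.pi * Complex.I *
        ((∑ k, ofRealVec l k) - ∑ k, ofRealVec c k))) w := by
      have h2 := (((hasDerivAt_id w).const_mul (2 * Real.pi * Complex.I)).mul_const
        ((∑ k, ofRealVec l k) - ∑ k, ofRealVec c k)).cexp
      simpa using h2
    have h3 := (h1.mul_const (∏ i, ∏ a, KC g (ofRealVec l i - ofRealVec c a))).mul_const
      (offProd g 0 (ofRealVec c))
    refine h3.congr_deriv ?_
    rw [kernelC]
    ring

end

/-- The differential equation in the spectral parameter of the Baxter operator. -/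
theorem baxter_ode {g : ℝ} (hg : 1 < g) {n : ℕ} (hn : 1 ≤ n) (x : Fin n → ℝ) {z : ℂ}
    (hz : |z.im| < 1 / 2) (l : Fin n → ℝ) :
    ∑ s : Finset (Fin n), Complex.exp (2 * Real.pi * z) ^ (n - s.card) *
      (∏ j ∈ s, Complex.exp (2 * Real.pi * x j)) *
      ((∫ c : Fin n → ℝ, (0 + 2 * Real.pi * Complex.I *
          ((∑ k, ofRealVec l k) - ∑ k, ofRealVec c k)) *
          kernelC g 0 (ofRealVec l) (ofRealVec c) z * waveC g n x (ofRealVec c)) +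
        Real.pi * g * (n - 2 * s.card) * ∫ c : Fin n → ℝ,
          kernelC g 0 (ofRealVec l) (ofRealVec c) z * waveC g n x (ofRealVec c)) = 0 := by
  obtain ⟨hd, hb, -⟩ := waveC_properties (by linarith : 0 < g) n hn x
  set F := waveC g n x with hF
  have hg0 : 0 < g := by linarith
  set A : Finset (Fin n) → ℂ := fun s => Real.pi * g * (n - 2 * s.card) with hA
  set w := Complex.exp (2 * Real.pi * z)
  have hI := fun s => integral_baxter_halfShift hg hd hb (A s) (2 * Real.pi * Complex.I) hz l s
  have hJ := fun s => integrable_linear_baxter hg0 hd hb (A s) (2 * Real.pi * Complex.I) hz l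
  have step1 : ∀ s : Finset (Fin n), w ^ (n - s.card) *
      (∏ j ∈ s, Complex.exp (2 * Real.pi * x j)) *
      ((∫ c : Fin n → ℝ, (0 + 2 * Real.pi * Complex.I *
          ((∑ k, ofRealVec l k) - ∑ k, ofRealVec c k)) *
          kernelC g 0 (ofRealVec l) (ofRealVec c) z * F (ofRealVec c)) +
        Real.pi * g * (n - 2 * s.card) * ∫ c : Fin n → ℝ,
          kernelC g 0 (ofRealVec l) (ofRealVec c) z * F (ofRealVec c)) =
      ∫ c : Fin n → ℝ, w ^ (n - s.card) * (∏ j ∈ s, Complex.exp (2 * Real.pi * x j)) *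
        ((A s + 2 * Real.pi * Complex.I * ((∑ k, ofRealVec l k) - ∑ k, ofRealVec c k)) *
          kernelC g 0 (ofRealVec l) (ofRealVec c) z * F (ofRealVec c)) := by
    intro s
    rw [integral_const_mul, ← integral_const_mul, ← integral_add
      (integrable_linear_baxter hg0 hd hb _ _ hz l) ((integrable_baxter hg0 hd hb hz l).const_mul _)]
    congr 2
    ext c
    simp only [hA]
    ring
  rw [Finset.sum_congr rfl fun s _ => step1 s, ← integral_finsetSum _ fun s _ => (hJ s).const_mul _]
  -- `P` removes the factor `∏ exp(-π x j)` of the symmetric difference equations.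
  set P := Complex.exp (∑ j, (Real.pi * x j : ℂ)) with hP
  -- The difference equations replace the products of `exp(2π x j)` by difference operators acting
  -- on the wave function. The remaining factor depends on `s` only through its cardinality, as
  -- `sum_card_mul_eq_of_generating` requires.
  have step2 : ∫ c : Fin n → ℝ, ∑ s : Finset (Fin n), w ^ (n - s.card) *
      (∏ j ∈ s, Complex.exp (2 * Real.pi * x j)) *
        ((A s + 2 * Real.pi * Complex.I * ((∑ k, ofRealVec l k) - ∑ k, ofRealVec c k)) *
          kernelC g 0 (ofRealVec l) (ofRealVec c) z * F (ofRealVec c)) =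
      ∫ c : Fin n → ℝ, P * ∑ s : Finset (Fin n), w ^ (n - s.card) *
        ((A s + 2 * Real.pi * Complex.I * ((∑ k, ofRealVec l k) - ∑ k, ofRealVec c k)) *
        kernelC g (cutShift s) (ofRealVec l) (ofRealVec c) z *
        F (fun k => ofRealVec c k - halfShift s k)) := by
    refine integral_congr_ae ((ae_injective n).mono fun c hc => ?_)
    have hc' := ofRealVec_injective hc
    have gen := sum_card_mul_eq_of_generating
      (A := fun s => P * (macCoeff g s (ofRealVec c) * F (fun k => ofRealVec c k - halfShift s k)))
      (B := fun s => (∏ j ∈ s, Complex.exp (2 * Real.pi * x j)) * F (ofRealVec c)) (fun v => by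
        have := sum_macCoeff_waveC hg n hn x (ofRealVec_mem_strip (by linarith) c) hc' v
        rw [Finset.prod_mul_distrib, prod_one_add_mul, ← Complex.exp_sum, ← hF] at this
        have e : P * Complex.exp (∑ j, -(Real.pi * x j : ℂ)) = 1 := by
          rw [hP, ← Complex.exp_add, ← Finset.sum_add_distrib]
          simp
        calc _ = P * ∑ s : Finset (Fin n), v ^ s.card * (macCoeff g s (ofRealVec c) *
              F (fun k => ofRealVec c k - halfShift s k)) := by
              rw [Finset.mul_sum]
              exact Finset.sum_congr rfl fun s _ => by ring
          _ = (P * Complex.exp (∑ j, -(Real.pi * x j : ℂ))) * ((∑ s : Finset (Fin n),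
              v ^ s.card * ∏ j ∈ s, Complex.exp (2 * Real.pi * x j)) * F (ofRealVec c)) := by
              rw [this]; ring
          _ = _ := by
              rw [e, one_mul, Finset.sum_mul]
              exact Finset.sum_congr rfl fun s _ => by ring)
      (fun r => w ^ (n - r) * (Real.pi * g * (n - 2 * r) + 2 * Real.pi * Complex.I *
        ((∑ k, ofRealVec l k) - ∑ k, ofRealVec c k)) *
          kernelC g 0 (ofRealVec l) (ofRealVec c) z)
    beta_reduce
    calc _ = _ := Finset.sum_congr rfl fun s _ => by simp only [hA]; ring
      _ = _ := gen.symm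
      _ = _ := by
        rw [Finset.mul_sum]
        refine Finset.sum_congr rfl fun s _ => ?_
        rw [kernelC_cutShift g s _ hc']
        simp only [hA]
        ring
  rw [step2, integral_const_mul, integral_finsetSum _ fun s _ => (hI s).2.1.const_mul _,
    Finset.sum_congr rfl fun s _ => by rw [integral_const_mul, ← (hI s).2.2, ← integral_const_mul],
    ← integral_finsetSum _ fun s _ => (hI s).1.const_mul _]
  -- After the contour shift the half steps act on the kernel, and the sum over subsets vanishes
  -- pointwise.
  have step3 : ∫ c : Fin n → ℝ, ∑ s : Finset (Fin n), w ^ (n - s.card) *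
      ((A s + 2 * Real.pi * Complex.I *
        ((∑ k, ofRealVec l k) - ∑ k, (ofRealVec c k + halfShift s k))) *
        kernelC g (cutShift s) (ofRealVec l) (fun k => ofRealVec c k + halfShift s k) z *
        F (ofRealVec c)) = ∫ _c : Fin n → ℝ, (0 : ℂ) := by
    refine integral_congr_ae ((ae_injective n).mono fun c hc => ?_)
    have hl : ∀ k, |(ofRealVec l k).im| < (g - 1) / 2 := ofRealVec_mem_strip (by linarith) l
    have := sum_kernelC_baxter_eq_zero (g := g) hn (l := ofRealVec l) (ofRealVec_injective hc)
      (fun k a => (I_mul_add_ne_zero (hl k) (by simp [ofRealVec])).1)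
      (fun k a => (I_mul_add_ne_zero (hl k) (by simp [ofRealVec])).2) z
    have h2 := congrArg (· * F (ofRealVec c)) this
    simp only [Finset.sum_mul, zero_mul] at h2
    rw [← h2]
    refine Finset.sum_congr rfl fun s _ => ?_
    ring
  rw [step3, integral_zero, mul_zero]

/-- The real part is `2 cosh(π Re z) cos(π Im z)`, positive for `|Im z| < 1/2`. -/
theorem cosh_mem_slitPlane {z : ℂ} (hz : |z.im| < 1 / 2) :
    2 * Complex.cosh (Real.pi * z) ∈ Complex.slitPlane := by
  left
  have h1 : (2 * Complex.cosh (Real.pi * z)).re =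
      2 * (Real.cosh (Real.pi * z.re) * Real.cos (Real.pi * z.im)) := by
    have : (Real.pi * z : ℂ) = ((Real.pi * z.re : ℝ) : ℂ) + ((Real.pi * z.im : ℝ) : ℂ) * Complex.I := by
      conv_lhs => rw [← Complex.re_add_im z]
      push_cast; ring
    rw [this, Complex.cosh_add, Complex.cosh_mul_I, Complex.sinh_mul_I, ← Complex.ofReal_cosh,
      ← Complex.ofReal_cos, ← Complex.ofReal_sinh, ← Complex.ofReal_sin]
    simp [-Complex.ofReal_cosh, -Complex.ofReal_cos, -Complex.ofReal_sinh, -Complex.ofReal_sin]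
  rw [h1]
  have h2 : 0 < Real.cos (Real.pi * z.im) := by
    refine Real.cos_pos_of_mem_Ioo ?_
    rw [abs_lt] at hz
    constructor <;> nlinarith [Real.pi_pos]
  have h3 := Real.cosh_pos (Real.pi * z.re)
  positivity

/-- The logarithmic derivative is `-πg tanh(πz)`, written in `exp(2πz)` to match the differential
equation. -/
theorem hasDerivAt_kernelK (g : ℝ) {z : ℂ} (hz : |z.im| < 1 / 2) :
    kernelK g z ≠ 0 ∧ HasDerivAt (kernelK g) (-(Real.pi * g *
      ((Complex.exp (2 * Real.pi * z) - 1) / (Complex.exp (2 * Real.pi * z) + 1))) *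
        kernelK g z) z ∧ Complex.exp (2 * Real.pi * z) + 1 ≠ 0 := by
  have hs := cosh_mem_slitPlane hz
  have h0 : 2 * Complex.cosh (Real.pi * z) ≠ 0 := Complex.slitPlane_ne_zero hs
  have hE : Complex.exp (2 * Real.pi * z) = Complex.exp (Real.pi * z) * Complex.exp (Real.pi * z) := by
    rw [← Complex.exp_add]; congr 1; ring
  have e0 := Complex.exp_ne_zero (Real.pi * z)
  have hc : 2 * Complex.cosh (Real.pi * z) = Complex.exp (Real.pi * z) + (Complex.exp (Real.pi * z))⁻¹ := by
    rw [Complex.cosh, Complex.exp_neg]; ring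
  have hsn : 2 * Complex.sinh (Real.pi * z) = Complex.exp (Real.pi * z) - (Complex.exp (Real.pi * z))⁻¹ := by
    rw [Complex.sinh, Complex.exp_neg]; ring
  have h1 : Complex.exp (2 * Real.pi * z) + 1 ≠ 0 := by
    intro h
    apply h0
    rw [hc]
    have := mul_inv_cancel₀ e0
    apply mul_left_cancel₀ e0
    rw [mul_add, this, ← hE, h, mul_zero]
  refine ⟨?_, ?_, h1⟩
  · rw [kernelK, Complex.cpow_def_of_ne_zero h0]
    exact Complex.exp_ne_zero _
  · have hd : HasDerivAt (fun z : ℂ => 2 * Complex.cosh (Real.pi * z))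
        (2 * (Complex.sinh (Real.pi * z) * Real.pi)) z := by
      have := (((hasDerivAt_id z).const_mul (Real.pi : ℂ)).ccosh).const_mul 2
      simpa using this
    have := hd.cpow_const (c := -(g : ℂ)) hs
    refine this.congr_deriv ?_
    rw [Complex.cpow_sub _ _ h0, Complex.cpow_one, kernelK]
    set X := (2 * Complex.cosh (Real.pi * z)) ^ (-(g : ℂ))
    have e : (Complex.exp (2 * Real.pi * z) - 1) / (Complex.exp (2 * Real.pi * z) + 1) =
        2 * Complex.sinh (Real.pi * z) / (2 * Complex.cosh (Real.pi * z)) := by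
      rw [div_eq_div_iff h1 h0, hc, hsn, hE]
      field_simp
    rw [e]
    ring

end RationalRuijsenaars

end

/-! ### Solution of the differential equation up to a constant. -/

noncomputable section

namespace RationalRuijsenaars

open MeasureTheory Filter Topology

theorem sum_pow_mul_prod {n : ℕ} (w : ℂ) (X : Fin n → ℂ) :
    ∑ s : Finset (Fin n), w ^ (n - s.card) * ∏ j ∈ s, X j = ∏ j, (X j + w) := by
  rw [Finset.prod_add, Finset.powerset_univ]
  refine Finset.sum_congr rfl fun s _ => ?_
  rw [Finset.prod_const, Finset.card_univ_sdiff, Fintype.card_fin, mul_comm]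

/-- `n - 2|s|` is a sum over `j` of a sign, `-1` for `j ∈ s`. The term of `j` is the product
expansion with `X j` replaced by `-X j`. -/
theorem sum_pow_mul_prod_mul {n : ℕ} (w : ℂ) (X : Fin n → ℂ) (h : ∀ j, w + X j ≠ 0) :
    ∑ s : Finset (Fin n), w ^ (n - s.card) * (∏ j ∈ s, X j) * (n - 2 * s.card) =
      (∑ j, (w - X j) / (w + X j)) * ∏ j, (X j + w) := by
  have h1 : ∀ (s : Finset (Fin n)), ((n : ℂ) - 2 * s.card) = ∑ j, if j ∈ s then (-1 : ℂ) else 1 := by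
    intro s
    have hcard : ((sᶜ.card : ℕ) : ℂ) + s.card = n := by
      exact_mod_cast (by simp : sᶜ.card + s.card = n)
    rw [← Finset.sum_add_sum_compl s, Finset.sum_congr rfl fun j hj => if_pos hj,
      Finset.sum_congr (s₁ := sᶜ) rfl fun j hj => if_neg (Finset.mem_compl.1 hj)]
    simp only [Finset.sum_const, nsmul_eq_mul]
    rw [← hcard]; ring
  simp only [h1, Finset.mul_sum, Finset.sum_mul]
  rw [Finset.sum_comm]
  refine Finset.sum_congr rfl fun j _ => ?_
  have h2 := sum_pow_mul_prod w fun i => (if i = j then -1 else 1) * X i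
  have h3 : ∏ i, ((if i = j then -1 else 1) * X i + w) =
      (w - X j) / (w + X j) * ∏ i, (X i + w) := by
    rw [← Finset.mul_prod_erase _ _ (Finset.mem_univ j),
      ← Finset.mul_prod_erase _ (fun i => X i + w) (Finset.mem_univ j), if_pos rfl,
      Finset.prod_congr (s₁ := Finset.univ.erase j) rfl fun i hi => by
        rw [if_neg (Finset.ne_of_mem_erase hi), one_mul]]
    rw [← mul_assoc, add_comm (X j) w, div_mul_cancel₀ _ (h j)]
    ring
  rw [← h3, ← h2]
  refine Finset.sum_congr rfl fun s _ => ?_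
  rw [Finset.prod_mul_distrib, Finset.prod_ite_eq']
  ring

/-- Both functions of `z` solve the same first-order linear equation on a connected strip, and the
product of kernels has no zeros there, so the quotient is constant. -/
theorem exists_baxter_eq_mul {g : ℝ} (hg : 1 < g) {n : ℕ} (hn : 1 ≤ n) (x : Fin n → ℝ)
    (l : Fin n → ℝ) : ∃ K : ℂ, ∀ z : ℂ, |z.im| < 1 / 2 →
      ∫ c : Fin n → ℝ, kernelC g 0 (ofRealVec l) (ofRealVec c) z * waveC g n x (ofRealVec c) =
        K * ∏ j, kernelK g (z - x j) := by
  have hg0 : 0 < g := by linarith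
  obtain ⟨hd, hb, -⟩ := waveC_properties hg0 n hn x
  set f : ℂ → ℂ := fun z => ∫ c : Fin n → ℝ,
    kernelC g 0 (ofRealVec l) (ofRealVec c) z * waveC g n x (ofRealVec c) with hf
  set u : ℂ → ℂ := fun z => ∏ j, kernelK g (z - x j) with hu
  set S : Set ℂ := {z | |z.im| < 1 / 2} with hS
  have hSx : ∀ z ∈ S, ∀ j, |(z - x j).im| < 1 / 2 := fun z hz j => by
    rw [Complex.sub_im, Complex.ofReal_im, sub_zero]; exact hz
  have hu0 : ∀ z ∈ S, u z ≠ 0 := fun z hz =>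
    Finset.prod_ne_zero_iff.2 fun j _ => (hasDerivAt_kernelK g (hSx z hz j)).1
  have hw : ∀ (z : ℂ) (j : Fin n), Complex.exp (2 * Real.pi * (z - x j)) =
      Complex.exp (2 * Real.pi * z) / Complex.exp (2 * Real.pi * x j) := fun z j => by
    rw [← Complex.exp_sub]; congr 1; ring
  have hwX : ∀ z ∈ S, ∀ j, Complex.exp (2 * Real.pi * z) + Complex.exp (2 * Real.pi * x j) ≠ 0 := by
    intro z hz j h
    have := (hasDerivAt_kernelK g (hSx z hz j)).2.2
    rw [hw] at this
    have e0 := Complex.exp_ne_zero (2 * Real.pi * x j)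
    apply this
    rw [div_add_one e0, h, zero_div]
  have hud : ∀ z ∈ S, HasDerivAt u (-(Real.pi * g * ∑ j,
      (Complex.exp (2 * Real.pi * z) - Complex.exp (2 * Real.pi * x j)) /
        (Complex.exp (2 * Real.pi * z) + Complex.exp (2 * Real.pi * x j))) * u z) z := by
    intro z hz
    have h1 : ∀ j, HasDerivAt (fun z => kernelK g (z - x j)) (-(Real.pi * g *
      ((Complex.exp (2 * Real.pi * z) - Complex.exp (2 * Real.pi * x j)) /
        (Complex.exp (2 * Real.pi * z) + Complex.exp (2 * Real.pi * x j)))) *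
        kernelK g (z - x j)) z := by
      intro j
      have h2 := ((hasDerivAt_kernelK g (hSx z hz j)).2.1).comp_sub_const z (x j)
      refine h2.congr_deriv ?_
      rw [hw]
      have e0 := Complex.exp_ne_zero (2 * Real.pi * x j)
      have e1 := hwX z hz j
      congr 3
      rw [div_sub_one e0, div_add_one e0, div_div_div_cancel_right₀ e0]
    have h3 := HasDerivAt.fun_finsetProd (u := Finset.univ) fun j _ => h1 j
    refine h3.congr_deriv ?_
    rw [Finset.mul_sum, ← Finset.sum_neg_distrib, Finset.sum_mul]
    refine Finset.sum_congr rfl fun j _ => ?_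
    simp only [hu, smul_eq_mul]
    rw [← Finset.mul_prod_erase _ _ (Finset.mem_univ j)]
    ring
  have hSo : IsOpen S := isOpen_lt Complex.continuous_im.abs continuous_const
  have hSc : Convex ℝ S := by
    have : S = (fun z : ℂ => z.im) ⁻¹' Set.Ioo (-(1 / 2)) (1 / 2) := by
      ext z; simp only [hS, abs_lt, Set.mem_ofPred_eq, Set.mem_preimage, Set.mem_Ioo]
    rw [this]
    exact (convex_Ioo _ _).is_linear_preimage Complex.imLm.isLinear
  have hq : ∀ z ∈ S, HasDerivAt (fun z => f z / u z) 0 z := by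
    intro z hz
    have h1 := hasDerivAt_baxter hg0 hd hb hz l
    have h2 := baxter_ode hg hn x hz l
    refine (h1.div (hud z hz) (hu0 z hz)).congr_deriv ?_
    set D := ∫ c : Fin n → ℝ, (0 + 2 * Real.pi * Complex.I *
      ((∑ k, ofRealVec l k) - ∑ k, ofRealVec c k)) *
        kernelC g 0 (ofRealVec l) (ofRealVec c) z * waveC g n x (ofRealVec c)
    have h3 := sum_pow_mul_prod (Complex.exp (2 * Real.pi * z))
      fun j => Complex.exp (2 * Real.pi * x j)
    have h4 := sum_pow_mul_prod_mul (Complex.exp (2 * Real.pi * z))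
      (fun j => Complex.exp (2 * Real.pi * x j)) (hwX z hz)
    set T := ∑ j, (Complex.exp (2 * Real.pi * z) - Complex.exp (2 * Real.pi * x j)) /
        (Complex.exp (2 * Real.pi * z) + Complex.exp (2 * Real.pi * x j))
    have hP0 : ∏ j, (Complex.exp (2 * Real.pi * x j) + Complex.exp (2 * Real.pi * z)) ≠ 0 :=
      Finset.prod_ne_zero_iff.2 fun j _ => by rw [add_comm]; exact hwX z hz j
    -- Summing over subsets makes `∏ (X j + w)` a common factor, which is cancelled.
    have h5 : D + Real.pi * g * T * f z = 0 := by
      refine mul_right_cancel₀ hP0 ?_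
      rw [zero_mul, ← h2]
      have : ∀ s : Finset (Fin n), Complex.exp (2 * Real.pi * z) ^ (n - s.card) *
          (∏ j ∈ s, Complex.exp (2 * Real.pi * x j)) *
          (D + Real.pi * g * (n - 2 * s.card) * f z) =
          D * (Complex.exp (2 * Real.pi * z) ^ (n - s.card) *
            ∏ j ∈ s, Complex.exp (2 * Real.pi * x j)) +
          Real.pi * g * f z * (Complex.exp (2 * Real.pi * z) ^ (n - s.card) *
          (∏ j ∈ s, Complex.exp (2 * Real.pi * x j)) * (n - 2 * s.card)) := fun s => by ring
      rw [Finset.sum_congr rfl fun s _ => this s, Finset.sum_add_distrib, ← Finset.mul_sum,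
        ← Finset.mul_sum, h3, h4]
      ring
    rw [div_eq_zero_iff]
    left
    linear_combination (u z) * h5
  refine ⟨f 0 / u 0, fun z hz => ?_⟩
  have h0 : (0 : ℂ) ∈ S := by simp [hS]
  have := hSo.is_const_of_deriv_eq_zero hSc.isPreconnected
    (fun z hz => (hq z hz).differentiableAt.differentiableWithinAt)
    (fun z hz => (hq z hz).deriv) h0 hz
  rw [this, div_mul_cancel₀ _ (hu0 z hz)]

end RationalRuijsenaars

end

/-! ### Fourier inversion and decay of Laplace–Fourier transforms. -/

noncomputable section

namespace RationalRuijsenaars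

open MeasureTheory Filter Topology

open scoped FourierTransform RealInnerProductSpace in
/-- Fourier inversion on `ℝⁿ`. -/
theorem integral_integral_exp_mul {n : ℕ} {h : (Fin n → ℝ) → ℂ} (hc : Continuous h)
    (hi : Integrable h) (l : Fin n → ℝ)
    (hF : Integrable fun s : Fin n → ℝ => ∫ c : Fin n → ℝ,
      Complex.exp (2 * Real.pi * Complex.I * ∑ a, s a * (l a - c a)) * h c) :
    ∫ s : Fin n → ℝ, ∫ c : Fin n → ℝ,
      Complex.exp (2 * Real.pi * Complex.I * ∑ a, s a * (l a - c a)) * h c = h l := by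
  -- After translation by `l` the Fourier transform carries the phase `s · (l - c)`, and inversion
  -- is only needed at the origin.
  set f : EuclideanSpace ℝ (Fin n) → ℂ := fun v => h (l + v.ofLp) with hf
  have mp := PiLp.volume_preserving_ofLp (Fin n)
  have me : MeasurableEmbedding (WithLp.ofLp : EuclideanSpace ℝ (Fin n) → Fin n → ℝ) :=
    (MeasurableEquiv.toLp 2 (Fin n → ℝ)).symm.measurableEmbedding
  have hfc : Continuous f := hc.comp (continuous_const.add (PiLp.continuous_ofLp 2 _))
  have hfi : Integrable f :=
    (mp.integrable_comp_emb me (g := fun c => h (l + c))).2 (hi.comp_add_left l)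
  have hFT : ∀ w : EuclideanSpace ℝ (Fin n), 𝓕 f w = ∫ c : Fin n → ℝ,
      Complex.exp (2 * Real.pi * Complex.I * ∑ a, w.ofLp a * (l a - c a)) * h c := by
    intro w
    rw [Real.fourier_eq']
    rw [← integral_add_left_eq_self (fun c : Fin n → ℝ => Complex.exp (2 * Real.pi * Complex.I *
      ∑ a, w.ofLp a * (l a - c a)) * h c) l, ← mp.integral_comp me]
    refine integral_congr_ae (Eventually.of_forall fun v => ?_)
    simp only [hf, smul_eq_mul, PiLp.inner_apply, Pi.add_apply]
    congr 2
    push_cast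
    rw [Finset.mul_sum, Finset.sum_mul, Finset.mul_sum]
    refine Finset.sum_congr rfl fun a _ => ?_
    simp
    ring
  have hFi : Integrable (𝓕 f) := by
    have := (mp.integrable_comp_emb me (g := fun s : Fin n → ℝ => ∫ c : Fin n → ℝ,
      Complex.exp (2 * Real.pi * Complex.I * ∑ a, s a * (l a - c a)) * h c)).2 hF
    refine this.congr (Eventually.of_forall fun w => ?_)
    exact (hFT w).symm
  have key := hfi.fourierInv_fourier_eq hFi (v := 0) hfc.continuousAt
  rw [Real.fourierInv_eq'] at key
  simp only [inner_zero_right, mul_zero, Complex.ofReal_zero, zero_mul, Complex.exp_zero,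
    one_smul] at key
  rw [← mp.integral_comp me]
  calc _ = ∫ v, 𝓕 f v := by
        refine integral_congr_ae (Eventually.of_forall fun w => ?_)
        exact (hFT w).symm
    _ = f 0 := key
    _ = h l := by simp [hf]

/-- Pointwise bound of a Laplace–Fourier transform. -/
theorem exists_norm_integral_exp_le {n : ℕ} {η δ C : ℝ} {H : (Fin n → ℂ) → ℂ} (hδ : 0 < δ)
    (hδη : δ < η) (hd : DifferentiableOn ℂ H (strip n η))
    (hb : ∀ w ∈ strip n η, ‖H w‖ ≤ C * ((weight (reVec w)) ^ 2)⁻¹) (l : Fin n → ℝ) :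
    ∃ C' ε : ℝ, 0 < ε ∧ ∀ s : Fin n → ℝ,
      ‖∫ c : Fin n → ℝ, Complex.exp (2 * Real.pi * ∑ a, s a * (δ + Complex.I * (l a - c a))) *
        H (ofRealVec c)‖ ≤ C' * ∏ a, Real.exp (-ε * |s a|) := by
  set ε := (η - δ) / 2 with hε
  have hε0 : 0 < ε := by rw [hε]; linarith
  refine ⟨C * ∫ c : Fin n → ℝ, (weight c ^ 2)⁻¹, 2 * Real.pi * ε, by positivity, fun s => ?_⟩
  -- The contour of each coordinate is moved past `-δ` by `ε` in the direction given by the sign of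
  -- `s a`, so the real exponent becomes `-ε|s a|` up to the factor `2π`.
  set v : Fin n → ℝ := fun a => -δ - ε * SignType.sign (s a) with hv
  have hvη : ∀ a, |v a| < η := fun a => by
    rw [abs_lt]
    rcases lt_trichotomy (s a) 0 with h | h | h <;> simp [hv, h] <;> constructor <;>
      linarith
  have hvs : ∀ a, s a * (δ + v a) = -(ε * |s a|) := fun a => by
    rw [← self_mul_sign (s a)]
    simp only [hv]; ring
  set G : (Fin n → ℂ) → ℂ := fun w => Complex.exp (2 * Real.pi *
    ∑ a, s a * (δ + Complex.I * (l a - w a))) * H w with hG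
  have hnorm : ∀ w : Fin n → ℂ, ‖Complex.exp (2 * Real.pi *
      ∑ a, s a * (δ + Complex.I * (l a - w a)))‖ =
      ∏ a, Real.exp (2 * Real.pi * (s a * (δ + (w a).im))) := fun w => by
    rw [Complex.norm_exp, ← Real.exp_sum]
    congr 1
    rw [← Finset.mul_sum]
    have : (2 * Real.pi * ∑ a, (s a : ℂ) * (δ + Complex.I * (l a - w a))) =
      ((2 * Real.pi : ℝ) : ℂ) * ∑ a, (s a : ℂ) * (δ + Complex.I * (l a - w a)) := by
        push_cast; rfl
    rw [this, Complex.re_ofReal_mul, Complex.re_sum]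
    congr 1
    refine Finset.sum_congr rfl fun a _ => ?_
    rw [Complex.re_ofReal_mul]
    simp
  have hexp : Differentiable ℂ fun w : Fin n → ℂ => Complex.exp (2 * Real.pi *
    ∑ a, s a * (δ + Complex.I * (l a - w a))) := by fun_prop
  have hGd : DifferentiableOn ℂ G (strip n η) := hexp.differentiableOn.mul hd
  have hη0 : 0 < η := by linarith
  have hC : 0 ≤ C := by
    have := (norm_nonneg _).trans (hb 0 fun k => by simpa using hη0)
    have hw := weight_pos (reVec (0 : Fin n → ℂ))
    exact nonneg_of_mul_nonneg_left this (by positivity)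
  -- This bound is not uniform in `s`; it only justifies the shift.
  have hGb : ∀ w ∈ strip n η, ‖G w‖ ≤ ((∏ a, Real.exp (2 * Real.pi * (|s a| * (δ + η)))) * C) *
      ((weight (reVec w)) ^ 2)⁻¹ := by
    intro w hw
    rw [hG, norm_mul, hnorm, mul_assoc]
    refine mul_le_mul ?_ (hb w hw) (norm_nonneg _) (by positivity)
    refine Finset.prod_le_prod (fun _ _ => by positivity) fun a _ => ?_
    refine Real.exp_le_exp.2 ?_
    have h1 := hw a
    have h2 : s a * (δ + (w a).im) ≤ |s a| * (δ + η) := by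
      refine (le_abs_self _).trans ?_
      rw [abs_mul]
      refine mul_le_mul_of_nonneg_left ?_ (abs_nonneg _)
      refine (abs_add_le _ _).trans ?_
      rw [abs_of_pos hδ]
      linarith
    have := Real.pi_pos
    nlinarith
  have key := integral_shift hGd hGb v hvη
  have e : ∫ c : Fin n → ℝ, Complex.exp (2 * Real.pi * ∑ a, s a * (δ + Complex.I * (l a - c a))) *
        H (ofRealVec c) = ∫ c : Fin n → ℝ, G (ofRealVec c) := by
    simp only [hG, ofRealVec]
  rw [e, ← key]
  have hmem : ∀ c : Fin n → ℝ, (fun k => (c k : ℂ) + v k * Complex.I) ∈ strip n η := fun c k => by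
    simpa using hvη k
  have hre : ∀ c : Fin n → ℝ, reVec (fun k => (c k : ℂ) + v k * Complex.I) = c := fun c => by
    ext k; simp [reVec]
  refine (norm_integral_le_of_norm_le (integrable_weight_inv_sq.const_mul
    ((∏ a, Real.exp (-(2 * Real.pi * ε) * |s a|)) * C)) (Eventually.of_forall fun c => ?_)).trans
    (le_of_eq ?_)
  · rw [hG, norm_mul, hnorm, mul_assoc]
    refine mul_le_mul (le_of_eq ?_) ?_ (norm_nonneg _) (by positivity)
    · refine Finset.prod_congr rfl fun a _ => ?_
      congr 1
      have := hvs a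
      simp only [Complex.add_im, Complex.ofReal_im, Complex.mul_im, Complex.ofReal_re,
        Complex.I_im, mul_one, Complex.I_re, mul_zero, zero_add, add_zero]
      rw [this]
      ring
    · have := hb _ (hmem c)
      rwa [hre] at this
  · rw [integral_const_mul]
    ring

end RationalRuijsenaars

end

/-! ### A multidimensional Abelian theorem. -/

noncomputable section

namespace RationalRuijsenaars

open MeasureTheory Filter Topology

theorem integrable_exp_neg_mul_abs {ε : ℝ} (hε : 0 < ε) :
    Integrable fun t : ℝ => Real.exp (-ε * |t|) := by
  rw [← integrableOn_univ, ← Set.Iic_union_Ioi (a := (0 : ℝ))]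
  refine IntegrableOn.union ?_ ?_
  · refine (integrableOn_exp_mul_Iic hε 0).congr_fun (fun t ht => ?_) measurableSet_Iic
    simp only [abs_of_nonpos (Set.mem_Iic.1 ht)]
    ring_nf
  · refine (integrableOn_exp_mul_Ioi (neg_lt_zero.2 hε) 0).congr_fun (fun t ht => ?_)
      measurableSet_Ioi
    simp only [abs_of_pos (Set.mem_Ioi.1 ht)]

theorem prod_indicator_Iic {n : ℕ} (z : ℝ) (φ : Fin n → ℝ → ℂ) (s : Fin n → ℝ) :
    ∏ a, (Set.Iic z).indicator (φ a) (s a) =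
      (Set.univ.pi fun _ => Set.Iic z).indicator (fun s => ∏ a, φ a (s a)) s := by
  by_cases h : s ∈ Set.univ.pi fun _ : Fin n => Set.Iic z
  · rw [Set.indicator_of_mem h]
    exact Finset.prod_congr rfl fun a _ => Set.indicator_of_mem (h a (Set.mem_univ a)) _
  · rw [Set.indicator_of_notMem h]
    simp only [Set.mem_univ_pi, not_forall] at h
    obtain ⟨a, ha⟩ := h
    exact Finset.prod_eq_zero (Finset.mem_univ a) (Set.indicator_of_notMem ha _)

section

variable {n : ℕ} {η δ C : ℝ} {H : (Fin n → ℂ) → ℂ}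

/-- For `Re A = δ > 0`, `exp(2πzA)/A` is the integral of `2π exp(2πAs)` over `s ≤ z`. Fubini applies
because `H` is integrable and `exp(2πδs)` is integrable on that half line. -/
theorem integral_laplace_eq (hδ : 0 < δ) (hHc : Continuous fun c : Fin n → ℝ => H (ofRealVec c))
    (hHi : Integrable fun c : Fin n → ℝ => H (ofRealVec c)) (l : Fin n → ℝ) (z : ℝ) :
    ∫ c : Fin n → ℝ, (∏ a, Complex.exp (2 * Real.pi * z * (δ + Complex.I * (l a - c a))) /
      (δ + Complex.I * (l a - c a))) * H (ofRealVec c) =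
    ∫ s : Fin n → ℝ, (Set.univ.pi fun _ => Set.Iic z).indicator (fun s => (2 * Real.pi) ^ n *
      ∫ c : Fin n → ℝ, Complex.exp (2 * Real.pi * ∑ a, s a * (δ + Complex.I * (l a - c a))) *
        H (ofRealVec c)) s := by
  have hpi : (2 * Real.pi : ℂ) ≠ 0 := by
    have := Real.pi_ne_zero
    norm_num [this]
  set φ : (Fin n → ℝ) → Fin n → ℝ → ℂ := fun c a t =>
    2 * Real.pi * Complex.exp (2 * Real.pi * (δ + Complex.I * (l a - c a)) * t) with hφ
  set J : (Fin n → ℝ) → (Fin n → ℝ) → ℂ := fun c s =>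
    (∏ a, (Set.Iic z).indicator (φ c a) (s a)) * H (ofRealVec c) with hJ
  have hre : ∀ (c : Fin n → ℝ) (a : Fin n),
      (2 * Real.pi * (δ + Complex.I * (l a - c a)) : ℂ).re = 2 * Real.pi * δ := fun c a => by
    simp
  have hone : ∀ c, ∫ s : Fin n → ℝ, J c s =
      (∏ a, Complex.exp (2 * Real.pi * z * (δ + Complex.I * (l a - c a))) /
        (δ + Complex.I * (l a - c a))) * H (ofRealVec c) := by
    intro c
    simp only [hJ]
    rw [integral_mul_const, integral_fintype_prod_volume_eq_prod]
    congr 1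
    refine Finset.prod_congr rfl fun a _ => ?_
    rw [integral_indicator measurableSet_Iic]
    simp only [hφ]
    rw [integral_const_mul, integral_exp_mul_complex_Iic (by rw [hre]; positivity)]
    rw [← mul_div_assoc, mul_div_mul_left _ _ hpi]
    congr 2
    ring
  have hmeas : Measurable (Function.uncurry J) := by
    have hH : Measurable fun p : (Fin n → ℝ) × (Fin n → ℝ) => H (ofRealVec p.1) :=
      hHc.measurable.comp measurable_fst
    refine Measurable.mul (Finset.measurable_prod _ fun a _ => ?_) hH
    have : (fun p : (Fin n → ℝ) × (Fin n → ℝ) => (Set.Iic z).indicator (φ p.1 a) (p.2 a)) =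
        {p : (Fin n → ℝ) × (Fin n → ℝ) | p.2 a ≤ z}.indicator fun p => φ p.1 a (p.2 a) := by
      ext p
      simp only [Set.indicator, Set.mem_Iic, Set.mem_ofPred_eq]
    rw [this]
    refine Measurable.indicator ?_ ?_
    · refine Continuous.measurable ?_
      simp only [hφ]
      fun_prop
    · exact measurableSet_le (by fun_prop) measurable_const
  have hbound : Integrable fun p : (Fin n → ℝ) × (Fin n → ℝ) => ‖H (ofRealVec p.1)‖ *
      ∏ a, (Set.Iic z).indicator (fun t => 2 * Real.pi * Real.exp (2 * Real.pi * δ * t)) (p.2 a) := by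
    refine hHi.norm.mul_prod (Integrable.fintype_prod fun a => ?_)
    exact (integrable_indicator_iff measurableSet_Iic).2
      ((integrableOn_exp_mul_Iic (by positivity) z).const_mul _)
  have hJi : Integrable (Function.uncurry J) (volume.prod volume) := by
    refine hbound.mono' hmeas.aestronglyMeasurable (Eventually.of_forall fun p => ?_)
    simp only [Function.uncurry, hJ]
    rw [norm_mul, mul_comm, norm_prod]
    refine mul_le_mul_of_nonneg_left (le_of_eq ?_) (norm_nonneg _)
    refine Finset.prod_congr rfl fun a _ => ?_
    rw [norm_indicator_eq_indicator_norm]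
    congr 1
    ext t
    simp only [hφ]
    rw [norm_mul, Complex.norm_exp, Complex.re_mul_ofReal, hre, norm_mul, Complex.norm_real,
      Real.norm_of_nonneg Real.pi_pos.le]
    simp
  rw [← integral_congr_ae (Eventually.of_forall hone), integral_integral_swap hJi]
  refine integral_congr_ae (Eventually.of_forall fun s => ?_)
  simp only [hJ, prod_indicator_Iic]
  by_cases hs : s ∈ Set.univ.pi fun _ : Fin n => Set.Iic z
  · simp only [Set.indicator_of_mem hs]
    rw [← integral_const_mul]
    refine integral_congr_ae (Eventually.of_forall fun c => ?_)
    simp only [hφ]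
    rw [Finset.prod_mul_distrib, Finset.prod_const, Finset.card_univ, Fintype.card_fin,
      ← Complex.exp_sum, mul_assoc, Finset.mul_sum]
    congr 3
    refine Finset.sum_congr rfl fun a _ => ?_
    ring
  · simp only [Set.indicator_of_notMem hs, zero_mul, integral_zero]

/-- A multidimensional Abelian theorem: the limit of the integral is the residue. -/
theorem tendsto_integral_laplace (hδ : 0 < δ)
    (hδη : δ < η) (hd : DifferentiableOn ℂ H (strip n η))
    (hb : ∀ w ∈ strip n η, ‖H w‖ ≤ C * ((weight (reVec w)) ^ 2)⁻¹) (l : Fin n → ℝ) :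
    Tendsto (fun z : ℝ => ∫ c : Fin n → ℝ,
      (∏ a, Complex.exp (2 * Real.pi * z * (δ + Complex.I * (l a - c a))) /
        (δ + Complex.I * (l a - c a))) * H (ofRealVec c)) atTop
      (𝓝 ((2 * Real.pi) ^ n * H fun a => l a - δ * Complex.I)) := by
  have hη0 : 0 < η := hδ.trans hδη
  have hHc : Continuous fun c : Fin n → ℝ => H (ofRealVec c) :=
    hd.continuousOn.comp_continuous continuous_ofRealVec (ofRealVec_mem_strip hη0)
  have hHi : Integrable fun c : Fin n → ℝ => H (ofRealVec c) := by
    have := integrable_shift hd hb 0 (fun k => by simpa using hη0)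
    exact this.congr (Eventually.of_forall fun c =>
      congrArg H (funext fun k => by simp [ofRealVec]))
  set Φ : (Fin n → ℝ) → ℂ := fun s => ∫ c : Fin n → ℝ,
    Complex.exp (2 * Real.pi * ∑ a, s a * (δ + Complex.I * (l a - c a))) * H (ofRealVec c) with hΦ
  obtain ⟨C', ε, hε, hΦb⟩ := exists_norm_integral_exp_le hδ hδη hd hb l
  have hbi : Integrable fun s : Fin n → ℝ => C' * ∏ a, Real.exp (-ε * |s a|) :=
    (Integrable.fintype_prod fun _ => integrable_exp_neg_mul_abs hε).const_mul C'
  have hΦm : StronglyMeasurable Φ := by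
    refine StronglyMeasurable.integral_prod_right (f := fun s c : Fin n → ℝ =>
      Complex.exp (2 * Real.pi * ∑ a, s a * (δ + Complex.I * (l a - c a))) * H (ofRealVec c))
      (Continuous.stronglyMeasurable ?_)
    refine Continuous.mul ?_ (hHc.comp continuous_snd)
    fun_prop
  have hΦi : Integrable Φ := hbi.mono' hΦm.aestronglyMeasurable (Eventually.of_forall hΦb)
  -- Shifting the contour to `Im = -δ` removes `δ` from the exponent. Then `Φ` is a Fourier
  -- transform of `H` on the shifted plane, and inversion gives the value at `l - iδ`.
  have hinv : ∫ s, Φ s = H fun a => l a - δ * Complex.I := by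
    set h : (Fin n → ℝ) → ℂ := fun c => H fun a => c a + ((-δ : ℝ) : ℂ) * Complex.I with hh
    have hmem : ∀ c : Fin n → ℝ, (fun a => (c a : ℂ) + ((-δ : ℝ) : ℂ) * Complex.I) ∈ strip n η :=
      fun c k => by simpa [abs_of_pos hδ] using hδη
    have hhc : Continuous h := hd.continuousOn.comp_continuous (by fun_prop) hmem
    have hhi : Integrable h := integrable_shift hd hb (fun _ => -δ) fun k => by
      simpa [abs_of_pos hδ] using hδη
    have hΦh : ∀ s, Φ s = ∫ c : Fin n → ℝ,
        Complex.exp (2 * Real.pi * Complex.I * ∑ a, s a * (l a - c a)) * h c := by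
      intro s
      set G : (Fin n → ℂ) → ℂ := fun w => Complex.exp (2 * Real.pi *
        ∑ a, s a * (δ + Complex.I * (l a - w a))) * H w with hG
      have hexp : Differentiable ℂ fun w : Fin n → ℂ => Complex.exp (2 * Real.pi *
        ∑ a, s a * (δ + Complex.I * (l a - w a))) := by fun_prop
      have hGb : ∀ w ∈ strip n η, ‖G w‖ ≤
          (Real.exp (2 * Real.pi * ∑ a, |s a| * (δ + η)) * C) * ((weight (reVec w)) ^ 2)⁻¹ := by
        intro w hw
        rw [hG, norm_mul, mul_assoc (Real.exp _)]
        refine mul_le_mul ?_ (hb w hw) (norm_nonneg _) (Real.exp_pos _).le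
        rw [Complex.norm_exp]
        refine Real.exp_le_exp.2 ?_
        have : (2 * Real.pi * ∑ a, (s a : ℂ) * (δ + Complex.I * (l a - w a))) =
          ((2 * Real.pi : ℝ) : ℂ) * ∑ a, (s a : ℂ) * (δ + Complex.I * (l a - w a)) := by
            push_cast; rfl
        rw [this, Complex.re_ofReal_mul, Complex.re_sum]
        refine mul_le_mul_of_nonneg_left (Finset.sum_le_sum fun a _ => ?_) (by positivity)
        rw [Complex.re_ofReal_mul]
        have h1 := hw a
        refine (le_abs_self _).trans ?_
        rw [abs_mul]
        refine mul_le_mul_of_nonneg_left ?_ (abs_nonneg _)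
        have e : (δ + Complex.I * (l a - w a) : ℂ).re = δ + (w a).im := by simp
        rw [e]
        refine (abs_add_le _ _).trans ?_
        rw [abs_of_pos hδ]
        linarith
      have hGd : DifferentiableOn ℂ G (strip n η) := hexp.differentiableOn.mul hd
      have key := integral_shift hGd hGb (fun _ => -δ) fun k => by
        simpa [abs_of_pos hδ] using hδη
      have e : Φ s = ∫ c : Fin n → ℝ, G (ofRealVec c) := by
        simp only [hG, hΦ, ofRealVec]
      rw [e, ← key]
      refine integral_congr_ae (Eventually.of_forall fun c => ?_)
      simp only [hG, hh]
      congr 2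
      rw [mul_assoc (2 * (Real.pi : ℂ)), Complex.ofReal_sum, Finset.mul_sum (a := Complex.I)]
      congr 1
      refine Finset.sum_congr rfl fun a _ => ?_
      push_cast
      linear_combination (s a * δ : ℂ) * Complex.I_sq
    have := integral_integral_exp_mul hhc hhi l (hΦi.congr (Eventually.of_forall hΦh))
    rw [integral_congr_ae (Eventually.of_forall hΦh), this, hh]
    refine congrArg H (funext fun a => ?_)
    push_cast
    ring
  rw [← hinv, ← integral_const_mul]
  simp only [integral_laplace_eq hδ hHc hHi l]
  -- As `z → ∞` the orthants `s ≤ z` exhaust the space, under the exponential majorant of `Φ`.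
  refine tendsto_integral_filter_of_dominated_convergence
    (fun s => ‖(2 * Real.pi : ℂ) ^ n‖ * (C' * ∏ a, Real.exp (-ε * |s a|)))
    (Eventually.of_forall fun z => ?_) (Eventually.of_forall fun z => Eventually.of_forall fun s => ?_)
    (hbi.const_mul _) (Eventually.of_forall fun s => ?_)
  · exact ((hΦm.const_mul _).indicator
      (MeasurableSet.univ_pi fun _ => measurableSet_Iic)).aestronglyMeasurable
  · refine (norm_indicator_le_norm_self _ _).trans ?_
    rw [norm_mul]
    exact mul_le_mul_of_nonneg_left (hΦb s) (norm_nonneg _)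
  · refine tendsto_const_nhds.congr' ?_
    have : ∀ᶠ z : ℝ in atTop, ∀ a, s a ≤ z := eventually_all.2 fun a => eventually_ge_atTop (s a)
    filter_upwards [this] with z hz
    have hm : s ∈ Set.univ.pi fun _ : Fin n => Set.Iic z := fun a _ => hz a
    rw [Set.indicator_of_mem hm]

end

end RationalRuijsenaars

end

/-! ### Permutation symmetry and the measure without its zeros. -/

noncomputable section

namespace RationalRuijsenaars

open MeasureTheory Filter Topology

theorem integral_comp_perm {n : ℕ} (π : Equiv.Perm (Fin n)) (f : (Fin n → ℝ) → ℂ) :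
    ∫ c : Fin n → ℝ, f (c ∘ π) = ∫ c : Fin n → ℝ, f c := by
  have := (volume_measurePreserving_piCongrLeft (fun _ : Fin n => ℝ) π.symm).integral_comp' f
  rw [← this]
  refine integral_congr_ae (Eventually.of_forall fun c => congrArg f (funext fun k => ?_))
  have h := MeasurableEquiv.piCongrLeft_apply_apply (β := fun _ : Fin n => ℝ) π.symm c (π k)
  simpa using h.symm

/-- The outermost raising kernel is already symmetric in the spectral variables, so no induction is
needed. -/
theorem waveC_comp_perm (g : ℝ) (n : ℕ) (x : Fin n → ℝ) (l : Fin n → ℂ) (π : Equiv.Perm (Fin n)) :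
    waveC g n x (l ∘ π) = waveC g n x l := by
  match n with
  | 0 => rfl
  | 1 => rw [Subsingleton.elim π 1]; rfl
  | m + 2 =>
    simp only [waveC, kernelC, Function.comp_apply]
    congr 2
    ext c
    rw [Equiv.sum_comp π l, Equiv.prod_comp π fun i => ∏ a, KC g (l i - ofRealVec c a)]

theorem diffProd_comp_perm {n : ℕ} (t : Fin n → ℂ) (π : Equiv.Perm (Fin n)) :
    diffProd (t ∘ π) = Equiv.Perm.sign π * diffProd t := by
  have h : ∀ t : Fin n → ℂ, diffProd t = (Matrix.vandermonde (-t)).det := fun t => by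
    rw [Matrix.det_vandermonde, diffProd]
    refine Finset.prod_congr rfl fun i _ => Finset.prod_congr rfl fun j _ => ?_
    simp only [Pi.neg_apply]
    ring
  rw [h, h, ← Matrix.det_permute]
  rfl

/-- The weight function without its zero at the origin. -/
def regWC (g : ℝ) (z : ℂ) : ℂ :=
  (Complex.Gamma (Complex.I * z + 1))⁻¹ * (Complex.Gamma (-(Complex.I * z) + g))⁻¹

/-- The product of the regularized weight functions. -/
def regProd (g : ℝ) {n : ℕ} (c : Fin n → ℂ) : ℂ :=
  ∏ i, ∏ j ∈ ({i}ᶜ : Finset (Fin n)), regWC g (c i - c j)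

theorem WC_eq_mul_regWC (g : ℝ) (z : ℂ) : WC g z = Complex.I * z * regWC g z := by
  rw [WC, regWC]
  by_cases hz : Complex.I * z = 0
  · rw [hz]; simp
  · rw [Complex.Gamma_add_one _ hz, mul_inv]
    linear_combination (-((Complex.Gamma (Complex.I * z))⁻¹ *
      (Complex.Gamma (-(Complex.I * z) + g))⁻¹)) * mul_inv_cancel₀ hz

/-- The zeros of the measure on the diagonals are two Vandermonde products. One is consumed by the
Cauchy determinant; the other makes `resFactor` antisymmetric. -/
theorem offProd_eq_mul_regProd (g : ℝ) {n : ℕ} (c : Fin n → ℂ) :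
    offProd g 0 c = diffProd (fun k => Complex.I * c k) * diffProd (-fun k => Complex.I * c k) *
      regProd g c := by
  have h := Finset.prod_prod_Ioi_mul_eq_prod_prod_off_diag
    (fun j i : Fin n => Complex.I * (c i - c j))
  have e : ∏ i, ∏ j ∈ ({i}ᶜ : Finset (Fin n)), (Complex.I * (c i - c j)) =
      diffProd (fun k => Complex.I * c k) * diffProd (-fun k => Complex.I * c k) := by
    rw [← h, diffProd, diffProd, ← Finset.prod_mul_distrib]
    refine Finset.prod_congr rfl fun i _ => ?_
    rw [← Finset.prod_mul_distrib]
    refine Finset.prod_congr rfl fun j _ => ?_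
    simp only [Pi.neg_apply]
    ring
  rw [← e, offProd, regProd, ← Finset.prod_mul_distrib]
  refine Finset.prod_congr rfl fun i _ => ?_
  rw [← Finset.prod_mul_distrib]
  refine Finset.prod_congr rfl fun j _ => ?_
  rw [Pi.zero_apply, Pi.zero_apply, sub_zero, WC_eq_mul_regWC]

theorem regProd_comp_perm (g : ℝ) {n : ℕ} (c : Fin n → ℂ) (π : Equiv.Perm (Fin n)) :
    regProd g (c ∘ π) = regProd g c := by
  rw [regProd, regProd, ← Equiv.prod_comp π fun i => ∏ j ∈ ({i}ᶜ : Finset (Fin n)),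
    regWC g (c i - c j)]
  refine Finset.prod_congr rfl fun i _ => ?_
  refine Finset.prod_equiv π (fun j => ?_) fun j _ => rfl
  simp

theorem differentiable_regProd (g : ℝ) {n : ℕ} : Differentiable ℂ (regProd g (n := n)) := by
  have h := Complex.differentiable_one_div_Gamma
  have h1 : Differentiable ℂ (regWC g) := by
    unfold regWC
    exact (h.comp (by fun_prop : Differentiable ℂ fun z : ℂ => Complex.I * z + 1)).mul
      (h.comp (by fun_prop : Differentiable ℂ fun z : ℂ => -(Complex.I * z) + g))
  intro c
  refine differentiableAt_prod _ fun i _ => differentiableAt_prod _ fun j _ => ?_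
  exact h1.differentiableAt.comp c (by fun_prop)

theorem exists_regProd_le (g : ℝ) (n : ℕ) (s : ℝ) :
    ∃ C : ℝ, ∃ N : ℕ, 1 ≤ C ∧ ∀ c : Fin n → ℂ, (∀ k, |(c k).im| ≤ s) →
      ‖regProd g c‖ ≤ C * (weight (reVec c)) ^ N *
        Real.exp (2 * Real.pi * pairEnergy (reVec c)) := by
  obtain ⟨C, N, hC, h⟩ := exists_norm_inv_gammaPair_le 1 g (s + s)
  refine ⟨C ^ (n * n), 2 * (N * (n * n)), one_le_pow₀ hC, fun c hc => ?_⟩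
  have := norm_prod_prod_le (fun i => ({i}ᶜ : Finset (Fin n)))
    (fun i j => regWC g (c i - c j)) (reVec c) (reVec c) hC
    (κ := Real.pi) (N := N) fun i j _ => ?_
  · rw [regProd]
    refine this.trans (le_of_eq ?_)
    rw [sum_compl_abs_sub, ← sq (weight _), ← pow_mul]
    ring_nf
  · have := h (c i - c j) ?_
    · simpa [reVec, regWC] using this
    · rw [Complex.sub_im]
      have := abs_sub (c i).im (c j).im
      linarith [hc i, hc j]

theorem exists_diffProd_le (n : ℕ) (s : ℝ) :
    ∃ C : ℝ, ∃ N : ℕ, 0 ≤ C ∧ ∀ c : Fin n → ℂ, (∀ k, |(c k).im| ≤ s) →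
      ‖diffProd fun k => Complex.I * c k‖ ≤ C * (weight (reVec c)) ^ N := by
  refine ⟨(∏ i : Fin n, ∏ _j ∈ Finset.Ioi i, (2 * (1 + |s|))),
    ∑ i : Fin n, ∑ _j ∈ Finset.Ioi i, 1, by positivity, fun c hc => ?_⟩
  have hw := one_le_weight (reVec c)
  have h1 : ∀ k, ‖c k‖ ≤ (1 + |s|) * weight (reVec c) := fun k => by
    have h2 := Complex.norm_le_abs_re_add_abs_im (c k)
    have h3 : 1 + |(c k).re| ≤ weight (reVec c) := one_add_abs_le_weight (reVec c) k
    have h4 := (hc k).trans (le_abs_self s)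
    nlinarith [abs_nonneg s]
  rw [diffProd, norm_prod, ← Finset.prod_pow_eq_pow_sum, ← Finset.prod_mul_distrib]
  refine Finset.prod_le_prod (fun _ _ => norm_nonneg _) fun i _ => ?_
  rw [norm_prod, ← Finset.prod_pow_eq_pow_sum, ← Finset.prod_mul_distrib]
  refine Finset.prod_le_prod (fun _ _ => norm_nonneg _) fun j _ => ?_
  refine (norm_sub_le _ _).trans ?_
  rw [norm_mul, norm_mul, Complex.norm_I, one_mul, one_mul, pow_one]
  linarith [h1 i, h1 j]

end RationalRuijsenaars

end

/-! ### Splitting the shifted Baxter integrand into simple fractions. -/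

noncomputable section

namespace RationalRuijsenaars

open MeasureTheory Filter Topology

/-- The integrand of the Baxter operator after removal of its exponential factor and of its
poles. -/
def resFactor (g δ : ℝ) {n : ℕ} (l : Fin n → ℂ) (F : (Fin n → ℂ) → ℂ) (w : Fin n → ℂ) : ℂ :=
  (∏ k, ∏ a, gammaPair (δ + 1) (g - δ) (l k - w a)) * diffProd (fun k => Complex.I * w k) *
    regProd g w * F w

section

variable {g δ η : ℝ} {n : ℕ} {F : (Fin n → ℂ) → ℂ}

/-- Raising the first parameter from `δ` to `δ + 1` removes the nearest pole, so the function is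
holomorphic across `Im w = -δ`, where the residue is taken. -/
theorem differentiableOn_resFactor (hg : 1 < g) (hδ : 0 < δ) (hδη : δ < η) (hη : η ≤ 1 / 2)
    (hd : DifferentiableOn ℂ F (strip n (g / 2))) (l : Fin n → ℝ) :
    DifferentiableOn ℂ (resFactor g δ (ofRealVec l) F) (strip n η) := by
  intro w hw
  refine DifferentiableAt.differentiableWithinAt ?_
  have hmem : w ∈ strip n (g / 2) := strip_mono (by linarith) hw
  refine DifferentiableAt.mul (DifferentiableAt.mul (DifferentiableAt.mul ?_ ?_)
    (differentiable_regProd g).differentiableAt)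
    ((hd w hmem).differentiableAt ((isOpen_strip _ _).mem_nhds hmem))
  · refine differentiableAt_prod _ fun k _ => differentiableAt_prod _ fun a _ => ?_
    have h1 := hw a
    rw [abs_lt] at h1
    refine DifferentiableAt.comp w (g := gammaPair (δ + 1) (g - δ))
      (f := fun w : Fin n → ℂ => ofRealVec l k - w a)
      (differentiableAt_gammaPair ?_ ?_) (by fun_prop) <;> simp [ofRealVec] <;> linarith
  · unfold diffProd
    exact differentiableAt_prod _ fun k _ => differentiableAt_prod _ fun a _ => by fun_prop

theorem exists_resFactor_le (hg : 1 < g) (hδ : 0 < δ) (hδη : δ < η) (hη : η ≤ 1 / 2)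
    (hb : HasWaveBound g F) (l : Fin n → ℝ) :
    ∃ C : ℝ, ∀ w ∈ strip n η, ‖resFactor g δ (ofRealVec l) F w‖ ≤
      C * ((weight (reVec w)) ^ 2)⁻¹ := by
  obtain ⟨C1, N1, hC1, h1⟩ := exists_prod_gammaPair_le (by linarith : η < δ + 1)
    (by linarith : η < g - δ) n n
  obtain ⟨C2, N2, hC2, h2⟩ := exists_regProd_le g n η
  obtain ⟨C3, N3, hC3, h3⟩ := hb η (by linarith)
  obtain ⟨C5, N5, hC5, h5⟩ := exists_diffProd_le n η
  obtain ⟨C4, N4, hC4, h4⟩ := exists_baxter_decay le_rfl zero_lt_one n (N1 + N5 + N2 + N3) 2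
  refine ⟨C1 * C5 * C2 * C3 * weight l ^ N1 * (C4 * weight l ^ N4), fun w hw => ?_⟩
  have hwl := weight_pos l
  have hwc := weight_pos (reVec w)
  have k1 := h1 (ofRealVec l) w fun i a => by simpa [ofRealVec] using (hw a).le
  have k4 := h4 l (reVec w)
  rw [reVec_ofRealVec] at k1
  rw [resFactor, norm_mul, norm_mul, norm_mul]
  calc _ ≤ (C1 * (weight l * weight (reVec w)) ^ N1 *
          Real.exp (-Real.pi * crossEnergy l (reVec w))) * (C5 * weight (reVec w) ^ N5) *
        (C2 * weight (reVec w) ^ N2 * Real.exp (2 * Real.pi * pairEnergy (reVec w))) *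
        (C3 * weight (reVec w) ^ N3 * Real.exp (-Real.pi * pairEnergy (reVec w))) := by
        gcongr
        · exact h5 w fun k => (hw k).le
        · exact h2 w fun k => (hw k).le
        · exact h3 w fun k => (hw k).le
    _ = C1 * C5 * C2 * C3 * weight l ^ N1 *
        (weight (reVec w) ^ (N1 + N5 + N2 + N3) *
        (Real.exp (-Real.pi * crossEnergy l (reVec w)) *
          Real.exp (2 * Real.pi * pairEnergy (reVec w)) *
          Real.exp (-Real.pi * pairEnergy (reVec w)) *
          Real.exp (Real.pi * 0 * |(∑ i, l i) - ∑ a, reVec w a|))) := by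
        rw [mul_pow, pow_add, pow_add, pow_add, mul_zero, zero_mul, Real.exp_zero]; ring
    _ ≤ C1 * C5 * C2 * C3 * weight l ^ N1 *
        (C4 * weight l ^ N4 * (weight (reVec w) ^ 2)⁻¹) := by
        exact mul_le_mul_of_nonneg_left k4 (by positivity)
    _ = _ := by ring

theorem resFactor_comp_perm (hF : ∀ (c : Fin n → ℂ) (π : Equiv.Perm (Fin n)), F (c ∘ π) = F c)
    (l w : Fin n → ℂ) (π : Equiv.Perm (Fin n)) :
    resFactor g δ l F (w ∘ π) = Equiv.Perm.sign π * resFactor g δ l F w := by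
  have h1 : (fun k => Complex.I * (w ∘ π) k) = (fun k => Complex.I * w k) ∘ π := rfl
  rw [resFactor, resFactor, hF, regProd_comp_perm, h1, diffProd_comp_perm]
  have h2 : ∏ k, ∏ a, gammaPair (δ + 1) (g - δ) (l k - (w ∘ π) a) =
      ∏ k, ∏ a, gammaPair (δ + 1) (g - δ) (l k - w a) :=
    Finset.prod_congr rfl fun k _ =>
      Equiv.prod_comp π fun a => gammaPair (δ + 1) (g - δ) (l k - w a)
  rw [h2]
  ring

/-- At `w = l - iδ` the diagonal factors give `Γ(1)Γ(g)`, and the off-diagonal Gamma factors are the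
inverses of those in `regProd`. -/
theorem resFactor_sub (hg : 0 < g) (l : Fin n → ℝ) (F : (Fin n → ℂ) → ℂ) :
    resFactor g δ (ofRealVec l) F (fun a => l a - δ * Complex.I) =
      diffProd (fun k => Complex.I * ofRealVec l k) * Complex.Gamma g ^ n *
        F (fun a => l a - δ * Complex.I) := by
  have h1 : diffProd (fun k => Complex.I * ((l k : ℂ) - δ * Complex.I)) =
      diffProd (fun k => Complex.I * ofRealVec l k) := by
    refine Finset.prod_congr rfl fun i _ => Finset.prod_congr rfl fun j _ => ?_
    simp only [ofRealVec]; ring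
  have h2 : ∀ k a, gammaPair (δ + 1) (g - δ) (ofRealVec l k - (l a - δ * Complex.I)) =
      Complex.Gamma (Complex.I * (l k - l a) + 1) * Complex.Gamma (-(Complex.I * (l k - l a)) + g) :=
      fun k a => by
    rw [gammaPair, ofRealVec]
    push_cast
    congr 2
    · linear_combination (δ : ℂ) * Complex.I_sq
    · linear_combination (-δ : ℂ) * Complex.I_sq
  have h3 : ∏ k, ∏ a, gammaPair (δ + 1) (g - δ) (ofRealVec l k - (l a - δ * Complex.I)) *
      1 = Complex.Gamma g ^ n * ∏ k : Fin n, ∏ a ∈ ({k}ᶜ : Finset (Fin n)),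
        (regWC g (l k - l a))⁻¹ := by
    have : Complex.Gamma g ^ n = ∏ _k : Fin n, Complex.Gamma g := by simp
    rw [this, ← Finset.prod_mul_distrib]
    refine Finset.prod_congr rfl fun k _ => ?_
    simp only [h2, mul_one]
    rw [← Finset.prod_mul_prod_compl {k}, Finset.prod_singleton]
    congr 1
    · simp
    · refine Finset.prod_congr rfl fun a _ => ?_
      rw [regWC, mul_inv, inv_inv, inv_inv]
  have h4 : regProd g (fun a => (l a : ℂ) - δ * Complex.I) = ∏ k : Fin n,
      ∏ a ∈ ({k}ᶜ : Finset (Fin n)), regWC g (l k - l a) := by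
    simp only [regProd, sub_sub_sub_cancel_right]
  have h5 : ∀ k a, regWC g ((l k : ℂ) - l a) ≠ 0 := fun k a => by
    rw [regWC]
    refine mul_ne_zero (inv_ne_zero (Complex.Gamma_ne_zero_of_re_pos ?_))
      (inv_ne_zero (Complex.Gamma_ne_zero_of_re_pos ?_)) <;> simp [hg]
  simp only [mul_one] at h3
  rw [resFactor, h1, h3, h4]
  have h6 : (∏ k : Fin n, ∏ a ∈ ({k}ᶜ : Finset (Fin n)), (regWC g ((l k : ℂ) - l a))⁻¹) *
      ∏ k : Fin n, ∏ a ∈ ({k}ᶜ : Finset (Fin n)), regWC g (l k - l a) = 1 := by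
    rw [← Finset.prod_mul_distrib]
    refine Finset.prod_eq_one fun k _ => ?_
    rw [← Finset.prod_mul_distrib]
    exact Finset.prod_eq_one fun a _ => inv_mul_cancel₀ (h5 k a)
  linear_combination (Complex.Gamma g ^ n * diffProd (fun k => Complex.I * ofRealVec l k) *
    F (fun a => l a - δ * Complex.I)) * h6

theorem gammaPair_eq_div {τ : ℂ} (h : δ + Complex.I * τ ≠ 0) :
    gammaPair δ (g - δ) τ = gammaPair (δ + 1) (g - δ) τ * (δ + Complex.I * τ)⁻¹ := by
  rw [gammaPair, gammaPair]
  have : Complex.I * τ + ((δ + 1 : ℝ) : ℂ) = (Complex.I * τ + δ) + 1 := by push_cast; ring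
  rw [this, Complex.Gamma_add_one _ (by rwa [add_comm]), add_comm (Complex.I * τ)]
  field_simp

/-- Expansion of the shifted integrand of the Baxter operator into simple fractions. -/
theorem kernelC_shift_eq_sum (hδ : 0 < δ) (l c : Fin n → ℝ) (z : ℂ) :
    diffProd (fun k => Complex.I * ofRealVec l k) *
      (kernelC g 0 (ofRealVec l) (fun a => c a + ((-(g / 2 - δ) : ℝ) : ℂ) * Complex.I) z *
        F (ofRealVec c)) =
    Complex.exp (-(Real.pi * g * n * z)) * ∑ π : Equiv.Perm (Fin n), Equiv.Perm.sign π *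
      ((∏ a, Complex.exp (2 * Real.pi * z * (δ + Complex.I * (l (π a) - c a))) /
        (δ + Complex.I * (l (π a) - c a))) * resFactor g δ (ofRealVec l) F (ofRealVec c)) := by
  have hne : ∀ k a, (δ + Complex.I * ((l k : ℂ) - c a)) ≠ 0 := fun k a h => by
    have := congrArg Complex.re h
    simp at this
    linarith
  have hexp : ∀ π : Equiv.Perm (Fin n), ∏ a, Complex.exp (2 * Real.pi * z *
      (δ + Complex.I * ((l (π a) : ℂ) - c a))) = Complex.exp (2 * Real.pi * z *
        (n * δ + Complex.I * ((∑ k, (l k : ℂ)) - ∑ a, (c a : ℂ)))) := by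
    intro π
    rw [← Complex.exp_sum, ← Equiv.sum_comp π fun k => (l k : ℂ), ← Finset.sum_sub_distrib,
      Finset.mul_sum, ← Finset.mul_sum, Finset.sum_add_distrib]
    simp
  -- The inverses of all differences, times two Vandermonde products, form a Cauchy determinant. Its
  -- Leibniz expansion yields the sum over permutations, one simple fraction for each variable.
  have hdet := det_cauchy (fun k => (δ : ℂ) + Complex.I * ofRealVec l k)
    (fun a => Complex.I * ofRealVec c a) fun k a => by
      have := hne k a
      rw [mul_sub, ← add_sub_assoc] at this
      exact this
  rw [Matrix.det_apply'] at hdet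
  have hD : diffProd (fun k => (δ : ℂ) + Complex.I * ofRealVec l k) =
      diffProd (fun k => Complex.I * ofRealVec l k) := by
    refine Finset.prod_congr rfl fun i _ => Finset.prod_congr rfl fun j _ => ?_
    ring
  have hK : ∏ k, ∏ a, KC g (ofRealVec l k - (c a + ((-(g / 2 - δ) : ℝ) : ℂ) * Complex.I)) =
      (∏ k, ∏ a, gammaPair (δ + 1) (g - δ) (ofRealVec l k - ofRealVec c a)) *
      ∏ k, ∏ a, ((δ + Complex.I * ofRealVec l k) - Complex.I * ofRealVec c a)⁻¹ := by
    rw [← Finset.prod_mul_distrib]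
    refine Finset.prod_congr rfl fun k _ => ?_
    rw [← Finset.prod_mul_distrib]
    refine Finset.prod_congr rfl fun a _ => ?_
    have e1 := gammaPair_eq_div (g := g) (hne k a)
    have e2 : (δ + Complex.I * ofRealVec l k) - Complex.I * ofRealVec c a =
      δ + Complex.I * ((l k : ℂ) - c a) := by simp only [ofRealVec]; ring
    rw [e2]
    simp only [ofRealVec]
    rw [← e1, KC_eq_gammaPair, gammaPair, gammaPair]
    push_cast
    congr 2
    · linear_combination ((g : ℂ) / 2 - δ) * Complex.I_sq
    · linear_combination (-((g : ℂ) / 2 - δ)) * Complex.I_sq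
  have hO : offProd g 0 (fun a => (c a : ℂ) + ((-(g / 2 - δ) : ℝ) : ℂ) * Complex.I) =
      diffProd (fun k => Complex.I * ofRealVec c k) *
        diffProd (-fun k => Complex.I * ofRealVec c k) * regProd g (ofRealVec c) := by
    rw [← offProd_eq_mul_regProd]
    simp only [offProd, add_sub_add_right_eq_sub, ofRealVec]
  have hE : Complex.exp (2 * Real.pi * Complex.I * z * ((∑ k, ofRealVec l k) -
      ∑ a, ((c a : ℂ) + ((-(g / 2 - δ) : ℝ) : ℂ) * Complex.I))) =
      Complex.exp (-(Real.pi * g * n * z)) * Complex.exp (2 * Real.pi * z *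
        (n * δ + Complex.I * ((∑ k, (l k : ℂ)) - ∑ a, (c a : ℂ)))) := by
    rw [← Complex.exp_add, Finset.sum_add_distrib]
    simp only [ofRealVec, Finset.sum_const, Finset.card_univ, Fintype.card_fin, nsmul_eq_mul]
    congr 1
    push_cast
    linear_combination (2 * Real.pi * z * n * ((g : ℂ) / 2 - δ)) * Complex.I_sq
  have hR : ∀ π : Equiv.Perm (Fin n), (Equiv.Perm.sign π : ℂ) *
      ((∏ a, Complex.exp (2 * Real.pi * z * (δ + Complex.I * (l (π a) - c a))) /
        (δ + Complex.I * (l (π a) - c a))) * resFactor g δ (ofRealVec l) F (ofRealVec c)) =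
      Complex.exp (2 * Real.pi * z *
        (n * δ + Complex.I * ((∑ k, (l k : ℂ)) - ∑ a, (c a : ℂ)))) *
        resFactor g δ (ofRealVec l) F (ofRealVec c) * ((Equiv.Perm.sign π : ℂ) *
        ∏ a, (Matrix.of fun k a => (δ + Complex.I * ofRealVec l k -
          Complex.I * ofRealVec c a)⁻¹) (π a) a) := by
    intro π
    rw [Finset.prod_div_distrib, hexp, div_eq_mul_inv, ← Finset.prod_inv_distrib]
    have : ∀ a, (Matrix.of fun k a => ((δ : ℂ) + Complex.I * ofRealVec l k -
          Complex.I * ofRealVec c a)⁻¹) (π a) a = (δ + Complex.I * ((l (π a) : ℂ) - c a))⁻¹ :=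
        fun a => by
      simp only [Matrix.of_apply, ofRealVec]
      congr 1; ring
    simp only [this]
    ring
  rw [Finset.sum_congr rfl fun π _ => hR π, ← Finset.mul_sum, hdet, hD, kernelC, hE, hK, hO,
    resFactor]
  ring

end

end RationalRuijsenaars

end

/-! ### Asymptotics in the spectral parameter. -/

noncomputable section

namespace RationalRuijsenaars

open MeasureTheory Filter Topology

theorem exp_mul_kernelK (g y : ℝ) :
    Complex.exp (Real.pi * g * y) * kernelK g y =
      (((1 + Real.exp (-(2 * Real.pi * y))) ^ (-g) : ℝ) : ℂ) := by
  have h1 : 2 * Real.cosh (Real.pi * y) =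
      Real.exp (Real.pi * y) * (1 + Real.exp (-(2 * Real.pi * y))) := by
    rw [Real.cosh_eq, mul_add, ← Real.exp_add, mul_one]
    ring_nf
  have h2 : kernelK g y = (((2 * Real.cosh (Real.pi * y)) ^ (-g) : ℝ) : ℂ) := by
    rw [Complex.ofReal_cpow (by positivity), kernelK]
    push_cast
    rfl
  rw [h2, h1, Real.mul_rpow (Real.exp_pos _).le (by positivity), ← Real.exp_mul]
  have h3 : Complex.exp (Real.pi * g * y) = ((Real.exp (Real.pi * g * y) : ℝ) : ℂ) := by
    push_cast; rfl
  rw [h3, ← Complex.ofReal_mul, ← mul_assoc, ← Real.exp_add]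
  ring_nf
  simp

theorem tendsto_exp_mul_prod_kernelK (g : ℝ) {n : ℕ} (x : Fin n → ℝ) :
    Tendsto (fun z : ℝ => Complex.exp (Real.pi * g * n * z) * ∏ j, kernelK g ((z : ℂ) - x j)) atTop
      (𝓝 (Complex.exp (Real.pi * g * (∑ j, x j : ℝ)))) := by
  have h1 : ∀ z : ℝ, Complex.exp (Real.pi * g * n * z) * ∏ j, kernelK g ((z : ℂ) - x j) =
      Complex.exp (Real.pi * g * (∑ j, x j : ℝ)) * ∏ j,
        (((1 + Real.exp (-(2 * Real.pi * (z - x j)))) ^ (-g) : ℝ) : ℂ) := by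
    intro z
    simp only [← exp_mul_kernelK, Finset.prod_mul_distrib]
    rw [← mul_assoc, ← Complex.exp_sum, ← Complex.exp_add, ← Finset.mul_sum]
    push_cast
    congr 2
    rw [Finset.sum_sub_distrib]
    simp
    ring
  simp only [h1]
  have h2 : ∀ j, Tendsto (fun z : ℝ =>
      (((1 + Real.exp (-(2 * Real.pi * (z - x j)))) ^ (-g) : ℝ) : ℂ)) atTop (𝓝 1) := by
    intro j
    have e1 : Tendsto (fun z : ℝ => 2 * Real.pi * (z - x j)) atTop atTop :=
      (tendsto_atTop_add_const_right _ (-(x j)) tendsto_id).const_mul_atTop (by positivity)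
    have e2 : Tendsto (fun z : ℝ => 1 + Real.exp (-(2 * Real.pi * (z - x j)))) atTop (𝓝 (1 + 0)) :=
      (Real.tendsto_exp_neg_atTop_nhds_zero.comp e1).const_add 1
    rw [add_zero] at e2
    have e3 := e2.rpow_const (p := -g) (Or.inl one_ne_zero)
    rw [Real.one_rpow] at e3
    exact_mod_cast (Complex.continuous_ofReal.tendsto 1).comp e3
  have h3 := (tendsto_finsetProd Finset.univ fun j _ => h2 j).const_mul
    (Complex.exp (Real.pi * g * (∑ j, x j : ℝ)))
  simpa using h3

section

variable {g δ : ℝ} {n : ℕ} {F : (Fin n → ℂ) → ℂ}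

/-- Moves every variable down to distance `δ` from the edge of the strip, where `K̂` has its nearest
poles. -/
theorem integral_baxter_shift (hδ : 0 < δ) (hδg : δ < g / 2)
    (hd : DifferentiableOn ℂ F (strip n (g / 2))) (hb : HasWaveBound g F) (l : Fin n → ℝ) (z : ℝ) :
    ∫ c : Fin n → ℝ, kernelC g 0 (ofRealVec l) (ofRealVec c) z * F (ofRealVec c) =
    ∫ c : Fin n → ℝ, kernelC g 0 (ofRealVec l)
      (fun a => c a + ((-(g / 2 - δ) : ℝ) : ℂ) * Complex.I) z *
        F (fun a => c a + ((-(g / 2 - δ) : ℝ) : ℂ) * Complex.I) := by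
  have hs : g / 2 - δ / 2 < g / 2 := by linarith
  obtain ⟨C, h⟩ := exists_linear_baxter_bound hb 0 (by simp) (by linarith : 0 ≤ g / 2 - δ / 2) hs
    le_rfl zero_lt_one |z| 1 0 l
  refine (integral_shift (s := g / 2 - δ / 2) (C := C) (f := fun c =>
    kernelC g 0 (ofRealVec l) c z * F c) ?_ ?_ (fun _ => -(g / 2 - δ)) ?_).symm
  · intro w hw
    have hmem : w ∈ strip n (g / 2) := strip_mono hs.le hw
    have k1 : DifferentiableAt ℂ (fun w : Fin n → ℂ => kernelC g 0 (ofRealVec l) w z) w :=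
      differentiableAt_kernelC (E := Fin n → ℂ) (g := g) 0 (e := w)
        (l := fun _ => ofRealVec l) (c := fun w => w) (z := fun _ => (z : ℂ))
        (by fun_prop) (by fun_prop) (by fun_prop) fun i a => by
          simpa [ofRealVec] using hmem a
    exact (k1.mul ((hd w hmem).differentiableAt
      ((isOpen_strip _ _).mem_nhds hmem))).differentiableWithinAt
  · intro w hw
    have := h w w z (fun a => (hw a).le) (fun a => (hw a).le) rfl (by simp) (by simp)
    simpa using this
  · intro k
    rw [abs_neg, abs_of_pos (by linarith)]
    linarith

/-- Renaming the variables by `π` produces a second sign from the antisymmetric `resFactor`, so all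
`n!` terms are equal. -/
theorem integral_sum_perm (hg : 1 < g) (hδ : 0 < δ) (hδη : δ < 1 / 2)
    (hF : ∀ (c : Fin n → ℂ) (π : Equiv.Perm (Fin n)), F (c ∘ π) = F c)
    (hd : DifferentiableOn ℂ F (strip n (g / 2))) (hb : HasWaveBound g F) (l : Fin n → ℝ) (z : ℝ) :
    ∫ c : Fin n → ℝ, ∑ π : Equiv.Perm (Fin n), (Equiv.Perm.sign π : ℂ) *
      ((∏ a, Complex.exp (2 * Real.pi * z * (δ + Complex.I * (l (π a) - c a))) /
        (δ + Complex.I * (l (π a) - c a))) * resFactor g δ (ofRealVec l) F (ofRealVec c)) =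
    n.factorial * ∫ c : Fin n → ℝ,
      (∏ a, Complex.exp (2 * Real.pi * z * (δ + Complex.I * (l a - c a))) /
        (δ + Complex.I * (l a - c a))) * resFactor g δ (ofRealVec l) F (ofRealVec c) := by
  set H := resFactor g δ (ofRealVec l) F with hH
  obtain ⟨C, hC⟩ := exists_resFactor_le hg hδ hδη le_rfl hb l
  have hHd := differentiableOn_resFactor hg hδ hδη le_rfl hd l
  have hHi : Integrable fun c : Fin n → ℝ => H (ofRealVec c) := by
    have := integrable_shift hHd hC 0 (fun k => by simp)
    exact this.congr (Eventually.of_forall fun c =>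
      congrArg H (funext fun k => by simp [ofRealVec]))
  have hre : ∀ a b : ℝ, ((δ : ℂ) + Complex.I * ((a : ℂ) - b)).re = δ := fun a b => by simp
  have hne : ∀ a b : ℝ, ((δ : ℂ) + Complex.I * ((a : ℂ) - b)) ≠ 0 := fun a b h => by
    have := hre a b
    rw [h, Complex.zero_re] at this
    linarith
  have hsq : ∀ π : Equiv.Perm (Fin n), Integrable fun c : Fin n → ℝ =>
      (∏ a, Complex.exp (2 * Real.pi * z * (δ + Complex.I * (l (π a) - c a))) /
        (δ + Complex.I * (l (π a) - c a))) * H (ofRealVec c) := by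
    intro π
    refine hHi.bdd_mul (c := ∏ _a : Fin n, Real.exp (2 * Real.pi * z * δ) / δ) ?_
      (Eventually.of_forall fun c => ?_)
    · refine Continuous.aestronglyMeasurable (continuous_finsetProd _ fun a _ => ?_)
      exact Continuous.div (by fun_prop) (by fun_prop) fun c => hne _ _
    · rw [norm_prod]
      refine Finset.prod_le_prod (fun _ _ => norm_nonneg _) fun a _ => ?_
      rw [norm_div, Complex.norm_exp]
      have e : (2 * Real.pi * z * (δ + Complex.I * (l (π a) - c a)) : ℂ).re =
          2 * Real.pi * z * δ := by
        have : (2 * Real.pi * z * (δ + Complex.I * (l (π a) - c a)) : ℂ) =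
          ((2 * Real.pi * z : ℝ) : ℂ) * (δ + Complex.I * (l (π a) - c a)) := by push_cast; ring
        rw [this, Complex.re_ofReal_mul, hre]
      rw [e]
      refine div_le_div_of_nonneg_left (Real.exp_pos _).le hδ ?_
      have := Complex.re_le_norm ((δ : ℂ) + Complex.I * ((l (π a) : ℂ) - c a))
      rwa [hre] at this
  rw [integral_finsetSum _ fun π _ => (hsq π).const_mul _]
  have hterm : ∀ π : Equiv.Perm (Fin n), ∫ c : Fin n → ℝ, (Equiv.Perm.sign π : ℂ) *
      ((∏ a, Complex.exp (2 * Real.pi * z * (δ + Complex.I * (l (π a) - c a))) /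
        (δ + Complex.I * (l (π a) - c a))) * H (ofRealVec c)) = ∫ c : Fin n → ℝ,
      (∏ a, Complex.exp (2 * Real.pi * z * (δ + Complex.I * (l a - c a))) /
        (δ + Complex.I * (l a - c a))) * H (ofRealVec c) := by
    intro π
    rw [← integral_comp_perm π]
    refine integral_congr_ae (Eventually.of_forall fun c => ?_)
    have e1 : ofRealVec (c ∘ π) = ofRealVec c ∘ π := rfl
    have e2 : ∏ a, Complex.exp (2 * Real.pi * z * (δ + Complex.I * (l (π a) - (c ∘ π) a))) /
        (δ + Complex.I * (l (π a) - (c ∘ π) a)) =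
        ∏ a, Complex.exp (2 * Real.pi * z * (δ + Complex.I * (l a - c a))) /
        (δ + Complex.I * (l a - c a)) :=
      Equiv.prod_comp π fun a => Complex.exp (2 * Real.pi * z * (δ + Complex.I * (l a - c a))) /
        (δ + Complex.I * (l a - c a))
    have e3 : (Equiv.Perm.sign π : ℂ) * Equiv.Perm.sign π = 1 := by
      rcases Int.units_eq_one_or (Equiv.Perm.sign π) with h | h <;> simp [h]
    beta_reduce
    rw [e1, e2, hH, resFactor_comp_perm hF]
    linear_combination ((∏ a, Complex.exp (2 * Real.pi * z * (δ + Complex.I * (l a - c a))) /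
        (δ + Complex.I * (l a - c a))) * resFactor g δ (ofRealVec l) F (ofRealVec c)) * e3
  rw [Finset.sum_congr rfl fun π _ => hterm π, Finset.sum_const, Finset.card_univ,
    Fintype.card_perm, Fintype.card_fin, nsmul_eq_mul]

end

theorem tendsto_exp_mul_baxter {g : ℝ} (hg : 1 < g) {n : ℕ} (hn : 1 ≤ n) (x : Fin n → ℝ)
    {l : Fin n → ℝ} (hl : Function.Injective l) :
    Tendsto (fun z : ℝ => Complex.exp (Real.pi * g * n * z) * ∫ c : Fin n → ℝ,
      kernelC g 0 (ofRealVec l) (ofRealVec c) z * waveC g n x (ofRealVec c)) atTop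
      (𝓝 (Complex.exp (Real.pi * g * (∑ j, x j : ℝ)) * (n.factorial *
        (2 * Real.pi * Complex.Gamma g) ^ n * waveC g n x (ofRealVec l)))) := by
  have hg0 : 0 < g := by linarith
  obtain ⟨hd, hb, -⟩ := waveC_properties hg0 n hn x
  set F := waveC g n x with hF
  -- Any `δ` strictly between `0` and `1/2` serves; it drops out of the limit.
  set δ : ℝ := 1 / 4 with hδ
  have hδ0 : 0 < δ := by norm_num [hδ]
  have hδ2 : δ < 1 / 2 := by norm_num [hδ]
  set t := g / 2 - δ with ht
  set D := diffProd (fun k => Complex.I * ofRealVec l k) with hD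
  have hD0 : D ≠ 0 := diffProd_ne_zero fun i j h =>
    ofRealVec_injective hl (mul_left_cancel₀ Complex.I_ne_zero h)
  obtain ⟨C, hC⟩ := exists_resFactor_le hg hδ0 hδ2 le_rfl hb l
  have hlim := tendsto_integral_laplace hδ0 hδ2
    (differentiableOn_resFactor hg hδ0 hδ2 le_rfl hd l) hC l
  rw [resFactor_sub hg0] at hlim
  -- Translation covariance brings the wave function on the shifted contour back to real arguments
  -- at the cost of a constant.
  have hadd : ∀ (c : Fin n → ℝ) (s : ℝ), |s| < g / 2 → F (fun a => c a + (s : ℂ) * Complex.I) =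
      Complex.exp (-(2 * Real.pi * s * (∑ j, x j : ℝ))) * F (ofRealVec c) := by
    intro c s hs
    have h1 := waveC_add hg0 hn x (l := ofRealVec c) (t := (s : ℂ) * Complex.I)
      (ofRealVec_mem_strip (by linarith) c) (fun k => by simpa [ofRealVec] using hs)
    refine h1.trans ?_
    congr 2
    linear_combination (2 * Real.pi * s * (∑ j, x j : ℝ) : ℂ) * Complex.I_sq
  have hf : ∀ z : ℝ, Complex.exp (Real.pi * g * n * z) * ∫ c : Fin n → ℝ,
      kernelC g 0 (ofRealVec l) (ofRealVec c) z * F (ofRealVec c) =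
      D⁻¹ * Complex.exp (2 * Real.pi * t * (∑ j, x j : ℝ)) * (n.factorial * ∫ c : Fin n → ℝ,
      (∏ a, Complex.exp (2 * Real.pi * z * (δ + Complex.I * (l a - c a))) /
        (δ + Complex.I * (l a - c a))) * resFactor g δ (ofRealVec l) F (ofRealVec c)) := by
    intro z
    rw [← integral_sum_perm hg hδ0 hδ2 (fun c π => waveC_comp_perm g n x c π) hd hb l z,
      integral_baxter_shift hδ0 (by linarith) hd hb l z, ← integral_const_mul,
      ← integral_const_mul]
    refine integral_congr_ae (Eventually.of_forall fun c => ?_)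
    beta_reduce
    have h1 := kernelC_shift_eq_sum (g := g) (F := F) hδ0 l c z
    rw [← ht, ← hD] at h1
    have h2 : Complex.exp (Real.pi * g * n * z) * Complex.exp (-(Real.pi * g * n * z)) = 1 := by
      rw [← Complex.exp_add]; simp
    rw [← ht, hadd c (-t) (by rw [abs_neg, abs_of_pos (by linarith)]; linarith)]
    have h3 : Complex.exp (-(2 * Real.pi * ((-t : ℝ) : ℂ) * (∑ j, x j : ℝ))) =
        Complex.exp (2 * Real.pi * t * (∑ j, x j : ℝ)) := by
      congr 1; push_cast; ring
    rw [h3]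
    set S := ∑ π : Equiv.Perm (Fin n), (Equiv.Perm.sign π : ℂ) *
      ((∏ a, Complex.exp (2 * Real.pi * z * (δ + Complex.I * (l (π a) - c a))) /
        (δ + Complex.I * (l (π a) - c a))) * resFactor g δ (ofRealVec l) F (ofRealVec c))
    refine mul_left_cancel₀ hD0 ?_
    have h4 := mul_inv_cancel₀ hD0
    linear_combination (Complex.exp (Real.pi * g * n * z) *
      Complex.exp (2 * Real.pi * t * (∑ j, x j : ℝ))) * h1 +
      (Complex.exp (2 * Real.pi * t * (∑ j, x j : ℝ)) * S) * h2 -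
      (Complex.exp (2 * Real.pi * t * (∑ j, x j : ℝ)) * S) * h4
  simp only [hf]
  have hlim2 := (hlim.const_mul (n.factorial : ℂ)).const_mul
    (D⁻¹ * Complex.exp (2 * Real.pi * t * (∑ j, x j : ℝ)))
  refine (congrArg (fun L => Tendsto _ atTop (𝓝 L)) ?_).mp hlim2
  have h5 : F (fun a => (l a : ℂ) - δ * Complex.I) =
      Complex.exp (2 * Real.pi * δ * (∑ j, x j : ℝ)) * F (ofRealVec l) := by
    have := hadd l (-δ) (by rw [abs_neg, abs_of_pos hδ0]; linarith)
    rw [show (fun a => (l a : ℂ) - δ * Complex.I) = fun a => (l a : ℂ) + ((-δ : ℝ) : ℂ) * Complex.I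
      from funext fun a => by push_cast; ring, this]
    congr 2; push_cast; ring
  -- Since `t + δ = g/2`, the two constants combine to the one in the asymptotics of the product of
  -- `kernelK`.
  have h6 : Complex.exp (2 * Real.pi * t * (∑ j, x j : ℝ)) *
      Complex.exp (2 * Real.pi * δ * (∑ j, x j : ℝ)) =
      Complex.exp (Real.pi * g * (∑ j, x j : ℝ)) := by
    rw [← Complex.exp_add]
    congr 1
    rw [ht]
    push_cast; ring
  have h4 := mul_inv_cancel₀ hD0
  rw [h5, ← h6, mul_pow (2 * (Real.pi : ℂ))]
  linear_combination (Complex.exp (2 * Real.pi * t * (∑ j, x j : ℝ)) *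
    Complex.exp (2 * Real.pi * δ * (∑ j, x j : ℝ)) * n.factorial * (2 * Real.pi) ^ n *
    Complex.Gamma g ^ n * F (ofRealVec l)) * h4

end RationalRuijsenaars

end

/-! ### The eigenvalue of the Baxter operator. -/

noncomputable section

namespace RationalRuijsenaars

open MeasureTheory Filter Topology

theorem continuous_baxter {g : ℝ} (hg : 0 < g) {n : ℕ} {F : (Fin n → ℂ) → ℂ}
    (hd : DifferentiableOn ℂ F (strip n (g / 2))) (hb : HasWaveBound g F) {z : ℂ}
    (hz : |z.im| < 1 / 2) :
    Continuous fun l : Fin n → ℝ => ∫ c : Fin n → ℝ,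
      kernelC g 0 (ofRealVec l) (ofRealVec c) z * F (ofRealVec c) := by
  have hg2 : 0 < g / 2 := by positivity
  obtain ⟨C, N, hC, h⟩ := exists_baxter_bound hb 0 (by simp) hg2 hg2
    (by positivity : 0 ≤ 2 * |z.im|) (by linarith) 0 |z.re| 0 2
  refine continuous_iff_continuousAt.2 fun l₀ => ?_
  refine continuousAt_of_dominated (bound := fun c => C * (weight l₀ + 1) ^ N * (weight c ^ 2)⁻¹)
    (Eventually.of_forall fun l => (integrable_baxter hg hd hb hz l).aestronglyMeasurable) ?_
    (integrable_weight_inv_sq.const_mul _) (Eventually.of_forall fun c => ?_)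
  · have : ∀ᶠ l in 𝓝 l₀, weight l < weight l₀ + 1 :=
      continuous_weight.continuousAt.eventually (gt_mem_nhds (by linarith))
    filter_upwards [this] with l hl
    refine Eventually.of_forall fun c => ?_
    have h1 := h (ofRealVec l) (ofRealVec c) (ofRealVec c) z (fun i a => by simp [ofRealVec])
      (fun a => by simp [ofRealVec]) (fun a => by simp [ofRealVec]) rfl (by simp [ofRealVec])
      le_rfl le_rfl
    rw [reVec_ofRealVec, reVec_ofRealVec] at h1
    refine h1.trans ?_
    have := weight_pos l
    have := weight_pos c
    gcongr
  · refine ContinuousAt.mul ?_ continuousAt_const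
    have h1 := differentiableAt_kernelC (g := g) 0 (l := id) (c := fun _ => ofRealVec c)
      (z := fun _ => z) (e := ofRealVec l₀) (by fun_prop) (by fun_prop) (by fun_prop)
      fun i a => by simpa [ofRealVec] using hg2
    exact ContinuousAt.comp (f := ofRealVec) h1.continuousAt continuous_ofRealVec.continuousAt

theorem hatD_mul_cancel {g : ℝ} (hg : 0 < g) (n : ℕ) :
    hatD n g * (n.factorial * (2 * Real.pi * Complex.Gamma g) ^ n) = 1 := by
  have h1 : (n.factorial : ℂ) ≠ 0 := Nat.cast_ne_zero.2 n.factorial_ne_zero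
  have h2 : (2 * Real.pi * Complex.Gamma g) ≠ 0 := by
    refine mul_ne_zero (mul_ne_zero two_ne_zero (Complex.ofReal_ne_zero.2 Real.pi_ne_zero)) ?_
    exact Complex.Gamma_ne_zero_of_re_pos (by simpa using hg)
  rw [hatD, mul_mul_mul_comm, one_div, inv_mul_cancel₀ h1, inv_mul_cancel₀ (pow_ne_zero _ h2),
    mul_one]

/-- For distinct coordinates the unknown factor is determined by comparing both asymptotics along
real `z → ∞`. Such `l` are dense and both sides are continuous in `l`. -/
theorem integral_baxter_eq {g : ℝ} (hg : 1 < g) {n : ℕ} (hn : 1 ≤ n) (x : Fin n → ℝ) {z : ℂ}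
    (hz : |z.im| < 1 / 2) (l : Fin n → ℝ) :
    hatD n g * ∫ c : Fin n → ℝ,
      kernelC g 0 (ofRealVec l) (ofRealVec c) z * waveC g n x (ofRealVec c) =
      (∏ j, kernelK g (z - x j)) * waveC g n x (ofRealVec l) := by
  have hg0 : 0 < g := by linarith
  obtain ⟨hd, hb, -⟩ := waveC_properties hg0 n hn x
  have hdense : Dense {l : Fin n → ℝ | Function.Injective l} := Measure.dense_of_ae (ae_injective n)
  have hc1 : Continuous fun l : Fin n → ℝ => hatD n g * ∫ c : Fin n → ℝ,
      kernelC g 0 (ofRealVec l) (ofRealVec c) z * waveC g n x (ofRealVec c) :=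
    continuous_const.mul (continuous_baxter hg0 hd hb hz)
  have hc2 : Continuous fun l : Fin n → ℝ =>
      (∏ j, kernelK g (z - x j)) * waveC g n x (ofRealVec l) :=
    continuous_const.mul (hd.continuousOn.comp_continuous continuous_ofRealVec
      (ofRealVec_mem_strip (by linarith)))
  refine congrFun (hc1.ext_on hdense hc2 fun l hl => ?_) l
  obtain ⟨K, hK⟩ := exists_baxter_eq_mul hg hn x l
  have h1 := (tendsto_exp_mul_prod_kernelK g x).const_mul K
  have h2 := tendsto_exp_mul_baxter hg hn x hl
  have h3 := tendsto_nhds_unique (h1.congr fun z => ?_) h2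
  · have h4 : K = n.factorial * (2 * Real.pi * Complex.Gamma g) ^ n * waveC g n x (ofRealVec l) :=
      mul_right_cancel₀ (Complex.exp_ne_zero _) (h3.trans (mul_comm _ _))
    beta_reduce
    rw [hK z hz, h4]
    linear_combination ((∏ j, kernelK g (z - x j)) * waveC g n x (ofRealVec l)) *
      hatD_mul_cancel hg0 n
  · rw [hK z (by simp)]
    ring

end RationalRuijsenaars

end

theorem theorem4p4 (g : ℝ) (hg : 1 < g) (n : ℕ) (hn : 1 ≤ n) (x : Fin n → ℝ) :
    WaveConverges g n x ∧
    (∃ F : (Fin n → ℂ) → ℂ, IsWaveContinuation g n x F) ∧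
    (∀ F : (Fin n → ℂ) → ℂ, IsWaveContinuation g n x F →
      ∀ r : ℕ, 1 ≤ r → r ≤ n →
      ∀ l ∈ tube n (g - 1), Function.Injective l →
        macdonald g n r F l =
          MvPolynomial.eval (fun j => Complex.exp (2 * Real.pi * x j))
            (MvPolynomial.esymm (Fin n) ℂ r) * F l) ∧
    (∀ z : ℂ, |z.im| < 1 / 2 → ∀ l : Fin n → ℝ,
      MeasureTheory.Integrable (fun c : Fin n → ℝ => hatKernel g l c z * wave g n x c) ∧
      baxter g n z (wave g n x) l = (∏ j, kernelK g (z - x j)) * wave g n x l) := by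
  have hg0 : 0 < g := by linarith
  obtain ⟨hd, hb, hconv⟩ := waveC_properties hg0 n hn x
  refine ⟨hconv, ⟨_, isWaveContinuation_waveTube hg0 hn x⟩,
    fun F hF r _ _ l hl hinj => macdonald_eq hg hn hF r hl hinj, fun z hz l => ⟨?_, ?_⟩⟩
  · simpa only [hatKernel_eq_kernelC, waveC_ofRealVec] using integrable_baxter hg0 hd hb hz l
  · have := integral_baxter_eq hg hn x hz l
    simpa only [baxter, hatKernel_eq_kernelC, waveC_ofRealVec] using this
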